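/- All manifolds are smooth, Hausdorff, second-countable and finite-dimensional, except that the arrow space of a Lie groupoid need be neither Hausdorff nor second-countable. Let $(X,\mathcal F)$ be a manifold of dimension $p+q$ with a smooth regular foliation of leaf dimension $p$ and codimension $q$. Let $\pi:\hat X\to X$ be a smooth covering map from a manifold $\hat X$ onto $X$ such that the pullback foliation $\hat{\mathcal F}:=\pi^{-1}(\mathcal F)$ is simple: there are a $q$-dimensional manifold $M$ (the leaf space $\hat X/\hat{\mathcal F}$) and a surjective submersion $d:\hat X\to M$ whose fibers are exactly the leaves of $\hat{\mathcal F}$ (so $(X,\mathcal F,\pi)$ is a developable foliation with developing map $d$). Let $\Gamma$ be the group of deck transformations of $\pi$, and assume that $\pi$ is Galois, i.e. $\Gamma$ acts transitively on every fiber of $\pi$. Let $h:\Gamma\to\mathrm{Diff}(M)$ be the induced action, determined by $h(\gamma)(d(\hat x))=d(\gamma\cdot\hat x)$, and let $\Psi$ be the pseudogroup on $M$ generated by $h(\Gamma)$, i.e. the smallest set of diffeomorphisms between open subsets of $M$ which contains $h(\Gamma)$ and the identity, is closed under composition, inversion and restriction to open subsets, and contains every such diffeomorphism that locally belongs to it.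 Let $\mathrm{Hol}(\mathcal F)\rightrightarrows X$ be the holonomy groupoid of $\mathcal F$: its arrows $x\to y$ are the holonomy classes of leafwise paths from $x$ to $y$ (two such paths $\sigma,\tau$ being in the same class if the holonomy of the loop $\sigma*\tau^{-1}$ is the germ of the identity), multiplication is concatenation, and its smooth structure is given by the charts $$[\sigma]\mapsto\big(\mathrm{pr}_1\varphi(\sigma(0)),\ \mathrm{pr}_2\varphi(\sigma(0)),\ \mathrm{pr}_1\psi(\sigma(1))\big)\in\mathbb R^p\times\mathbb R^q\times\mathbb R^p,$$ for $\varphi,\psi$ foliated charts with values in $\mathbb R^p\times\mathbb R^q$, defined on the set of those $[\sigma]$ from the domain of $\varphi$ to the domain of $\psi$ whose holonomy is the germ of the identity in the transverse coordinates $\mathrm{pr}_2\varphi$, $\mathrm{pr}_2\psi$. Let $G\rightrightarrows M$ be the germ groupoid of $\Psi$: its arrows are the germs $\mathrm{germ}_m\psi:m\to\psi(m)$ for $\psi\in\Psi$ and $m\in\mathrm{dom}\,\psi$, multiplication is composition of germs, and its smooth structure is given by the parametrizations $m\mapsto\mathrm{germ}_m\psi$. Then $\mathrm{Hol}(\mathcal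 F)$ and $G$ are Lie groupoids, and they are Morita equivalent: there are a Lie groupoid $K$ and smooth functors $K\to\mathrm{Hol}(\mathcal F)$ and $K\to G$, each of which is a Morita map, i.e. induces a homeomorphism of orbit spaces, isomorphisms (of Lie groups) of all isotropy groups, and isomorphisms of the normal spaces $T_xK_0/T_x\mathcal O_x$ to the orbits. -/

import Mathlib

open Set Filter Topology
open scoped Manifold ContDiff

universe u

noncomputable section

/-- Cartesian space of dimension `n`. -/
abbrev Cart (n : ℕ) : Type := EuclideanSpace ℝ (Fin n)

/-! ### Regular foliations -/

section Charts

variable {p q : ℕ} {X : Type u} [TopologicalSpace X] [ChartedSpace (Cart (p + q)) X]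

/-- A smooth chart of `X` with values in an open subset of `ℝ^p × ℝ^q`. -/
structure IsSmoothProductChart (φ : OpenPartialHomeomorph X (Cart p × Cart q)) : Prop where
  smooth : ContMDiffOn 𝓘(ℝ, Cart (p + q)) 𝓘(ℝ, Cart p × Cart q) ∞ φ φ.source
  smooth_symm : ContMDiffOn 𝓘(ℝ, Cart p × Cart q) 𝓘(ℝ, Cart (p + q)) ∞ φ.symm φ.target

/-- The change of coordinates from `φ` to `ψ` is locally of the form
`(x, y) ↦ (g (x, y), h y)`. -/
def ChartsFoliated (φ ψ : OpenPartialHomeomorph X (Cart p × Cart q)) : Prop :=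
  ∀ x ∈ φ.source ∩ ψ.source, ∃ h : Cart q → Cart q, ∀ᶠ z in 𝓝 x, (ψ z).2 = h (φ z).2

end Charts

/-- A smooth regular foliation of a `(p + q)`-dimensional manifold `X`, with leaves of dimension
`p` and codimension `q`, given by its maximal foliated atlas. -/
structure Foliation (p q : ℕ) (X : Type u) [TopologicalSpace X]
    [ChartedSpace (Cart (p + q)) X] where
  charts : Set (OpenPartialHomeomorph X (Cart p × Cart q))
  smooth : ∀ φ ∈ charts, IsSmoothProductChart φ
  covers : ∀ x, ∃ φ ∈ charts, x ∈ φ.source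
  compatible : ∀ φ ∈ charts, ∀ ψ ∈ charts, ChartsFoliated φ ψ
  maximal : ∀ φ, IsSmoothProductChart φ →
    (∀ ψ ∈ charts, ChartsFoliated φ ψ ∧ ChartsFoliated ψ φ) → φ ∈ charts

namespace Foliation

variable {p q : ℕ} {X : Type u} [TopologicalSpace X] [ChartedSpace (Cart (p + q)) X]
variable (F : Foliation p q X)

/-! ### Leaves and leafwise paths -/

/-- A path is leafwise if in every foliated chart its transverse coordinate is locally constant;
together with continuity this says that it is a continuous path in a leaf
(for the topology of the leaf). -/
def IsLeafwise (σ : unitInterval → X) : Prop :=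
  ∀ φ ∈ F.charts, ∀ t, σ t ∈ φ.source → ∀ᶠ s in 𝓝 t, (φ (σ s)).2 = (φ (σ t)).2

/-- Leafwise paths from `x` to `y`. -/
structure LeafPath (x y : X) where
  toPath : Path x y
  leafwise : F.IsLeafwise toPath

/-- `x` and `y` lie in the same leaf of `F`. -/
def SameLeaf (x y : X) : Prop := Nonempty (F.LeafPath x y)

variable {F}

lemma IsLeafwise.comp {σ : unitInterval → X} (hσ : F.IsLeafwise σ) {c : unitInterval → unitInterval} (hc : Continuous c) :
    F.IsLeafwise (σ ∘ c) := fun φ hφ t ht =>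
  hc.continuousAt.eventually (hσ φ hφ (c t) ht)

lemma IsLeafwise.glue {a b : unitInterval → X} (ha : F.IsLeafwise a) (hb : F.IsLeafwise b)
    (hab : ∀ t : unitInterval, (t : ℝ) = 1 / 2 → a t = b t) :
    F.IsLeafwise (fun t : unitInterval => if (t : ℝ) ≤ 1 / 2 then a t else b t) := by
  intro φ hφ t ht
  beta_reduce at ht ⊢
  rcases lt_trichotomy (t : ℝ) (1 / 2) with h | h | h
  · have h1 : ∀ᶠ s : unitInterval in 𝓝 t, (s : ℝ) < 1 / 2 :=
      continuous_subtype_val.continuousAt.eventually_lt continuousAt_const h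
    rw [if_pos h.le] at ht
    filter_upwards [h1, ha φ hφ t ht] with s hs1 hs2
    rw [if_pos hs1.le, if_pos h.le, hs2]
  · rw [if_pos h.le] at ht
    have ht2 : b t ∈ φ.source := hab t h ▸ ht
    filter_upwards [ha φ hφ t ht, hb φ hφ t ht2] with s hs1 hs2
    rw [if_pos h.le]
    split_ifs
    · exact hs1
    · rw [hs2, hab t h]
  · have h1 : ∀ᶠ s : unitInterval in 𝓝 t, (1 / 2 : ℝ) < s :=
      continuousAt_const.eventually_lt continuous_subtype_val.continuousAt h
    rw [if_neg h.not_ge] at ht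
    filter_upwards [h1, hb φ hφ t ht] with s hs1 hs2
    rw [if_neg hs1.not_ge, if_neg h.not_ge, hs2]

/-- Concatenation of leafwise paths: first `σ`, then `τ`. -/
def LeafPath.trans {x y z : X} (σ : F.LeafPath x y) (τ : F.LeafPath y z) : F.LeafPath x z where
  toPath := σ.toPath.trans τ.toPath
  leafwise := by
    have ha := σ.leafwise.comp (c := fun t : unitInterval => projIcc 0 1 zero_le_one (2 * (t : ℝ)))
      (continuous_projIcc.comp (by fun_prop))
    have hb := τ.leafwise.comp (c := fun t : unitInterval => projIcc 0 1 zero_le_one (2 * (t : ℝ) - 1))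
      (continuous_projIcc.comp (by fun_prop))
    refine IsLeafwise.glue ha hb ?_
    intro t ht
    simp [ht]

variable (F)

/-! ### Holonomy -/

/-- A transversal: a subset which near each of its points is a slice `{a} × ℝ^q` of a foliated
chart, i.e. an embedded submanifold of dimension `q` transverse to the leaves. -/
def IsTransversal (S : Set X) : Prop :=
  ∀ x ∈ S, ∃ φ ∈ F.charts, x ∈ φ.source ∧ ∀ z ∈ φ.source, z ∈ S ↔ (φ z).1 = (φ x).1

/-- The plaque through `z` of a chart `φ` (empty if `z` is outside the domain of `φ`). -/
def plaque (φ : OpenPartialHomeomorph X (Cart p × Cart q)) (z : X) : Set X :=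
  connectedComponentIn {w | w ∈ φ.source ∧ (φ w).2 = (φ z).2} z

/-- Sliding the points of `S` near `x` along `σ`, through a chain of plaques.
`Slides F σ S t g` says that there are times `0 ≤ t₁ ≤ ⋯ ≤ t_k = t` and foliated charts whose
domains `U_i` contain `σ [t_{i-1}, t_i]`, such that `g z` is obtained from `z ∈ S` near `x` by
moving successively inside a plaque of each `U_i`, to a point near `σ t_i` which depends
continuously on `z` at `z = x`. -/
inductive Slides {x y : X} (σ : Path x y) (S : Set X) : unitInterval → (X → X) → Prop
  | start (g : X → X) : (∀ᶠ z in 𝓝[S] x, g z = z) → Slides σ S 0 g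
  | step (s t : unitInterval) (g k : X → X) (φ : OpenPartialHomeomorph X (Cart p × Cart q)) :
      Slides σ S s g → s ≤ t → φ ∈ F.charts → (∀ r ∈ Icc s t, σ r ∈ φ.source) →
      ContinuousWithinAt k S x → k x = σ t →
      (∀ᶠ z in 𝓝[S] x, k z ∈ plaque φ (g z)) → Slides σ S t k

/-- `h` represents the holonomy germ of the path `σ` from the transversal `S` through its initial
point to the transversal `T` through its endpoint. -/
def IsHolonomy {x y : X} (σ : Path x y) (S T : Set X) (h : X → X) : Prop :=
  F.Slides σ S 1 h ∧ ∀ᶠ z in 𝓝[S] x, h z ∈ T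

/-- Two leafwise paths with the same endpoints are in the same holonomy class if the loop
`σ * τ⁻¹` has trivial holonomy. -/
def HolRel (x y : X) (σ τ : F.LeafPath x y) : Prop :=
  ∀ S : Set X, F.IsTransversal S → x ∈ S →
    F.IsHolonomy (σ.toPath.trans τ.toPath.symm) S S id

/-- Arrows of the holonomy groupoid: holonomy classes of leafwise paths. -/
structure HolArrow where
  src : X
  tgt : X
  cls : Quot (F.HolRel src tgt)

variable {F} in
/-- The holonomy class of a leafwise path. -/
def LeafPath.hol {x y : X} (σ : F.LeafPath x y) : F.HolArrow := ⟨x, y, Quot.mk _ σ⟩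

/-- The domain of the standard chart of `Hol(F)` given by two foliated charts `φ`, `ψ`: classes of
leafwise paths from the domain of `φ` to the domain of `ψ` whose holonomy is the identity in the
transverse coordinates of `φ` and `ψ`. -/
def holChartSource (φ ψ : OpenPartialHomeomorph X (Cart p × Cart q)) : Set F.HolArrow :=
  {g | g.src ∈ φ.source ∧ g.tgt ∈ ψ.source ∧ ∃ σ : F.LeafPath g.src g.tgt, g.cls = Quot.mk _ σ ∧
    ∃ (S T : Set X) (h : X → X), F.IsTransversal S ∧ g.src ∈ S ∧ F.IsTransversal T ∧ g.tgt ∈ T ∧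
      F.IsHolonomy σ.toPath S T h ∧ ∀ᶠ z in 𝓝[S] g.src, (ψ (h z)).2 = (φ z).2}

/-- The standard chart of `Hol(F)` given by `φ` and `ψ`, with values in `ℝ^p × ℝ^q × ℝ^p`. -/
def holChart (φ ψ : OpenPartialHomeomorph X (Cart p × Cart q)) (g : F.HolArrow) :
    Cart p × Cart q × Cart p :=
  ((φ g.src).1, (φ g.src).2, (ψ g.tgt).1)

end Foliation

/-! ### Lie groupoids and Morita equivalence -/

/-- A Lie groupoid with base `B` and arrow space `A`. The arrow space is a smooth manifold
which need be neither Hausdorff nor second-countable; `mul g h` is the composite `g ∘ h`. -/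
structure LieGroupoid (EB EA : Type) [NormedAddCommGroup EB] [NormedSpace ℝ EB]
    [FiniteDimensional ℝ EB] [NormedAddCommGroup EA] [NormedSpace ℝ EA] [FiniteDimensional ℝ EA]
    (B A : Type u) [TopologicalSpace B] [ChartedSpace EB B] [TopologicalSpace A]
    [ChartedSpace EA A] where
  isManifold_base : IsManifold 𝓘(ℝ, EB) ∞ B
  t2_base : T2Space B
  secondCountable_base : SecondCountableTopology B
  isManifold_arrows : IsManifold 𝓘(ℝ, EA) ∞ A
  src : A → B
  tgt : A → B
  one : B → A
  inv : A → A
  mul : (g h : A) → src g = tgt h → A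
  src_one : ∀ x, src (one x) = x
  tgt_one : ∀ x, tgt (one x) = x
  src_inv : ∀ g, src (inv g) = tgt g
  tgt_inv : ∀ g, tgt (inv g) = src g
  src_mul : ∀ g h c, src (mul g h c) = src h
  tgt_mul : ∀ g h c, tgt (mul g h c) = tgt g
  one_mul : ∀ g c, mul (one (tgt g)) g c = g
  mul_one : ∀ g c, mul g (one (src g)) c = g
  inv_mul : ∀ g c, mul (inv g) g c = one (src g)
  mul_inv : ∀ g c, mul g (inv g) c = one (tgt g)
  mul_assoc : ∀ g h k c₁ c₂ c₃ c₄, mul (mul g h c₁) k c₂ = mul g (mul h k c₃) c₄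
  smooth_one : ContMDiff 𝓘(ℝ, EB) 𝓘(ℝ, EA) ∞ one
  smooth_inv : ContMDiff 𝓘(ℝ, EA) 𝓘(ℝ, EA) ∞ inv
  submersion_src : Manifold.IsSubmersion 𝓘(ℝ, EA) 𝓘(ℝ, EB) ∞ src
  submersion_tgt : Manifold.IsSubmersion 𝓘(ℝ, EA) 𝓘(ℝ, EB) ∞ tgt
  /-- Multiplication is smooth on the submanifold of composable pairs of `A × A`:
  it takes smooth families of composable pairs to smooth families. -/
  smooth_mul : ∀ (n : ℕ) (f g : Cart n → A) (c : ∀ v, src (f v) = tgt (g v)),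
    ContMDiff 𝓘(ℝ, Cart n) 𝓘(ℝ, EA) ∞ f → ContMDiff 𝓘(ℝ, Cart n) 𝓘(ℝ, EA) ∞ g →
    ContMDiff 𝓘(ℝ, Cart n) 𝓘(ℝ, EA) ∞ (fun v => mul (f v) (g v) (c v))
  t2_src_fiber : ∀ x, T2Space {g : A // src g = x}
  t2_tgt_fiber : ∀ x, T2Space {g : A // tgt g = x}

namespace LieGroupoid

variable {EB EA EC ED : Type}
  [NormedAddCommGroup EB] [NormedSpace ℝ EB] [FiniteDimensional ℝ EB]
  [NormedAddCommGroup EA] [NormedSpace ℝ EA] [FiniteDimensional ℝ EA]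
  [NormedAddCommGroup EC] [NormedSpace ℝ EC] [FiniteDimensional ℝ EC]
  [NormedAddCommGroup ED] [NormedSpace ℝ ED] [FiniteDimensional ℝ ED]
  {B A C D : Type u}
  [TopologicalSpace B] [ChartedSpace EB B] [TopologicalSpace A] [ChartedSpace EA A]
  [TopologicalSpace C] [ChartedSpace EC C] [TopologicalSpace D] [ChartedSpace ED D]

/-- Points of the base are equivalent if there is an arrow between them, that is, if they lie in
the same orbit. -/
def orbitSetoid (G : LieGroupoid EB EA B A) : Setoid B where
  r x y := ∃ g, G.src g = x ∧ G.tgt g = y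
  iseqv :=
    { refl := fun x => ⟨G.one x, G.src_one x, G.tgt_one x⟩
      symm := by
        rintro x y ⟨g, hx, hy⟩
        exact ⟨G.inv g, (G.src_inv g).trans hy, (G.tgt_inv g).trans hx⟩
      trans := by
        rintro x y z ⟨g, hx, hy⟩ ⟨k, hk, hz⟩
        exact ⟨G.mul k g (hk.trans hy.symm), (G.src_mul _ _ _).trans hx,
          (G.tgt_mul _ _ _).trans hz⟩ }

/-- The orbit space, with the quotient topology. -/
abbrev OrbitSpace (G : LieGroupoid EB EA B A) : Type u := Quotient G.orbitSetoid

/-- The isotropy group at `x` (as a topological space; its topology is that of a subspace of the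
arrow space). -/
abbrev Isotropy (G : LieGroupoid EB EA B A) (x : B) : Type u :=
  {g : A // G.src g = x ∧ G.tgt g = x}

/-- The tangent space at `x` of the orbit through `x`: the image under `d t` of the kernel of
`d s`, at the unit of `x`. -/
def orbitTangent (G : LieGroupoid EB EA B A) (x : B) : Submodule ℝ (TangentSpace 𝓘(ℝ, EB) x) :=
  Submodule.map (M := EA) (M₂ := EB) (σ₁₂ := RingHom.id ℝ)
    (mfderiv 𝓘(ℝ, EA) 𝓘(ℝ, EB) G.tgt (G.one x)).toLinearMap
    (LinearMap.ker (M := EA) (M₂ := EB) (mfderiv 𝓘(ℝ, EA) 𝓘(ℝ, EB) G.src (G.one x)).toLinearMap)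

/-- Smooth functors between Lie groupoids. -/
structure Functor (G : LieGroupoid EB EA B A) (H : LieGroupoid EC ED C D) where
  obj : B → C
  map : A → D
  smooth_obj : ContMDiff 𝓘(ℝ, EB) 𝓘(ℝ, EC) ∞ obj
  smooth_map : ContMDiff 𝓘(ℝ, EA) 𝓘(ℝ, ED) ∞ map
  src_map : ∀ g, H.src (map g) = obj (G.src g)
  tgt_map : ∀ g, H.tgt (map g) = obj (G.tgt g)
  map_one : ∀ x, map (G.one x) = H.one (obj x)
  map_mul : ∀ g h c, map (G.mul g h c) =
    H.mul (map g) (map h) ((src_map g).trans ((congrArg obj c).trans (tgt_map h).symm))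

variable {G : LieGroupoid EB EA B A} {H : LieGroupoid EC ED C D}

/-- The homomorphism induced on isotropy groups. -/
def Functor.isotropyMap (φ : Functor G H) (x : B) : G.Isotropy x → H.Isotropy (φ.obj x) :=
  fun g => ⟨φ.map g.1, (φ.src_map g.1).trans (congrArg φ.obj g.2.1),
    (φ.tgt_map g.1).trans (congrArg φ.obj g.2.2)⟩

/-- Morita maps: smooth functors which induce a homeomorphism of orbit spaces, isomorphisms of
isotropy groups, and isomorphisms of the normal spaces to the orbits. (A bijective homomorphism of
Lie groups which is a homeomorphism is an isomorphism of Lie groups.) -/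
structure Functor.IsMorita (φ : Functor G H) : Prop where
  orbits : ∃ e : G.OrbitSpace ≃ₜ H.OrbitSpace, ∀ x : B,
    e (Quotient.mk G.orbitSetoid x) = Quotient.mk H.orbitSetoid (φ.obj x)
  isotropy : ∀ x, IsHomeomorph (φ.isotropyMap x)
  normal : ∀ x : B, ∃ c : G.orbitTangent x ≤ (H.orbitTangent (φ.obj x)).comap
      (mfderiv 𝓘(ℝ, EB) 𝓘(ℝ, EC) φ.obj x).toLinearMap,
    Function.Bijective (Submodule.mapQ _ _ _ c)

/-- Two Lie groupoids are Morita equivalent if a third one has Morita maps to both. -/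
def MoritaEquivalent (G : LieGroupoid EB EA B A) (H : LieGroupoid EC ED C D) : Prop :=
  ∃ (EK EL : Type) (_ : NormedAddCommGroup EK) (_ : NormedSpace ℝ EK)
    (_ : FiniteDimensional ℝ EK) (_ : NormedAddCommGroup EL) (_ : NormedSpace ℝ EL)
    (_ : FiniteDimensional ℝ EL) (K L : Type u) (_ : TopologicalSpace K) (_ : ChartedSpace EK K)
    (_ : TopologicalSpace L) (_ : ChartedSpace EL L) (P : LieGroupoid EK EL K L)
    (φ : Functor P G) (ψ : Functor P H), φ.IsMorita ∧ ψ.IsMorita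

end LieGroupoid

/-! ### The holonomy groupoid -/

/-- `H` is the holonomy groupoid of `F`: its arrows are the holonomy classes of leafwise paths,
multiplication is concatenation, and the standard charts belong to the smooth structure of the
arrow space. Since the standard charts cover the arrow space, this determines `H`. -/
structure IsHolonomyGroupoid {p q : ℕ} {X : Type u} [TopologicalSpace X]
    [ChartedSpace (Cart (p + q)) X] (F : Foliation p q X) [TopologicalSpace F.HolArrow]
    [ChartedSpace (Cart p × Cart q × Cart p) F.HolArrow]
    (H : LieGroupoid (Cart (p + q)) (Cart p × Cart q × Cart p) X F.HolArrow) : Prop where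
  src_eq : ∀ g, H.src g = g.src
  tgt_eq : ∀ g, H.tgt g = g.tgt
  mul_eq : ∀ {x y z : X} (σ : F.LeafPath x y) (τ : F.LeafPath y z) (c),
    H.mul τ.hol σ.hol c = (σ.trans τ).hol
  charts_covers : ∀ g, ∃ φ ∈ F.charts, ∃ ψ ∈ F.charts, g ∈ F.holChartSource φ ψ
  charts_mem : ∀ φ ∈ F.charts, ∀ ψ ∈ F.charts,
    ∃ e ∈ IsManifold.maximalAtlas 𝓘(ℝ, Cart p × Cart q × Cart p) ∞ F.HolArrow,
      e.source = F.holChartSource φ ψ ∧ EqOn e (F.holChart φ ψ) e.source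

/-! ### Pseudogroups and germ groupoids -/

/-- The pseudogroup generated by a set of transitions of `M`: the smallest one containing it.
(A pseudogroup is a structure groupoid which is closed under restriction to open subsets.) -/
def generatedPseudogroup {M : Type u} [TopologicalSpace M]
    (T : Set (OpenPartialHomeomorph M M)) : StructureGroupoid M :=
  sInf {Ψ | ClosedUnderRestriction Ψ ∧ ∀ e ∈ T, e ∈ Ψ}

/-- Arrows of the germ groupoid of `Ψ`: germs of elements of `Ψ` at points of their domains. -/
structure GermArrow {M : Type u} [TopologicalSpace M] (Ψ : StructureGroupoid M) where
  base : M
  germ : (𝓝 base).Germ M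
  exists_rep : ∃ ψ ∈ Ψ, base ∈ ψ.source ∧ germ = ((ψ : M → M) : (𝓝 base).Germ M)

/-- The germ of `ψ ∈ Ψ` at `x`. -/
def GermArrow.of {M : Type u} [TopologicalSpace M] {Ψ : StructureGroupoid M}
    (ψ : OpenPartialHomeomorph M M) (hψ : ψ ∈ Ψ) (x : M) (hx : x ∈ ψ.source) : GermArrow Ψ :=
  ⟨x, ((ψ : M → M) : (𝓝 x).Germ M), ψ, hψ, hx, rfl⟩

/-- `G` is the germ groupoid of `Ψ`: the germ of `ψ` at `x` is an arrow from `x` to `ψ x`,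
multiplication is composition of germs, and the smooth structure of the arrow space is given by
the parametrizations `x ↦ germ_x ψ`, i.e. by the charts `germ_x ψ ↦ c x` with `c` a chart of
`M`. -/
structure IsGermGroupoid {q : ℕ} {M : Type u} [TopologicalSpace M] [ChartedSpace (Cart q) M]
    (Ψ : StructureGroupoid M) [TopologicalSpace (GermArrow Ψ)]
    [ChartedSpace (Cart q) (GermArrow Ψ)]
    (G : LieGroupoid (Cart q) (Cart q) M (GermArrow Ψ)) : Prop where
  src_of : ∀ ψ hψ x hx, G.src (GermArrow.of ψ hψ x hx) = x
  tgt_of : ∀ ψ hψ x hx, G.tgt (GermArrow.of ψ hψ x hx) = ψ x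
  mul_of : ∀ ψ χ (hψ : ψ ∈ Ψ) (hχ : χ ∈ Ψ) (x : M) (hx : x ∈ ψ.source) (hy : ψ x ∈ χ.source) (c),
    G.mul (GermArrow.of χ hχ (ψ x) hy) (GermArrow.of ψ hψ x hx) c =
      GermArrow.of (ψ.trans χ) (Ψ.trans hψ hχ) x (by simp [hx, hy])
  charts_mem : ∀ ψ (hψ : ψ ∈ Ψ), ∀ c ∈ IsManifold.maximalAtlas 𝓘(ℝ, Cart q) ∞ M,
    ∃ e ∈ IsManifold.maximalAtlas 𝓘(ℝ, Cart q) ∞ (GermArrow Ψ),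
      e.source = {g | ∃ x, ∃ hx : x ∈ ψ.source, x ∈ c.source ∧ g = GermArrow.of ψ hψ x hx} ∧
      ∀ g ∈ e.source, e g = c g.base

/-! ### Covers and developable foliations -/

/-- A (smooth) cover of manifolds. -/
structure IsSmoothCover (n : ℕ) {Y X : Type u} [TopologicalSpace Y] [ChartedSpace (Cart n) Y]
    [TopologicalSpace X] [ChartedSpace (Cart n) X] (π : Y → X) : Prop where
  covering : IsCoveringMap π
  surjective : Function.Surjective π
  localDiffeo : IsLocalDiffeomorph 𝓘(ℝ, Cart n) 𝓘(ℝ, Cart n) ∞ π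

/-- The group of deck transformations of `π`. -/
def deckGroup {Y X : Type u} [TopologicalSpace Y] (π : Y → X) : Subgroup (Y ≃ₜ Y) where
  carrier := {γ | ∀ y, π (γ y) = π y}
  mul_mem' := by
    intro a b ha hb y
    exact (ha (b y)).trans (hb y)
  one_mem' := fun _ => rfl
  inv_mem' := by
    intro a ha y
    have := ha (a⁻¹ y)
    rw [← this]
    exact congrArg π (a.apply_symm_apply y)

/-- A cover is Galois if its deck transformations act transitively on each fiber. -/
structure IsGaloisCover (n : ℕ) {Y X : Type u} [TopologicalSpace Y] [ChartedSpace (Cart n) Y]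
    [TopologicalSpace X] [ChartedSpace (Cart n) X] (π : Y → X) : Prop
    extends IsSmoothCover n π where
  transitive : ∀ y z, π y = π z → ∃ γ ∈ deckGroup π, γ y = z

namespace Foliation

variable {p q : ℕ} {X Y M : Type u} [TopologicalSpace X] [ChartedSpace (Cart (p + q)) X]
  [TopologicalSpace Y] [ChartedSpace (Cart (p + q)) Y]

/-- `φ` is a foliated chart for the pullback of `F` along `π`: the transverse coordinates of `φ`
and of the charts of `F` locally determine each other. -/
structure IsPullbackChart (F : Foliation p q X) (π : Y → X)
    (φ : OpenPartialHomeomorph Y (Cart p × Cart q)) : Prop where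
  smooth : IsSmoothProductChart φ
  to_base : ∀ ψ ∈ F.charts, ∀ y ∈ φ.source, π y ∈ ψ.source →
    ∃ h : Cart q → Cart q, ∀ᶠ z in 𝓝 y, (ψ (π z)).2 = h (φ z).2
  of_base : ∀ ψ ∈ F.charts, ∀ y ∈ φ.source, π y ∈ ψ.source →
    ∃ h : Cart q → Cart q, ∀ᶠ z in 𝓝 y, (φ z).2 = h (ψ (π z)).2

lemma exists_pullbackChart (F : Foliation p q X) {π : Y → X}
    (hπ : IsLocalDiffeomorph 𝓘(ℝ, Cart (p + q)) 𝓘(ℝ, Cart (p + q)) ∞ π) (y : Y) :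
    ∃ φ, F.IsPullbackChart π φ ∧ y ∈ φ.source := by
  obtain ⟨Φ, hy, hΦ⟩ := hπ y
  obtain ⟨ψ, hψ, hyψ⟩ := F.covers (π y)
  have hs : ∀ z ∈ (Φ.toOpenPartialHomeomorph.trans ψ).source,
      z ∈ Φ.source ∧ π z = Φ z ∧ π z ∈ ψ.source := by
    intro z hz
    rw [OpenPartialHomeomorph.trans_source] at hz
    have h1 : π z = Φ z := hΦ hz.1
    exact ⟨hz.1, h1, h1 ▸ hz.2⟩
  have hev : ∀ z ∈ (Φ.toOpenPartialHomeomorph.trans ψ).source,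
      ∀ᶠ w in 𝓝 z, (Φ.toOpenPartialHomeomorph.trans ψ) w = ψ (π w) := by
    intro z hz
    filter_upwards [(Φ.toOpenPartialHomeomorph.trans ψ).open_source.mem_nhds hz] with w hw
    exact congrArg ψ (hs w hw).2.1.symm
  have hc : Continuous π := hπ.contMDiff.continuous
  refine ⟨Φ.toOpenPartialHomeomorph.trans ψ, ⟨⟨?_, ?_⟩, ?_, ?_⟩, ?_⟩
  · exact (F.smooth ψ hψ).smooth.comp (Φ.contMDiffOn_toFun.mono fun z hz => (hs z hz).1)
      (fun z hz => by
        rw [OpenPartialHomeomorph.trans_source] at hz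
        exact hz.2)
  · rw [OpenPartialHomeomorph.trans_target]
    exact Φ.contMDiffOn_invFun.comp
      ((F.smooth ψ hψ).smooth_symm.mono fun z hz => hz.1) (fun z hz => hz.2)
  · intro χ hχ z hz hzχ
    obtain ⟨h, hh⟩ := F.compatible ψ hψ χ hχ (π z) ⟨(hs z hz).2.2, hzχ⟩
    refine ⟨h, ?_⟩
    filter_upwards [hev z hz, hc.continuousAt.eventually hh] with w h1 h2
    rw [h1, h2]
  · intro χ hχ z hz hzχ
    obtain ⟨h, hh⟩ := F.compatible χ hχ ψ hψ (π z) ⟨hzχ, (hs z hz).2.2⟩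
    refine ⟨h, ?_⟩
    filter_upwards [hev z hz, hc.continuousAt.eventually hh] with w h1 h2
    rw [h1, h2]
  · rw [OpenPartialHomeomorph.trans_source]
    exact ⟨hy, show Φ y ∈ ψ.source from hΦ hy ▸ hyψ⟩

/-- The pullback foliation `π⁻¹ F` along a local diffeomorphism. -/
def pullback (F : Foliation p q X) (π : Y → X)
    (hπ : IsLocalDiffeomorph 𝓘(ℝ, Cart (p + q)) 𝓘(ℝ, Cart (p + q)) ∞ π) : Foliation p q Y where
  charts := {φ | F.IsPullbackChart π φ}
  smooth := fun _ hφ => hφ.smooth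
  covers := F.exists_pullbackChart hπ
  compatible := by
    intro φ hφ χ hχ y hy
    obtain ⟨ψ, hψ, hyψ⟩ := F.covers (π y)
    obtain ⟨h, hh⟩ := hφ.to_base ψ hψ y hy.1 hyψ
    obtain ⟨k, hk⟩ := hχ.of_base ψ hψ y hy.2 hyψ
    refine ⟨k ∘ h, ?_⟩
    filter_upwards [hh, hk] with z h1 h2
    rw [h2, h1, Function.comp]
  maximal := by
    intro φ hφ hall
    refine ⟨hφ, ?_, ?_⟩
    · intro ψ hψ y hy hyψ
      obtain ⟨χ, hχ, hyχ⟩ := F.exists_pullbackChart hπ y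
      obtain ⟨h, hh⟩ := (hall χ hχ).1 y ⟨hy, hyχ⟩
      obtain ⟨k, hk⟩ := hχ.to_base ψ hψ y hyχ hyψ
      refine ⟨k ∘ h, ?_⟩
      filter_upwards [hh, hk] with z h1 h2
      rw [h2, h1, Function.comp]
    · intro ψ hψ y hy hyψ
      obtain ⟨χ, hχ, hyχ⟩ := F.exists_pullbackChart hπ y
      obtain ⟨h, hh⟩ := (hall χ hχ).2 y ⟨hyχ, hy⟩
      obtain ⟨k, hk⟩ := hχ.of_base ψ hψ y hyχ hyψ
      refine ⟨h ∘ k, ?_⟩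
      filter_upwards [hh, hk] with z h1 h2
      rw [h1, h2, Function.comp]

/-- `d : Y → M` exhibits the manifold `M` as the leaf space of `F`, and `F` is simple: `d` is a
surjective submersion whose fibers are the leaves of `F`. -/
structure IsSimpleWith [TopologicalSpace M] [ChartedSpace (Cart q) M] (F : Foliation p q Y)
    (d : Y → M) : Prop where
  surjective : Function.Surjective d
  submersion : Manifold.IsSubmersion 𝓘(ℝ, Cart (p + q)) 𝓘(ℝ, Cart q) ∞ d
  fibers : ∀ y z, d y = d z ↔ F.SameLeaf y z

/-- `F` is developable with respect to the cover `π : Y → X`, with developing map `d : Y → M`: the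
pullback foliation is simple, with leaf space `M` and quotient map `d`. -/
structure IsDevelopable [TopologicalSpace M] [ChartedSpace (Cart q) M] (F : Foliation p q X)
    (π : Y → X) (d : Y → M) : Prop where
  cover : IsSmoothCover (p + q) π
  simple : (F.pullback π cover.localDiffeo).IsSimpleWith d

variable {F : Foliation p q X} {π : Y → X}
  {hπ : IsLocalDiffeomorph 𝓘(ℝ, Cart (p + q)) 𝓘(ℝ, Cart (p + q)) ∞ π}

lemma isLeafwise_pullback_iff {σ : unitInterval → Y} (hσ : Continuous σ) :
    (F.pullback π hπ).IsLeafwise σ ↔ F.IsLeafwise (π ∘ σ) := by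
  constructor
  · intro h ψ hψ t ht
    obtain ⟨φ, hφ, hφt⟩ := F.exists_pullbackChart hπ (σ t)
    obtain ⟨k, hk⟩ := hφ.to_base ψ hψ (σ t) hφt ht
    filter_upwards [h φ hφ t hφt, hσ.continuousAt.eventually hk] with s h1 h2
    rw [Function.comp, Function.comp, h2, h1, hk.self_of_nhds]
  · intro h φ hφ t ht
    obtain ⟨ψ, hψ, hψt⟩ := F.covers (π (σ t))
    obtain ⟨k, hk⟩ := IsPullbackChart.of_base hφ ψ hψ (σ t) ht hψt
    filter_upwards [h ψ hψ t hψt, hσ.continuousAt.eventually hk] with s h1 h2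
    have h3 : (ψ (π (σ s))).2 = (ψ (π (σ t))).2 := h1
    rw [h2, h3, hk.self_of_nhds]

/-- Deck transformations preserve the leaves of the pullback foliation. -/
lemma SameLeaf.deck {γ : Y ≃ₜ Y} (hγ : γ ∈ deckGroup π) {y z : Y}
    (h : (F.pullback π hπ).SameLeaf y z) : (F.pullback π hπ).SameLeaf (γ y) (γ z) := by
  obtain ⟨σ⟩ := h
  refine ⟨⟨σ.toPath.map γ.continuous, ?_⟩⟩
  have h1 := (isLeafwise_pullback_iff σ.toPath.continuous).1 σ.leafwise
  refine (isLeafwise_pullback_iff (σ.toPath.map γ.continuous).continuous).2 ?_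
  have h2 : π ∘ (σ.toPath.map γ.continuous) = π ∘ σ.toPath := funext fun t => hγ _
  rw [h2]
  exact h1

variable [TopologicalSpace M] [ChartedSpace (Cart q) M] {d : Y → M}

/-- The map of the leaf space `M` induced by a deck transformation. -/
def leafMap (hd : F.IsDevelopable π d) (γ : deckGroup π) (m : M) : M :=
  d (γ.1 (Function.surjInv hd.simple.surjective m))

lemma leafMap_apply (hd : F.IsDevelopable π d) (γ : deckGroup π) (y : Y) :
    leafMap hd γ (d y) = d (γ.1 y) :=
  (hd.simple.fibers _ _).2 (SameLeaf.deck γ.2 ((hd.simple.fibers _ _).1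
    (Function.surjInv_eq hd.simple.surjective (d y))))

/-- The action of the group of deck transformations on the leaf space `M`, determined by the
equivariance of the developing map: `γ • d y = d (γ y)`. -/
def leafAction (hd : F.IsDevelopable π d) : deckGroup π →* Equiv.Perm M :=
  MonoidHom.toHomPerm
    { toFun := leafMap hd
      map_one' := by
        funext m
        obtain ⟨y, rfl⟩ := hd.simple.surjective m
        exact leafMap_apply hd 1 y
      map_mul' := by
        intro a b
        funext m
        obtain ⟨y, rfl⟩ := hd.simple.surjective m
        show leafMap hd (a * b) (d y) = leafMap hd a (leafMap hd b (d y))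
        rw [leafMap_apply, leafMap_apply, leafMap_apply]
        rfl }

/-- The pseudogroup on `M` generated by the action of the deck transformations. -/
def developingPseudogroup (hd : F.IsDevelopable π d) : StructureGroupoid M :=
  generatedPseudogroup
    {e | e.source = univ ∧ ∃ γ : deckGroup π, ∀ m, e m = leafAction hd γ m}

end Foliation

end

noncomputable section

set_option linter.unusedSectionVars false

/-! ### Groupoids presented by germs -/

/-! A leafwise path in `X` lifts to a path in `Y` along which `d` is constant. If the lift starts at
`y`, and `z` is any point over the end of the path, the Galois property gives a deck transformation
`γ` carrying the end of the lift to `z`, and `h(γ)` maps `d y` to `d z`. The germ of `h(γ)` at `d y`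
is the holonomy of the path, seen in `M`: sliding through plaques preserves `d`
(`eventually_eq_of_slides`), continuous maps preserving `d` with the right endpoint are slidings
(`slides_of_eventually_eq`), and transversals have open image in `M`; so two leafwise paths have the
same holonomy class exactly when their germs agree (`holRel_iff`). Conversely, every element of `Ψ`
is locally some `h(γ)`, and since the fibers of `d` are leaves, every germ in `Ψ` from `d y` to `d
z` comes from a leafwise path. So, once lifts `y`, `z` of the endpoints are chosen, holonomy classes
are the same thing as germs in `Ψ` from `d y` to `d z`.

`GermPresentation` axiomatizes this situation: arrows over `B` are described by germs of `Ψ` after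
lifting their endpoints along a local homeomorphism `π : N → B` and applying an open map `d : N →
M`. The holonomy groupoid is presented over `Y` by the given `π` and `d`, the germ groupoid over `M`
by two identities, and the pullback `K` of the germ groupoid along `d` over `Y` by `id` and `d`.
Topology, charts, groupoid laws and orbit tangents are treated once, for presentations. In adapted
charts, whose transverse coordinate is locally equivalent to `d`, an arrow whose germ is the
identity transversally is determined by its source and target; hence a continuous map into the arrow
space is smooth as soon as its source and target are (`IsSmoothStructure.contMDiffAt`).

A map `f : N₀ → N` over `M` induces a functor which leaves the germs untouched. Orbits, isotropy and
normal spaces can all be read off in `M`, so this functor is a Morita map when `N₀ → M` is onto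
(`functor_isMorita`). The maps `id : Y → Y` and `d : Y → M` give the two Morita maps out of `K`.

The remaining task is to recognize the prescribed smooth structures. Foliated charts are exactly the
adapted charts (`eventually_snd_eq_iff`, which uses the inverse function theorem, and
`mem_charts_of_isAdaptedChart`), and the standard chart domains agree
(`chartSource_holPresentation`, `chartSource_germPresentation`). -/

lemma IsOpenMap.eventually_exists_lift {E E' B : Type*} [TopologicalSpace E] [TopologicalSpace E']
    [TopologicalSpace B] {f : E → B} (hf : IsOpenMap f) {g : E' → B} {a₀ : E} {a : E'}
    (hg : ContinuousAt g a) (h : f a₀ = g a) {Q : E × E' → Prop} (hQ : ∀ᶠ r in 𝓝 (a₀, a), Q r) :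
    ∀ᶠ b in 𝓝 a, ∃ b₀, f b₀ = g b ∧ Q (b₀, b) := by
  rw [nhds_prod_eq, eventually_prod_iff] at hQ
  obtain ⟨pa, ha, pb, hb, hQ⟩ := hQ
  have h1 : f '' {x | pa x} ∈ 𝓝 (g a) := h ▸ hf.image_mem_nhds ha
  filter_upwards [hb, hg h1] with b hb1 hb2
  obtain ⟨b₀, hb₀, hb₁⟩ := hb2
  exact ⟨b₀, hb₁, hQ hb₀ hb1⟩

lemma IsLocalHomeomorph.eventually_injective {E B : Type*} [TopologicalSpace E]
    [TopologicalSpace B] {f : E → B} (hf : IsLocalHomeomorph f) (a : E) :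
    ∀ᶠ p in 𝓝 (a, a), f p.1 = f p.2 → p.1 = p.2 := by
  obtain ⟨e, hae, rfl⟩ := hf a
  filter_upwards [prod_mem_nhds (e.open_source.mem_nhds hae) (e.open_source.mem_nhds hae)]
    with p hp h
  exact e.injOn hp.1 hp.2 h

/-- A presentation of a set `A` of arrows over `B` by germs of elements of a pseudogroup `Ψ` on
`M`, relative to a local homeomorphism `π : N → B` and an open map `d : N → M`: `Rep g y z θ`
says that, in terms of the lifts `y` and `z` of its source and its target, the arrow `g` is given
by the germ of `θ` at `d y`. -/
structure GermPresentation {B N M : Type u} [TopologicalSpace B] [TopologicalSpace N]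
    [TopologicalSpace M] (Ψ : StructureGroupoid M) (π : N → B) (d : N → M) (A : Type u) where
  src : A → B
  tgt : A → B
  Rep : A → N → N → OpenPartialHomeomorph M M → Prop
  isLocalHomeomorph : IsLocalHomeomorph π
  surjective : Function.Surjective π
  continuous_d : Continuous d
  isOpenMap_d : IsOpenMap d
  mem : ∀ {g y z θ}, Rep g y z θ → θ ∈ Ψ
  base_mem : ∀ {g y z θ}, Rep g y z θ → d y ∈ θ.source
  map_base : ∀ {g y z θ}, Rep g y z θ → θ (d y) = d z
  src_eq : ∀ {g y z θ}, Rep g y z θ → π y = src g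
  tgt_eq : ∀ {g y z θ}, Rep g y z θ → π z = tgt g
  exists_rep : ∀ {g y z}, π y = src g → π z = tgt g → ∃ θ, Rep g y z θ
  exists_arrow : ∀ {y z θ}, θ ∈ Ψ → d y ∈ θ.source → θ (d y) = d z → ∃ g, Rep g y z θ
  eq_iff : ∀ {g g' y z θ θ'}, Rep g y z θ → Rep g' y z θ' → (g = g' ↔ θ =ᶠ[𝓝 (d y)] θ')
  change : ∀ {y y'}, π y = π y' → ∃ e ∈ Ψ, d y ∈ e.source ∧ ∀ᶠ p in 𝓝 (y, y'), π p.1 = π p.2 →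
    e (d p.1) = d p.2 ∧ (∀ g z θ, Rep g p.2 z θ → Rep g p.1 z (e.trans θ)) ∧
      ∀ g z θ, Rep g z p.1 θ → Rep g z p.2 (θ.trans e)

namespace GermPresentation

variable {B N M A : Type u} [TopologicalSpace B] [TopologicalSpace N] [TopologicalSpace M]
  {Ψ : StructureGroupoid M} {π : N → B} {d : N → M} (P : GermPresentation Ψ π d A)

include P in
lemma continuous_π : Continuous π := P.isLocalHomeomorph.continuous

include P in
lemma isOpenMap_π : IsOpenMap π := P.isLocalHomeomorph.isOpenMap

/-- Only the germ at `d y` matters: `θ'` presents some arrow by `exists_arrow`, and `eq_iff`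
identifies that arrow with `g`. -/
lemma rep_congr {g : A} {y z : N} {θ θ' : OpenPartialHomeomorph M M} (h : P.Rep g y z θ)
    (hθ' : θ' ∈ Ψ) (hy : d y ∈ θ'.source) (hθ : θ' =ᶠ[𝓝 (d y)] θ) : P.Rep g y z θ' := by
  obtain ⟨g', h'⟩ := P.exists_arrow hθ' hy (hθ.self_of_nhds.trans (P.map_base h))
  rwa [(P.eq_iff h' h).2 hθ] at h'

/-- A representative of an arrow near given lifts, in terms of another representative. -/
lemma rep_shift {g : A} {y z y' z' : N} {θ θ' : OpenPartialHomeomorph M M} (h : P.Rep g y z θ)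
    (h' : P.Rep g y' z' θ') : ∀ᶠ r in 𝓝 ((y, z), (y', z')), π r.1.1 = π r.2.1 →
      π r.1.2 = π r.2.2 → ∀ k, P.Rep k r.2.1 r.2.2 θ' → P.Rep k r.1.1 r.1.2 θ := by
  obtain ⟨e, he, hey, hE⟩ := P.change ((P.src_eq h).trans (P.src_eq h').symm)
  obtain ⟨f, hf, hfz, hF⟩ := P.change ((P.tgt_eq h').trans (P.tgt_eq h).symm)
  -- Both `θ` and `f ∘ θ' ∘ e` present `g` at the lifts `y`, `z`, so they have the same germ at `d
  -- y` and therefore also the same germs at nearby points.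
  have h1 : P.Rep g y z ((e.trans θ').trans f) :=
    (hF.self_of_nhds ((P.tgt_eq h').trans (P.tgt_eq h).symm)).2.2 _ _ _
      ((hE.self_of_nhds ((P.src_eq h).trans (P.src_eq h').symm)).2.1 _ _ _ h')
  have h2 := ((P.eq_iff h h1).1 rfl).eventually_nhds
  have c1 : ContinuousAt (fun r : (N × N) × (N × N) => (r.1.1, r.2.1)) ((y, z), (y', z')) := by
    fun_prop
  have c2 : ContinuousAt (fun r : (N × N) × (N × N) => (r.2.2, r.1.2)) ((y, z), (y', z')) := by
    fun_prop
  have c3 : ContinuousAt (fun r : (N × N) × (N × N) => d r.1.1) ((y, z), (y', z')) :=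
    (P.continuous_d.comp (by fun_prop)).continuousAt
  filter_upwards [c1.eventually hE, c2.eventually hF, c3.eventually h2,
    c3.eventually (θ.open_source.mem_nhds (P.base_mem h))] with r r1 r2 r3 r4 hr1 hr2 k hk
  exact P.rep_congr ((r2 hr2.symm).2.2 _ _ _ ((r1 hr1).2.1 _ _ _ hk)) (P.mem h) r4 r3

include P in
-- Openness of `π × π` lets a property known near one pair of lifts be used near another pair over
-- the same points.
lemma eventually_exists_lift_pair {y z y' z' : N} (hy : π y = π y') (hz : π z = π z')
    {Q : (N × N) × (N × N) → Prop} (hQ : ∀ᶠ r in 𝓝 ((y, z), (y', z')), Q r) :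
    ∀ᶠ p in 𝓝 (y', z'), ∃ p₀ : N × N, π p₀.1 = π p.1 ∧ π p₀.2 = π p.2 ∧ Q (p₀, p) := by
  filter_upwards [(P.isOpenMap_π.prodMap P.isOpenMap_π).eventually_exists_lift
    (P.continuous_π.prodMap P.continuous_π).continuousAt
    (a₀ := (y, z)) (a := (y', z')) (Prod.ext hy hz) hQ] with p hp
  obtain ⟨p₀, h1, h2⟩ := hp
  exact ⟨p₀, congrArg Prod.fst h1, congrArg Prod.snd h1, h2⟩

/-! #### Adapted charts -/

section Adapted

variable {EB FP FQ : Type} [NormedAddCommGroup EB] [NormedSpace ℝ EB]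
  [NormedAddCommGroup FP] [NormedSpace ℝ FP] [NormedAddCommGroup FQ] [NormedSpace ℝ FQ]
  [ChartedSpace EB B]

/-- A smooth chart of `B` with values in a product, the second coordinate of which locally
determines, and is determined by, the map `d`. -/
structure _root_.IsAdaptedChart (π : N → B) (d : N → M)
    (φ : OpenPartialHomeomorph B (FP × FQ)) : Prop where
  smooth : ContMDiffOn 𝓘(ℝ, EB) 𝓘(ℝ, FP × FQ) ∞ φ φ.source
  smooth_symm : ContMDiffOn 𝓘(ℝ, FP × FQ) 𝓘(ℝ, EB) ∞ φ.symm φ.target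
  basic : ∀ x ∈ φ.source, ∃ y, π y = x ∧
    ∀ᶠ p in 𝓝 (y, y), (φ (π p.1)).2 = (φ (π p.2)).2 ↔ d p.1 = d p.2

variable {φ ψ : OpenPartialHomeomorph B (FP × FQ)}

include P in
-- An adapted chart is tested at a single lift of each point. The change of lift `e` is injective
-- and intertwines the values of `d`, so the equivalence passes to every other lift.
lemma eventually_basic (hφ : IsAdaptedChart (EB := EB) π d φ) {y : N} (hy : π y ∈ φ.source) :
    ∀ᶠ p in 𝓝 (y, y), (φ (π p.1)).2 = (φ (π p.2)).2 ↔ d p.1 = d p.2 := by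
  obtain ⟨y₀, hy₀, h⟩ := hφ.basic _ hy
  obtain ⟨e, he, hey, hE⟩ := P.change hy₀
  have c1 : ContinuousAt (fun r : (N × N) × (N × N) => (r.1.1, r.2.1)) ((y₀, y₀), (y, y)) := by
    fun_prop
  have c2 : ContinuousAt (fun r : (N × N) × (N × N) => (r.1.2, r.2.2)) ((y₀, y₀), (y, y)) := by
    fun_prop
  have c3 : ContinuousAt (fun r : (N × N) × (N × N) => d r.1.1) ((y₀, y₀), (y, y)) :=
    (P.continuous_d.comp (by fun_prop)).continuousAt
  have c4 : ContinuousAt (fun r : (N × N) × (N × N) => d r.1.2) ((y₀, y₀), (y, y)) :=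
    (P.continuous_d.comp (by fun_prop)).continuousAt
  have hs := e.open_source.mem_nhds hey
  have hall := (continuousAt_fst.eventually h).and <| (c1.eventually hE).and <|
    (c2.eventually hE).and <| (c3.eventually hs).and (c4.eventually hs)
  filter_upwards [P.eventually_exists_lift_pair hy₀ hy₀ hall] with p hp
  obtain ⟨p₀, h1, h2, h3, h4, h5, h6, h7⟩ := hp
  rw [← h1, ← h2, h3, ← (h4 h1).1, ← (h5 h2).1]
  exact ⟨fun h => congrArg e h, fun h => e.injOn h6 h7 h⟩

/-- The arrows which are the identity in the transverse coordinates given by `φ` and `ψ`. -/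
def chartSource (φ ψ : OpenPartialHomeomorph B (FP × FQ)) : Set A :=
  {g | P.src g ∈ φ.source ∧ P.tgt g ∈ ψ.source ∧ ∃ y z θ, P.Rep g y z θ ∧
    ∀ᶠ p in 𝓝 (y, z), θ (d p.1) = d p.2 → (φ (π p.1)).2 = (ψ (π p.2)).2}

/-- The condition defining `chartSource` does not depend on the representative: `rep_shift` moves it
from one to any other. -/
lemma chartSource_eventually {g : A} (hg : g ∈ P.chartSource φ ψ) {y z : N}
    {θ : OpenPartialHomeomorph M M} (h : P.Rep g y z θ) :
    ∀ᶠ p in 𝓝 (y, z), θ (d p.1) = d p.2 → (φ (π p.1)).2 = (ψ (π p.2)).2 := by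
  obtain ⟨-, -, y₀, z₀, θ₀, h₀, hall⟩ := hg
  have c1 : ContinuousAt (fun p : N × N => d p.1) (y, z) :=
    (P.continuous_d.comp continuous_fst).continuousAt
  filter_upwards [P.eventually_exists_lift_pair ((P.src_eq h₀).trans (P.src_eq h).symm)
    ((P.tgt_eq h₀).trans (P.tgt_eq h).symm)
    ((continuousAt_fst.eventually hall).and (P.rep_shift h₀ h)),
    c1.eventually (θ.open_source.mem_nhds (P.base_mem h))] with p ⟨p₀, h1, h2, h3, h4⟩ h5 h6
  obtain ⟨k, hk⟩ := P.exists_arrow (P.mem h) h5 h6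
  rw [← h1, ← h2]
  exact h3 (P.map_base (h4 h1 h2 k hk))

/-- The converse implication comes from openness of `d`: there is `b` near `z` with `d b = θ (d
p.1)`. If the transverse coordinates of `p.1` and `p.2` agree, then so do those of `b` and `p.2` in
`ψ`, and `ψ` being adapted gives `d b = d p.2`. -/
lemma chartSource_eventually_iff (hψ : IsAdaptedChart (EB := EB) π d ψ) {g : A}
    (hg : g ∈ P.chartSource φ ψ) {y z : N} {θ : OpenPartialHomeomorph M M} (h : P.Rep g y z θ) :
    ∀ᶠ p in 𝓝 (y, z), θ (d p.1) = d p.2 ↔ (φ (π p.1)).2 = (ψ (π p.2)).2 := by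
  have h1 := P.chartSource_eventually hg h
  have h2 := P.eventually_basic hψ (y := z) (by rw [P.tgt_eq h]; exact hg.2.1)
  have c1 : ContinuousAt (fun p : N × N => θ (d p.1)) (y, z) :=
    ContinuousAt.comp (f := fun p : N × N => d p.1) (g := θ)
      (θ.continuousAt (P.base_mem h)) (P.continuous_d.comp continuous_fst).continuousAt
  have c2 : ContinuousAt (fun r : N × (N × N) => (r.2.1, r.1)) (z, (y, z)) := by fun_prop
  have c3 : ContinuousAt (fun r : N × (N × N) => (r.1, r.2.2)) (z, (y, z)) := by fun_prop
  filter_upwards [h1, P.isOpenMap_d.eventually_exists_lift c1 (P.map_base h).symm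
    ((c2.eventually h1).and (c3.eventually h2))] with p hp1 ⟨b, hb, hb1, hb2⟩
  refine ⟨hp1, fun hp2 => ?_⟩
  rw [← hb]
  exact hb2.1 ((hb1 hb.symm).symm.trans hp2)

lemma chartSource_snd_eq {g : A} (hg : g ∈ P.chartSource φ ψ) :
    (φ (P.src g)).2 = (ψ (P.tgt g)).2 := by
  obtain ⟨y, hy⟩ := P.surjective (P.src g)
  obtain ⟨z, hz⟩ := P.surjective (P.tgt g)
  obtain ⟨θ, h⟩ := P.exists_rep hy hz
  have := (P.chartSource_eventually hg h).self_of_nhds (P.map_base h)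
  rwa [hy, hz] at this

/-- The standard chart of the arrow space. -/
def chartMap (φ ψ : OpenPartialHomeomorph B (FP × FQ)) (g : A) : FP × FQ × FP :=
  ((φ (P.src g)).1, (φ (P.src g)).2, (ψ (P.tgt g)).1)

lemma chartMap_eq {g : A} (hg : g ∈ P.chartSource φ ψ) :
    φ (P.src g) = ((P.chartMap φ ψ g).1, (P.chartMap φ ψ g).2.1) ∧
      ψ (P.tgt g) = ((P.chartMap φ ψ g).2.2, (P.chartMap φ ψ g).2.1) :=
  ⟨rfl, Prod.ext rfl (P.chartSource_snd_eq hg).symm⟩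

/-- The coordinates determine the source and the target. Over common lifts the two germs agree at
points `d a` with `a` near `y`, because each of them is the identity in the same transverse
coordinates; as `d` is open, such points fill a neighbourhood of `d y`. -/
lemma injOn_chartMap (hψ : IsAdaptedChart (EB := EB) π d ψ) :
    InjOn (P.chartMap φ ψ) (P.chartSource φ ψ) := by
  intro g hg k hk hgk
  have h1 : P.src g = P.src k := φ.injOn hg.1 hk.1 (by
    rw [(P.chartMap_eq hg).1, (P.chartMap_eq hk).1, hgk])
  have h2 : P.tgt g = P.tgt k := ψ.injOn hg.2.1 hk.2.1 (by
    rw [(P.chartMap_eq hg).2, (P.chartMap_eq hk).2, hgk])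
  obtain ⟨y, hy⟩ := P.surjective (P.src g)
  obtain ⟨z, hz⟩ := P.surjective (P.tgt g)
  obtain ⟨θ, h⟩ := P.exists_rep hy hz
  obtain ⟨θ', h'⟩ := P.exists_rep (hy.trans h1) (hz.trans h2)
  refine (P.eq_iff h h').2 ?_
  have h3 := P.chartSource_eventually_iff hψ hk h'
  have c1 : ContinuousAt (fun p : N => θ (d p)) y :=
    ContinuousAt.comp (f := d) (g := θ) (θ.continuousAt (P.base_mem h)) P.continuous_d.continuousAt
  have c2 : ContinuousAt (fun r : N × N => (r.2, r.1)) (z, y) := by fun_prop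
  have h4 : ∀ᶠ a in 𝓝 y, θ (d a) = θ' (d a) := by
    filter_upwards [P.isOpenMap_d.eventually_exists_lift c1 (P.map_base h).symm
      ((c2.eventually h3).and (c2.eventually (P.chartSource_eventually hg h)))]
      with a ⟨b, hb, hb1, hb2⟩
    exact hb.symm.trans (hb1.2 (hb2 hb.symm)).symm
  exact (P.isOpenMap_d.nhds_le y) h4

end Adapted

end GermPresentation

namespace GermPresentation

/-! #### The topology of the arrow space -/

variable {B N M A : Type u} [TopologicalSpace B] [TopologicalSpace N] [TopologicalSpace M]
  {Ψ : StructureGroupoid M} {π : N → B} {d : N → M} (P : GermPresentation Ψ π d A)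

/-- The topology of the arrow space: the arrows near `g` are given by the same element of `Ψ`
as `g`, at nearby points. -/
@[reducible] def topology : TopologicalSpace A where
  IsOpen W := ∀ g ∈ W, ∀ y z θ, P.Rep g y z θ →
    ∀ᶠ p in 𝓝 (y, z), ∀ k, P.Rep k p.1 p.2 θ → k ∈ W
  isOpen_univ := fun _ _ _ _ _ _ => Eventually.of_forall fun _ _ _ => mem_univ _
  isOpen_inter := by
    intro U V hU hV g hg y z θ h
    filter_upwards [hU g hg.1 y z θ h, hV g hg.2 y z θ h] with p h1 h2 k hk
    exact ⟨h1 k hk, h2 k hk⟩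
  isOpen_sUnion := by
    intro S hS g hg y z θ h
    obtain ⟨U, hU, hgU⟩ := hg
    filter_upwards [hS U hU g hgU y z θ h] with p h1 k hk
    exact ⟨U, hU, h1 k hk⟩

/-- The given topology of the arrow space is the one defined by the presentation. -/
def IsGermTopology [TopologicalSpace A] : Prop :=
  ∀ W : Set A, IsOpen W ↔ ∀ g ∈ W, ∀ y z θ, P.Rep g y z θ →
    ∀ᶠ p in 𝓝 (y, z), ∀ k, P.Rep k p.1 p.2 θ → k ∈ W

section Topology

variable {P} [TopologicalSpace A] (hA : P.IsGermTopology)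

include hA

/-- Neighbourhoods can be tested on a single representative, although open sets are defined by all
of them: the set of arrows presented by `θ` at lifts near which `Q` holds is open, since by
`rep_shift` arrows near one of its members in another presentation are again presented by `θ` at
nearby lifts. -/
lemma IsGermTopology.eventually_iff {g : A} {y z : N} {θ : OpenPartialHomeomorph M M}
    (h : P.Rep g y z θ) {Q : A → Prop} :
    (∀ᶠ k in 𝓝 g, Q k) ↔ ∀ᶠ p in 𝓝 (y, z), ∀ k, P.Rep k p.1 p.2 θ → Q k := by
  constructor
  · intro hQ
    obtain ⟨W, hWQ, hW, hgW⟩ := eventually_nhds_iff.1 hQ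
    filter_upwards [(hA W).1 hW g hgW y z θ h] with p hp k hk
    exact hWQ k (hp k hk)
  · intro hQ
    refine eventually_nhds_iff.2 ⟨{k | ∃ p : N × N, P.Rep k p.1 p.2 θ ∧
      ∀ᶠ p' in 𝓝 p, ∀ k, P.Rep k p'.1 p'.2 θ → Q k}, ?_, ?_, ⟨(y, z), h, hQ⟩⟩
    · rintro k ⟨p, hk, hp⟩
      exact hp.self_of_nhds k hk
    · refine (hA _).2 ?_
      rintro k ⟨⟨a, b⟩, hk, hp⟩ a' b' θ' hk'
      filter_upwards [P.eventually_exists_lift_pair ((P.src_eq hk).trans (P.src_eq hk').symm)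
        ((P.tgt_eq hk).trans (P.tgt_eq hk').symm)
        ((continuousAt_fst.eventually hp.eventually_nhds).and (P.rep_shift hk hk'))]
        with p' ⟨p₀, h1, h2, h3, h4⟩ k' hk'
      exact ⟨p₀, h4 h1 h2 k' hk', h3⟩

lemma IsGermTopology.continuous_src : Continuous P.src := by
  refine continuous_iff_continuousAt.2 fun g => ?_
  obtain ⟨y, hy⟩ := P.surjective (P.src g)
  obtain ⟨z, hz⟩ := P.surjective (P.tgt g)
  obtain ⟨θ, h⟩ := P.exists_rep hy hz
  intro U hU
  refine (hA.eventually_iff h (Q := fun k => P.src k ∈ U)).2 ?_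
  have c : ContinuousAt (fun p : N × N => π p.1) (y, z) :=
    (P.continuous_π.comp continuous_fst).continuousAt
  filter_upwards [c.eventually (show U ∈ 𝓝 (π y) by rwa [hy])] with p hp k hk
  rwa [← P.src_eq hk]

lemma IsGermTopology.continuous_tgt : Continuous P.tgt := by
  refine continuous_iff_continuousAt.2 fun g => ?_
  obtain ⟨y, hy⟩ := P.surjective (P.src g)
  obtain ⟨z, hz⟩ := P.surjective (P.tgt g)
  obtain ⟨θ, h⟩ := P.exists_rep hy hz
  intro U hU
  refine (hA.eventually_iff h (Q := fun k => P.tgt k ∈ U)).2 ?_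
  have c : ContinuousAt (fun p : N × N => π p.2) (y, z) :=
    (P.continuous_π.comp continuous_snd).continuousAt
  filter_upwards [c.eventually (show U ∈ 𝓝 (π z) by rwa [hz])] with p hp k hk
  rwa [← P.tgt_eq hk]

variable {EB FP FQ : Type} [NormedAddCommGroup EB] [NormedSpace ℝ EB]
  [NormedAddCommGroup FP] [NormedSpace ℝ FP] [NormedAddCommGroup FQ] [NormedSpace ℝ FQ]
  [ChartedSpace EB B] {φ ψ : OpenPartialHomeomorph B (FP × FQ)}

lemma IsGermTopology.isOpen_chartSource : IsOpen (P.chartSource φ ψ) := by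
  refine isOpen_iff_mem_nhds.2 fun g hg => ?_
  obtain ⟨h1, h2, y, z, θ, h, hall⟩ := hg
  filter_upwards [(hA.eventually_iff h (Q := fun k => ∃ y z θ, P.Rep k y z θ ∧
    ∀ᶠ p in 𝓝 (y, z), θ (d p.1) = d p.2 → (φ (π p.1)).2 = (ψ (π p.2)).2)).2
    (by filter_upwards [hall.eventually_nhds] with p hp k hk using ⟨_, _, _, hk, hp⟩),
    hA.continuous_src.continuousAt.eventually (φ.open_source.mem_nhds h1),
    hA.continuous_tgt.continuousAt.eventually (ψ.open_source.mem_nhds h2)] with k h3 h4 h5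
  exact ⟨h4, h5, h3⟩

lemma IsGermTopology.continuousOn_chartMap :
    ContinuousOn (P.chartMap φ ψ) (P.chartSource φ ψ) := by
  have h1 : ContinuousOn (fun g => φ (P.src g)) (P.chartSource φ ψ) :=
    φ.continuousOn.comp hA.continuous_src.continuousOn fun g hg => hg.1
  have h2 : ContinuousOn (fun g => ψ (P.tgt g)) (P.chartSource φ ψ) :=
    ψ.continuousOn.comp hA.continuous_tgt.continuousOn fun g hg => hg.2.1
  exact h1.fst.prodMk (h1.snd.prodMk h2.fst)

/-- This is openness of the chart map. For `v` near the coordinates of `g`, the points with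
coordinates `(v.1, v.2.1)` and `(v.2.2, v.2.1)` lift to a pair near `(y, z)`. Their common
transverse coordinate forces `θ` to match the values of `d`, so `θ` presents an arrow with
coordinates `v`. -/
lemma IsGermTopology.nhds_chartMap_le (hψ : IsAdaptedChart (EB := EB) π d ψ) {g : A}
    (hg : g ∈ P.chartSource φ ψ) : 𝓝 (P.chartMap φ ψ g) ≤ map (P.chartMap φ ψ) (𝓝 g) := by
  intro V hV
  obtain ⟨y, hy⟩ := P.surjective (P.src g)
  obtain ⟨z, hz⟩ := P.surjective (P.tgt g)
  obtain ⟨θ, h⟩ := P.exists_rep hy hz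
  have h1 := (hA.eventually_iff h (Q := fun k => P.chartMap φ ψ k ∈ V)).1 hV
  have h2 := P.chartSource_eventually_iff hψ hg h
  have c1 : ContinuousAt (fun p : N × N => d p.1) (y, z) :=
    (P.continuous_d.comp continuous_fst).continuousAt
  have h3 := c1.eventually (θ.open_source.mem_nhds (P.base_mem h))
  obtain ⟨e1, e2⟩ := P.chartMap_eq hg
  have m1 : ((P.chartMap φ ψ g).1, (P.chartMap φ ψ g).2.1) ∈ φ.target := by
    rw [← e1]; exact φ.map_source hg.1
  have m2 : ((P.chartMap φ ψ g).2.2, (P.chartMap φ ψ g).2.1) ∈ ψ.target := by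
    rw [← e2]; exact ψ.map_source hg.2.1
  have d1 : ContinuousAt (fun v : FP × FQ × FP => (v.1, v.2.1)) (P.chartMap φ ψ g) := by fun_prop
  have d2 : ContinuousAt (fun v : FP × FQ × FP => (v.2.2, v.2.1)) (P.chartMap φ ψ g) := by
    fun_prop
  have d3 : ContinuousAt (fun v : FP × FQ × FP => (φ.symm (v.1, v.2.1), ψ.symm (v.2.2, v.2.1)))
      (P.chartMap φ ψ g) :=
    (ContinuousAt.comp (f := fun v : FP × FQ × FP => (v.1, v.2.1)) (g := φ.symm) (φ.symm.continuousAt m1) d1).prodMk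
      (ContinuousAt.comp (f := fun v : FP × FQ × FP => (v.2.2, v.2.1)) (g := ψ.symm)
        (ψ.symm.continuousAt m2) d2)
  have e3 : Prod.map π π (y, z) = (φ.symm ((P.chartMap φ ψ g).1, (P.chartMap φ ψ g).2.1),
      ψ.symm ((P.chartMap φ ψ g).2.2, (P.chartMap φ ψ g).2.1)) := by
    rw [← e1, ← e2, φ.left_inv hg.1, ψ.left_inv hg.2.1]
    exact Prod.ext hy hz
  filter_upwards [(P.isOpenMap_π.prodMap P.isOpenMap_π).eventually_exists_lift d3 e3
    (continuousAt_fst.eventually (h1.and (h2.and h3))),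
    d1.eventually (φ.open_target.mem_nhds m1), d2.eventually (ψ.open_target.mem_nhds m2)]
    with v ⟨p, hp, p1, p2, p3⟩ hv1 hv2
  have q1 : π p.1 = φ.symm (v.1, v.2.1) := congrArg Prod.fst hp
  have q2 : π p.2 = ψ.symm (v.2.2, v.2.1) := congrArg Prod.snd hp
  obtain ⟨k, hk⟩ := P.exists_arrow (P.mem h) p3 (p2.2 (by
    rw [q1, q2, φ.right_inv hv1, ψ.right_inv hv2]))
  have : P.chartMap φ ψ k = v := by
    simp only [chartMap, ← P.src_eq hk, ← P.tgt_eq hk, q1, q2, φ.right_inv hv1, ψ.right_inv hv2]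
  exact this ▸ p1 k hk

/-- The standard charts of the arrow space. -/
lemma IsGermTopology.exists_chart (hψ : IsAdaptedChart (EB := EB) π d ψ) :
    ∃ e : OpenPartialHomeomorph A (FP × FQ × FP), e.source = P.chartSource φ ψ ∧
      (e : A → FP × FQ × FP) = P.chartMap φ ψ := by
  -- Only `Nonempty A` is needed, for the default value of the inverse map; `φ.symm 0` merely names
  -- some point of `B`, and the arrow is an identity germ.
  obtain ⟨y, -⟩ := P.surjective (φ.symm 0)
  obtain ⟨g, -⟩ := P.exists_arrow (y := y) Ψ.id_mem (mem_univ _) rfl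
  have : Nonempty A := ⟨g⟩
  refine ⟨OpenPartialHomeomorph.ofContinuousOpenRestrict
    ((P.injOn_chartMap (φ := φ) hψ).toPartialEquiv _ _) hA.continuousOn_chartMap ?_
    hA.isOpen_chartSource, rfl, rfl⟩
  refine IsOpenMap.of_nhds_le fun k => ?_
  have h1 := hA.nhds_chartMap_le hψ k.2
  rw [← map_nhds_subtype_coe_eq_nhds k.2 (hA.isOpen_chartSource.mem_nhds k.2), map_map] at h1
  exact h1

end Topology

section Smooth

variable {EB EA FP FQ : Type} [NormedAddCommGroup EB] [NormedSpace ℝ EB]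
  [NormedAddCommGroup EA] [NormedSpace ℝ EA]
  [NormedAddCommGroup FP] [NormedSpace ℝ FP] [NormedAddCommGroup FQ] [NormedSpace ℝ FQ]
  [ChartedSpace EB B]

/-- The smooth structure of the arrow space defined by the presentation. -/
structure IsSmoothStructure [TopologicalSpace A] [ChartedSpace EA A]
    (κ : EA ≃L[ℝ] FP × FQ × FP) : Prop where
  topology : P.IsGermTopology
  isManifold : IsManifold 𝓘(ℝ, EA) ∞ A
  exists_chartSource : ∀ g, ∃ φ ψ : OpenPartialHomeomorph B (FP × FQ),
    IsAdaptedChart (EB := EB) π d φ ∧ IsAdaptedChart (EB := EB) π d ψ ∧ g ∈ P.chartSource φ ψ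
  chart_mem : ∀ φ ψ : OpenPartialHomeomorph B (FP × FQ), IsAdaptedChart (EB := EB) π d φ →
    IsAdaptedChart (EB := EB) π d ψ → ∃ e ∈ IsManifold.maximalAtlas 𝓘(ℝ, EA) ∞ A,
      e.source = P.chartSource φ ψ ∧ ∀ g, κ (e g) = P.chartMap φ ψ g

lemma contDiffOn_transition {φ φ' : OpenPartialHomeomorph B (FP × FQ)}
    (hφ : IsAdaptedChart (EB := EB) π d φ) (hφ' : IsAdaptedChart (EB := EB) π d φ') :
    ContDiffOn ℝ ∞ (φ' ∘ φ.symm) (φ.target ∩ φ.symm ⁻¹' φ'.source) :=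
  contMDiffOn_iff_contDiffOn.1
    (hφ'.smooth.comp (hφ.smooth_symm.mono inter_subset_left) fun _ h => h.2)

/-- A change of standard charts sends `(a, b, c)` to the two components of `φ' ∘ φ.symm` at `(a,
b)`, followed by the first component of `ψ' ∘ ψ.symm` at `(c, b)`. Thus it is smooth because the
changes of adapted charts are. -/
lemma exists_isSmoothStructure (κ : EA ≃L[ℝ] FP × FQ × FP)
    (hcov : ∀ g, ∃ φ ψ : OpenPartialHomeomorph B (FP × FQ), IsAdaptedChart (EB := EB) π d φ ∧
      IsAdaptedChart (EB := EB) π d ψ ∧ g ∈ P.chartSource φ ψ) :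
    ∃ (_ : TopologicalSpace A) (_ : ChartedSpace EA A), P.IsSmoothStructure (EB := EB) κ := by
  let τ : TopologicalSpace A := P.topology
  have hA : P.IsGermTopology := fun W => Iff.rfl
  let S : Set (OpenPartialHomeomorph A EA) :=
    {e | ∃ φ ψ : OpenPartialHomeomorph B (FP × FQ), IsAdaptedChart (EB := EB) π d φ ∧
      IsAdaptedChart (EB := EB) π d ψ ∧ e.source = P.chartSource φ ψ ∧
      ∀ g, κ (e g) = P.chartMap φ ψ g}
  have hS : ∀ φ ψ : OpenPartialHomeomorph B (FP × FQ), IsAdaptedChart (EB := EB) π d φ →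
      IsAdaptedChart (EB := EB) π d ψ → ∃ e ∈ S, e.source = P.chartSource φ ψ ∧
      ∀ g, κ (e g) = P.chartMap φ ψ g := by
    intro φ ψ hφ hψ
    obtain ⟨e, he, he'⟩ := hA.exists_chart (φ := φ) hψ
    have h1 : (e.transHomeomorph κ.symm.toHomeomorph).source = P.chartSource φ ψ := he
    have h2 : ∀ g, κ (e.transHomeomorph κ.symm.toHomeomorph g) = P.chartMap φ ψ g := by
      intro g
      rw [← he']
      exact κ.apply_symm_apply _
    exact ⟨_, ⟨φ, ψ, hφ, hψ, h1, h2⟩, h1, h2⟩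
  have hcov' : ∀ g, ∃ e ∈ S, g ∈ e.source := by
    intro g
    obtain ⟨φ, ψ, hφ, hψ, hg⟩ := hcov g
    obtain ⟨e, he, h1, -⟩ := hS φ ψ hφ hψ
    exact ⟨e, he, h1 ▸ hg⟩
  let cs : ChartedSpace EA A :=
    { atlas := S
      chartAt := fun g => (hcov' g).choose
      mem_chart_source := fun g => (hcov' g).choose_spec.2
      chart_mem_atlas := fun g => (hcov' g).choose_spec.1 }
  have hman : IsManifold 𝓘(ℝ, EA) ∞ A := by
    refine isManifold_of_contDiffOn _ _ _ ?_
    rintro e e' ⟨φ, ψ, hφ, hψ, h1, h2⟩ ⟨φ', ψ', hφ', hψ', h1', h2'⟩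
    simp only [modelWithCornersSelf_coe, modelWithCornersSelf_coe_symm, range_id, inter_univ,
      Function.id_comp, Function.comp_id, preimage_id]
    have hsrc : ∀ v ∈ (e.symm.trans e').source, v ∈ e.target ∧
        e.symm v ∈ P.chartSource φ ψ ∧ e.symm v ∈ P.chartSource φ' ψ' := by
      intro v hv
      rw [OpenPartialHomeomorph.trans_source] at hv
      exact ⟨hv.1, h1 ▸ e.map_target hv.1, h1' ▸ hv.2⟩
    have key : ∀ v ∈ (e.symm.trans e').source,
        φ (P.src (e.symm v)) = ((κ v).1, (κ v).2.1) ∧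
          ψ (P.tgt (e.symm v)) = ((κ v).2.2, (κ v).2.1) := by
      intro v hv
      obtain ⟨a, b, -⟩ := hsrc v hv
      have := P.chartMap_eq b
      rwa [← h2, e.right_inv a] at this
    have keyφ : ∀ v ∈ (e.symm.trans e').source, ((κ v).1, (κ v).2.1) ∈ φ.target ∧
        φ.symm ((κ v).1, (κ v).2.1) = P.src (e.symm v) := by
      intro v hv
      obtain ⟨a, b, -⟩ := hsrc v hv
      rw [← (key v hv).1]
      exact ⟨φ.map_source b.1, φ.left_inv b.1⟩
    have keyψ : ∀ v ∈ (e.symm.trans e').source, ((κ v).2.2, (κ v).2.1) ∈ ψ.target ∧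
        ψ.symm ((κ v).2.2, (κ v).2.1) = P.tgt (e.symm v) := by
      intro v hv
      obtain ⟨a, b, -⟩ := hsrc v hv
      rw [← (key v hv).2]
      exact ⟨ψ.map_source b.2.1, ψ.left_inv b.2.1⟩
    have s1 : ContDiffOn ℝ ∞ (fun v => (φ' ∘ φ.symm) ((κ v).1, (κ v).2.1))
        (e.symm.trans e').source :=
      (contDiffOn_transition hφ hφ').comp (by fun_prop) fun v hv =>
        ⟨(keyφ v hv).1, by
          show φ.symm ((κ v).1, (κ v).2.1) ∈ φ'.source
          rw [(keyφ v hv).2]; exact (hsrc v hv).2.2.1⟩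
    have s2 : ContDiffOn ℝ ∞ (fun v => (ψ' ∘ ψ.symm) ((κ v).2.2, (κ v).2.1))
        (e.symm.trans e').source :=
      (contDiffOn_transition hψ hψ').comp (by fun_prop) fun v hv =>
        ⟨(keyψ v hv).1, by
          show ψ.symm ((κ v).2.2, (κ v).2.1) ∈ ψ'.source
          rw [(keyψ v hv).2]; exact (hsrc v hv).2.2.2.1⟩
    refine (κ.symm.contDiff.comp_contDiffOn (s1.fst.prodMk (s1.snd.prodMk s2.fst))).congr ?_
    intro v hv
    apply κ.injective
    simp only [Function.comp, OpenPartialHomeomorph.coe_trans, h2', κ.apply_symm_apply,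
      (keyφ v hv).2, (keyψ v hv).2]
    rfl
  refine ⟨τ, cs, hA, hman, hcov, fun φ ψ hφ hψ => ?_⟩
  obtain ⟨e, he, h⟩ := hS φ ψ hφ hψ
  exact ⟨e, IsManifold.subset_maximalAtlas he, h⟩

end Smooth

end GermPresentation

namespace GermPresentation

/-! #### The groupoid structure -/

variable {B N M A : Type u} [TopologicalSpace B] [TopologicalSpace N] [TopologicalSpace M]
  {Ψ : StructureGroupoid M} {π : N → B} {d : N → M} (P : GermPresentation Ψ π d A)

lemma exists_change {y y' : N} (h : π y = π y') : ∃ e ∈ Ψ, d y ∈ e.source ∧ e (d y) = d y' ∧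
    (∀ g z θ, P.Rep g y' z θ → P.Rep g y z (e.trans θ)) ∧
      ∀ g z θ, P.Rep g z y θ → P.Rep g z y' (θ.trans e) := by
  obtain ⟨e, he, hy, hall⟩ := P.change h
  exact ⟨e, he, hy, hall.self_of_nhds h⟩

lemma exists_reps (g : A) : ∃ y z θ, P.Rep g y z θ := by
  obtain ⟨y, hy⟩ := P.surjective (P.src g)
  obtain ⟨z, hz⟩ := P.surjective (P.tgt g)
  exact ⟨y, z, P.exists_rep hy hz⟩

/-- The identity germs at two lifts present the same arrow because any change of lift `e` satisfies
`id ∘ e = e ∘ id`. -/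
lemma exists_one (x : B) : ∃ k, ∀ y, π y = x → P.Rep k y y (OpenPartialHomeomorph.refl M) := by
  obtain ⟨y₀, hy₀⟩ := P.surjective x
  obtain ⟨k, hk⟩ := P.exists_arrow (y := y₀) Ψ.id_mem (mem_univ _) rfl
  refine ⟨k, fun y hy => ?_⟩
  obtain ⟨k', hk'⟩ := P.exists_arrow (y := y) Ψ.id_mem (mem_univ _) rfl
  obtain ⟨e, he, -, -, h1, h2⟩ := P.exists_change (hy₀.trans hy.symm)
  rwa [(P.eq_iff (h2 _ _ _ hk) (h1 _ _ _ hk')).2 (by simp)]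

/-- The inverse germ over one choice of lifts defines the arrow. For other lifts, the changes `a`
and `b` satisfy `b θ₀ = θ a` as germs, and hence `a θ₀⁻¹ = θ⁻¹ b`. -/
lemma exists_inv (g : A) : ∃ k, ∀ y z θ, P.Rep g y z θ → P.Rep k z y θ.symm := by
  have hinv : ∀ {y z θ}, P.Rep g y z θ → ∃ k, P.Rep k z y θ.symm := fun {y z θ} h =>
    P.exists_arrow (Ψ.symm (P.mem h)) (by rw [← P.map_base h]; exact θ.map_source (P.base_mem h))
      (by rw [← P.map_base h, θ.left_inv (P.base_mem h)])
  obtain ⟨y₀, z₀, θ₀, h₀⟩ := P.exists_reps g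
  obtain ⟨k, hk⟩ := hinv h₀
  refine ⟨k, fun y z θ h => ?_⟩
  obtain ⟨k', hk'⟩ := hinv h
  obtain ⟨a, ha, hay, ha', a1, a2⟩ := P.exists_change ((P.src_eq h₀).trans (P.src_eq h).symm)
  obtain ⟨b, hb, -, -, b1, b2⟩ := P.exists_change ((P.tgt_eq h₀).trans (P.tgt_eq h).symm)
  have h1 : ∀ᶠ m in 𝓝 (d y₀), b (θ₀ m) = θ (a m) :=
    (P.eq_iff (b2 _ _ _ h₀) (a1 _ _ _ h)).1 rfl
  have h2 : ∀ᶠ m in 𝓝 (d y₀), a m ∈ θ.source :=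
    (a.continuousAt hay).eventually (ha' ▸ θ.open_source.mem_nhds (P.base_mem h))
  have h3 : d z₀ ∈ θ₀.target := by
    rw [← P.map_base h₀]; exact θ₀.map_source (P.base_mem h₀)
  have h4 : Tendsto θ₀.symm (𝓝 (d z₀)) (𝓝 (d y₀)) := by
    have := θ₀.symm.continuousAt h3
    rwa [ContinuousAt, ← P.map_base h₀, θ₀.left_inv (P.base_mem h₀), P.map_base h₀] at this
  rwa [(P.eq_iff (a2 _ _ _ hk) (b1 _ _ _ hk')).2 ?_]
  filter_upwards [h4.eventually (h1.and h2), θ₀.open_target.mem_nhds h3] with m ⟨m1, m2⟩ m3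
  rw [θ₀.right_inv m3] at m1
  show a (θ₀.symm m) = θ.symm (b m)
  rw [m1, θ.left_inv m2]

/-- Independence of the lifts is the pasting of two commuting squares of germs, `b1 θ₀ = θ a1` and
`c1 θ₀' = θ' b1`. -/
lemma exists_mul {g h : A} (c : P.src g = P.tgt h) : ∃ k, ∀ y z w θ θ', P.Rep h y z θ →
    P.Rep g z w θ' → P.Rep k y w (θ.trans θ') := by
  have hmul : ∀ {y z w θ θ'}, P.Rep h y z θ → P.Rep g z w θ' → ∃ k, P.Rep k y w (θ.trans θ') :=
    fun {y z w θ θ'} h1 h2 => P.exists_arrow (Ψ.trans (P.mem h1) (P.mem h2))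
      (by simp [P.base_mem h1, P.map_base h1, P.base_mem h2])
      (by simp [P.map_base h1, P.map_base h2])
  obtain ⟨y₀, z₀, θ₀, h₀⟩ := P.exists_reps h
  obtain ⟨w₀, hw₀⟩ := P.surjective (P.tgt g)
  obtain ⟨θ₀', h₀'⟩ := P.exists_rep ((P.tgt_eq h₀).trans c.symm) hw₀
  obtain ⟨k, hk⟩ := hmul h₀ h₀'
  refine ⟨k, fun y z w θ θ' h1 h2 => ?_⟩
  obtain ⟨k', hk'⟩ := hmul h1 h2
  obtain ⟨a1, -, -, -, a2, -⟩ := P.exists_change ((P.src_eq h₀).trans (P.src_eq h1).symm)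
  obtain ⟨b1, -, -, -, b2, b3⟩ := P.exists_change ((P.tgt_eq h₀).trans (P.tgt_eq h1).symm)
  obtain ⟨c1, -, -, -, -, c3⟩ := P.exists_change ((P.tgt_eq h₀').trans (P.tgt_eq h2).symm)
  have e1 : ∀ᶠ m in 𝓝 (d y₀), b1 (θ₀ m) = θ (a1 m) :=
    (P.eq_iff (b3 _ _ _ h₀) (a2 _ _ _ h1)).1 rfl
  have e2 : ∀ᶠ m in 𝓝 (d z₀), c1 (θ₀' m) = θ' (b1 m) :=
    (P.eq_iff (c3 _ _ _ h₀') (b2 _ _ _ h2)).1 rfl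
  rwa [(P.eq_iff (c3 _ _ _ hk) (a2 _ _ _ hk')).2 ?_]
  have h4 : Tendsto θ₀ (𝓝 (d y₀)) (𝓝 (d z₀)) := by
    have := θ₀.continuousAt (P.base_mem h₀)
    rwa [ContinuousAt, P.map_base h₀] at this
  filter_upwards [e1, h4.eventually e2] with m m1 m2
  show c1 (θ₀' (θ₀ m)) = θ' (θ (a1 m))
  rw [m2, m1]

/-- The unit arrow at `x`. -/
def one (x : B) : A := (P.exists_one x).choose

/-- The inverse of an arrow. -/
def inv (g : A) : A := (P.exists_inv g).choose

/-- The composite of two arrows. -/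
def mul (g h : A) (c : P.src g = P.tgt h) : A := (P.exists_mul c).choose

lemma rep_one (y : N) : P.Rep (P.one (π y)) y y (OpenPartialHomeomorph.refl M) :=
  (P.exists_one (π y)).choose_spec y rfl

variable {P} in
lemma Rep.inv {g : A} {y z : N} {θ : OpenPartialHomeomorph M M} (h : P.Rep g y z θ) :
    P.Rep (P.inv g) z y θ.symm :=
  (P.exists_inv g).choose_spec _ _ _ h

variable {P} in
lemma Rep.mul {g h : A} (c : P.src g = P.tgt h) {y z w : N} {θ θ' : OpenPartialHomeomorph M M}
    (h1 : P.Rep h y z θ) (h2 : P.Rep g z w θ') : P.Rep (P.mul g h c) y w (θ.trans θ') :=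
  (P.exists_mul c).choose_spec _ _ _ _ _ h1 h2

lemma rep_ext {g h : A} {y z : N} {θ : OpenPartialHomeomorph M M} (h1 : P.Rep g y z θ)
    (h2 : P.Rep h y z θ) : g = h :=
  (P.eq_iff h1 h2).2 (EventuallyEq.refl _ _)

lemma src_one (x : B) : P.src (P.one x) = x := by
  obtain ⟨y, rfl⟩ := P.surjective x
  exact (P.src_eq (P.rep_one y)).symm

lemma tgt_one (x : B) : P.tgt (P.one x) = x := by
  obtain ⟨y, rfl⟩ := P.surjective x
  exact (P.tgt_eq (P.rep_one y)).symm

lemma src_inv (g : A) : P.src (P.inv g) = P.tgt g := by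
  obtain ⟨y, z, θ, h⟩ := P.exists_reps g
  rw [← P.src_eq h.inv, P.tgt_eq h]

lemma tgt_inv (g : A) : P.tgt (P.inv g) = P.src g := by
  obtain ⟨y, z, θ, h⟩ := P.exists_reps g
  rw [← P.tgt_eq h.inv, P.src_eq h]

lemma exists_reps_mul {g h : A} (c : P.src g = P.tgt h) :
    ∃ y z w θ θ', P.Rep h y z θ ∧ P.Rep g z w θ' := by
  obtain ⟨y, z, θ, h1⟩ := P.exists_reps h
  obtain ⟨w, hw⟩ := P.surjective (P.tgt g)
  obtain ⟨θ', h2⟩ := P.exists_rep ((P.tgt_eq h1).trans c.symm) hw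
  exact ⟨y, z, w, θ, θ', h1, h2⟩

lemma src_mul (g h : A) (c) : P.src (P.mul g h c) = P.src h := by
  obtain ⟨y, z, w, θ, θ', h1, h2⟩ := P.exists_reps_mul c
  rw [← P.src_eq (h1.mul c h2), P.src_eq h1]

lemma tgt_mul (g h : A) (c) : P.tgt (P.mul g h c) = P.tgt g := by
  obtain ⟨y, z, w, θ, θ', h1, h2⟩ := P.exists_reps_mul c
  rw [← P.tgt_eq (h1.mul c h2), P.tgt_eq h2]

lemma one_mul (g : A) (c) : P.mul (P.one (P.tgt g)) g c = g := by
  obtain ⟨y, z, θ, h⟩ := P.exists_reps g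
  have h1 := h.mul c (by rw [← P.tgt_eq h]; exact P.rep_one z)
  rw [OpenPartialHomeomorph.trans_refl] at h1
  exact P.rep_ext h1 h

lemma mul_one (g : A) (c) : P.mul g (P.one (P.src g)) c = g := by
  obtain ⟨y, z, θ, h⟩ := P.exists_reps g
  have h1 := Rep.mul c (by rw [← P.src_eq h]; exact P.rep_one y) h
  rw [OpenPartialHomeomorph.refl_trans] at h1
  exact P.rep_ext h1 h

lemma inv_mul (g : A) (c) : P.mul (P.inv g) g c = P.one (P.src g) := by
  obtain ⟨y, z, θ, h⟩ := P.exists_reps g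
  rw [← P.src_eq h]
  refine (P.eq_iff (h.mul c h.inv) (P.rep_one y)).2 ?_
  filter_upwards [θ.open_source.mem_nhds (P.base_mem h)] with m hm
  simp [θ.left_inv hm]

lemma mul_inv (g : A) (c) : P.mul g (P.inv g) c = P.one (P.tgt g) := by
  obtain ⟨y, z, θ, h⟩ := P.exists_reps g
  rw [← P.tgt_eq h]
  refine (P.eq_iff (h.inv.mul c h) (P.rep_one z)).2 ?_
  filter_upwards [θ.symm.open_source.mem_nhds (P.base_mem h.inv)] with m hm
  simp [θ.right_inv hm]

lemma mul_assoc (g h k : A) (c₁ c₂ c₃ c₄) :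
    P.mul (P.mul g h c₁) k c₂ = P.mul g (P.mul h k c₃) c₄ := by
  obtain ⟨y, z, w, θ, θ', h1, h2⟩ := P.exists_reps_mul c₃
  obtain ⟨v, hv⟩ := P.surjective (P.tgt g)
  obtain ⟨θ'', h3⟩ := P.exists_rep ((P.tgt_eq h2).trans c₁.symm) hv
  have e1 := h1.mul c₂ (h2.mul c₁ h3)
  rw [← OpenPartialHomeomorph.trans_assoc] at e1
  exact P.rep_ext e1 ((h1.mul c₃ h2).mul c₄ h3)

/-! #### Continuity -/

section Continuity

variable {P} [TopologicalSpace A] (hA : P.IsGermTopology)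

include hA

lemma IsGermTopology.eventually_exists_rep {g : A} {y z : N} {θ : OpenPartialHomeomorph M M}
    (h : P.Rep g y z θ) {Q : N × N → Prop} (hQ : ∀ᶠ p in 𝓝 (y, z), Q p) :
    ∀ᶠ k in 𝓝 g, ∃ p : N × N, Q p ∧ P.Rep k p.1 p.2 θ :=
  (hA.eventually_iff h).2 (hQ.mono fun p hp _ hk => ⟨p, hp, hk⟩)

lemma IsGermTopology.continuous_one : Continuous P.one := by
  refine continuous_iff_continuousAt.2 fun x => ?_
  obtain ⟨y, rfl⟩ := P.surjective x
  intro U hU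
  have h1 := (hA.eventually_iff (P.rep_one y) (Q := fun k => k ∈ U)).1 hU
  have c : ContinuousAt (fun a : N => (a, a)) y := by fun_prop
  have h2 := P.isOpenMap_π.image_mem_nhds (c.eventually h1)
  refine mem_map.2 ?_
  filter_upwards [h2] with x' ⟨a, ha, hx'⟩
  exact hx' ▸ ha _ (P.rep_one a)

lemma IsGermTopology.continuous_inv : Continuous P.inv := by
  refine continuous_iff_continuousAt.2 fun g => ?_
  obtain ⟨y, z, θ, h⟩ := P.exists_reps g
  intro U hU
  have h1 := (hA.eventually_iff h.inv (Q := fun k => k ∈ U)).1 hU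
  have c : ContinuousAt (fun p : N × N => (p.2, p.1)) (y, z) := by fun_prop
  refine mem_map.2 ?_
  filter_upwards [hA.eventually_exists_rep h (c.eventually h1)] with k ⟨p, hp, hk⟩
  exact hp _ hk.inv

/-- Nearby factors are presented by the same `θ` and `θ'`, but germs compose only if the two middle
lifts coincide. They have the same image in `B` and both are close to `z`, where `π` is injective.
-/
lemma IsGermTopology.continuousAt_mul {V : Type*} [TopologicalSpace V] {f g : V → A}
    (c : ∀ v, P.src (f v) = P.tgt (g v)) {v₀ : V} (hf : ContinuousAt f v₀)
    (hg : ContinuousAt g v₀) : ContinuousAt (fun v => P.mul (f v) (g v) (c v)) v₀ := by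
  obtain ⟨y, z, w, θ, θ', h1, h2⟩ := P.exists_reps_mul (c v₀)
  intro U hU
  have hU' := (hA.eventually_iff (h1.mul (c v₀) h2) (Q := fun k => k ∈ U)).1 hU
  rw [nhds_prod_eq, eventually_prod_iff] at hU'
  obtain ⟨Sy, hSy, Sw, hSw, hS⟩ := hU'
  have hi := P.isLocalHomeomorph.eventually_injective z
  rw [nhds_prod_eq, eventually_prod_iff] at hi
  obtain ⟨Sz, hSz, Sz', hSz', hi⟩ := hi
  refine mem_map.2 ?_
  filter_upwards [hg.eventually (hA.eventually_exists_rep h1 (Q := fun p => Sy p.1 ∧ Sz p.2)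
    (by rw [nhds_prod_eq]; exact hSy.prod_mk hSz)),
    hf.eventually (hA.eventually_exists_rep h2 (Q := fun p => Sz' p.1 ∧ Sw p.2)
    (by rw [nhds_prod_eq]; exact hSz'.prod_mk hSw))] with v ⟨p, ⟨p1, p2⟩, p3⟩ ⟨q, ⟨q1, q2⟩, q3⟩
  have e : p.2 = q.1 := hi p2 q1 ((P.tgt_eq p3).trans ((c v).symm.trans (P.src_eq q3).symm))
  exact hS p1 q2 _ (p3.mul (c v) (e ▸ q3))

/-- If `a` and `b` cannot be separated, then their targets agree and some arrow `k` is close to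
both. Since the source is fixed, the lift of the source of `k` must be `y` itself, so `k` compares
the germs of `θ` and `θ'` exactly at `d y`. Without the fixed source they would only be compared at
a nearby point, which is why the whole arrow space may fail to be Hausdorff. -/
lemma IsGermTopology.t2Space_src_fiber [T2Space B] (x : B) : T2Space {g : A // P.src g = x} := by
  refine t2_iff_nhds.2 ?_
  rintro ⟨a, ha⟩ ⟨b, hb⟩ hne
  have ca : Tendsto (fun k : {g : A // P.src g = x} => k.1) (𝓝 ⟨a, ha⟩ ⊓ 𝓝 ⟨b, hb⟩) (𝓝 a) :=
    (continuous_subtype_val.tendsto _).mono_left inf_le_left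
  have cb : Tendsto (fun k : {g : A // P.src g = x} => k.1) (𝓝 ⟨a, ha⟩ ⊓ 𝓝 ⟨b, hb⟩) (𝓝 b) :=
    (continuous_subtype_val.tendsto _).mono_left inf_le_right
  have ht : P.tgt a = P.tgt b := tendsto_nhds_unique
    ((hA.continuous_tgt.tendsto a).comp ca) ((hA.continuous_tgt.tendsto b).comp cb)
  obtain ⟨y, z, θ, h⟩ := P.exists_reps a
  obtain ⟨θ', h'⟩ := P.exists_rep ((P.src_eq h).trans (ha.trans hb.symm)) ((P.tgt_eq h).trans ht)
  have hy := P.isLocalHomeomorph.eventually_injective y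
  have c0 : ContinuousAt (fun p : N × N => (p.1, y)) (y, z) := by fun_prop
  have hi := P.isLocalHomeomorph.eventually_injective z
  rw [nhds_prod_eq, eventually_prod_iff] at hi
  obtain ⟨Sz, hSz, Sz', hSz', hi⟩ := hi
  have s1 : ∀ᶠ p : N × N in 𝓝 (y, z), Sz p.2 := continuousAt_snd.eventually hSz
  have s2 : ∀ᶠ p : N × N in 𝓝 (y, z), Sz' p.2 := continuousAt_snd.eventually hSz'
  obtain ⟨⟨k, hk⟩, ⟨p, ⟨p1, p2⟩, p3⟩, ⟨q, ⟨q1, q2⟩, q3⟩⟩ :=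
    ((ca.eventually (hA.eventually_exists_rep h ((c0.eventually hy).and s1))).and
      (cb.eventually (hA.eventually_exists_rep h' ((c0.eventually hy).and s2)))).exists
  have ep : p.1 = y := p1 ((P.src_eq p3).trans (hk.trans (ha.symm.trans (P.src_eq h).symm)))
  have eq : q.1 = y := q1 ((P.src_eq q3).trans (hk.trans (ha.symm.trans (P.src_eq h).symm)))
  have e2 : p.2 = q.2 := hi p2 q2 ((P.tgt_eq p3).trans (P.tgt_eq q3).symm)
  rw [ep, e2] at p3
  rw [eq] at q3
  exact Subtype.ext ((P.eq_iff h h').2 ((P.eq_iff p3 q3).1 rfl))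

/-- Inversion maps a target fiber continuously and injectively into a source fiber. -/
lemma IsGermTopology.t2Space_tgt_fiber [T2Space B] (x : B) : T2Space {g : A // P.tgt g = x} := by
  have := hA.t2Space_src_fiber x
  let f : {g : A // P.tgt g = x} → {g : A // P.src g = x} :=
    fun g => ⟨P.inv g.1, (P.src_inv g.1).trans g.2⟩
  refine T2Space.of_injective_continuous (f := f) ?_
    ((hA.continuous_inv.comp continuous_subtype_val).subtype_mk _)
  intro g h hgh
  have e : P.inv g.1 = P.inv h.1 := congrArg Subtype.val hgh
  obtain ⟨y, z, θ, hg⟩ := P.exists_reps g.1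
  have hsrc : P.src g.1 = P.src h.1 := by rw [← P.tgt_inv, ← P.tgt_inv, e]
  obtain ⟨θ', hh⟩ := P.exists_rep ((P.src_eq hg).trans hsrc)
    ((P.tgt_eq hg).trans (g.2.trans h.2.symm))
  have h1 : ∀ᶠ m in 𝓝 (d z), θ.symm m = θ'.symm m := (P.eq_iff hg.inv hh.inv).1 e
  refine Subtype.ext ((P.eq_iff hg hh).2 ?_)
  have c : Tendsto θ (𝓝 (d y)) (𝓝 (d z)) := by
    have := θ.continuousAt (P.base_mem hg)
    rwa [ContinuousAt, P.map_base hg] at this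
  filter_upwards [c.eventually h1, θ.open_source.mem_nhds (P.base_mem hg),
    c.eventually (θ'.symm.open_source.mem_nhds (P.base_mem hh.inv))] with m m1 m2 m3
  rw [θ.left_inv m2] at m1
  exact (θ'.right_inv m3).symm.trans (congrArg θ' m1).symm

/-- The isotropy groups are discrete. -/
lemma IsGermTopology.discrete_isotropy (x : B) :
    DiscreteTopology {g : A // P.src g = x ∧ P.tgt g = x} := by
  refine discreteTopology_iff_isOpen_singleton.2 fun g => isOpen_iff_mem_nhds.2 ?_
  intro g' hg'
  obtain rfl : g' = g := hg'
  obtain ⟨y, z, θ, h⟩ := P.exists_reps g'.1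
  have c1 : ContinuousAt (fun p : N × N => (p.1, y)) (y, z) := by fun_prop
  have c2 : ContinuousAt (fun p : N × N => (p.2, z)) (y, z) := by fun_prop
  filter_upwards [continuous_subtype_val.continuousAt.eventually (hA.eventually_exists_rep h
    ((c1.eventually (P.isLocalHomeomorph.eventually_injective y)).and
      (c2.eventually (P.isLocalHomeomorph.eventually_injective z))))] with k ⟨p, ⟨p1, p2⟩, p3⟩
  have e1 : p.1 = y := p1 ((P.src_eq p3).trans (k.2.1.trans (g'.2.1.symm.trans (P.src_eq h).symm)))
  have e2 : p.2 = z := p2 ((P.tgt_eq p3).trans (k.2.2.trans (g'.2.2.symm.trans (P.tgt_eq h).symm)))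
  rw [e1, e2] at p3
  exact Subtype.ext (P.rep_ext p3 h)

end Continuity

end GermPresentation

namespace GermPresentation

/-! #### The Lie groupoid -/

section LieGroupoid

variable {B N M A : Type u} [TopologicalSpace B] [TopologicalSpace N] [TopologicalSpace M]
  {Ψ : StructureGroupoid M} {π : N → B} {d : N → M} {P : GermPresentation Ψ π d A}
  {EB EA FP FQ : Type} [NormedAddCommGroup EB] [NormedSpace ℝ EB]
  [NormedAddCommGroup EA] [NormedSpace ℝ EA]
  [NormedAddCommGroup FP] [NormedSpace ℝ FP] [NormedAddCommGroup FQ] [NormedSpace ℝ FQ]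
  [ChartedSpace EB B] [TopologicalSpace A] [ChartedSpace EA A]
  {κ : EA ≃L[ℝ] FP × FQ × FP}

lemma _root_.IsAdaptedChart.mem_maximalAtlas [IsManifold 𝓘(ℝ, EB) ∞ B]
    {φ : OpenPartialHomeomorph B (FP × FQ)} (hφ : IsAdaptedChart (EB := EB) π d φ)
    (κB : EB ≃L[ℝ] FP × FQ) :
    φ.transHomeomorph κB.symm.toHomeomorph ∈ IsManifold.maximalAtlas 𝓘(ℝ, EB) ∞ B := by
  refine (IsManifold.mem_maximalAtlas_iff_contMDiffOn (I := 𝓘(ℝ, EB)) (n := ∞) _).2 ⟨?_, ?_⟩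
  · exact κB.symm.contDiff.contMDiff.comp_contMDiffOn hφ.smooth
  · exact hφ.smooth_symm.comp κB.contDiff.contMDiff.contMDiffOn fun v hv => hv

variable (hS : P.IsSmoothStructure (EB := EB) κ)

include hS

/-- The standard coordinates of an arrow are functions of its source and target alone; continuity is
what keeps the values in the chart domain. -/
lemma IsSmoothStructure.contMDiffAt {EV V : Type*} [NormedAddCommGroup EV] [NormedSpace ℝ EV]
    [TopologicalSpace V] [ChartedSpace EV V] {F : V → A} {v : V} (hF : ContinuousAt F v)
    (h1 : ContMDiffAt 𝓘(ℝ, EV) 𝓘(ℝ, EB) ∞ (fun v => P.src (F v)) v)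
    (h2 : ContMDiffAt 𝓘(ℝ, EV) 𝓘(ℝ, EB) ∞ (fun v => P.tgt (F v)) v) :
    ContMDiffAt 𝓘(ℝ, EV) 𝓘(ℝ, EA) ∞ F v := by
  obtain ⟨φ, ψ, hφ, hψ, hg⟩ := hS.exists_chartSource (F v)
  obtain ⟨e, he, hes, heκ⟩ := hS.chart_mem φ ψ hφ hψ
  have s1 : ContMDiffAt 𝓘(ℝ, EV) 𝓘(ℝ, FP × FQ) ∞ (fun v => φ (P.src (F v))) v :=
    (hφ.smooth.contMDiffAt (φ.open_source.mem_nhds hg.1)).comp v h1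
  have s2 : ContMDiffAt 𝓘(ℝ, EV) 𝓘(ℝ, FP × FQ) ∞ (fun v => ψ (P.tgt (F v))) v :=
    (hψ.smooth.contMDiffAt (ψ.open_source.mem_nhds hg.2.1)).comp v h2
  have hc : ContDiff ℝ ∞ (fun u : (FP × FQ) × (FP × FQ) => κ.symm (u.1.1, u.1.2, u.2.1)) := by
    fun_prop
  have s3 : ContMDiffAt 𝓘(ℝ, EV) 𝓘(ℝ, EA) ∞ (fun v => e (F v)) v := by
    refine (hc.contMDiff.contMDiffAt.comp v (s1.prodMk_space s2)).congr_of_eventuallyEq ?_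
    refine Eventually.of_forall fun v => ?_
    apply κ.injective
    rw [heκ]
    simp [chartMap]
  have hev : ∀ᶠ v' in 𝓝 v, F v' ∈ e.source :=
    hF.eventually (e.open_source.mem_nhds (hes ▸ hg))
  refine (ContMDiffAt.comp (g := e.symm) v
    (contMDiffAt_symm_of_mem_maximalAtlas he (e.map_source (hes ▸ hg))) s3).congr_of_eventuallyEq ?_
  filter_upwards [hev] with v' hv'
  exact (e.left_inv hv').symm

/-- In standard coordinates the source is `(a, b, c) ↦ (a, b)`. -/
lemma IsSmoothStructure.submersion_src [IsManifold 𝓘(ℝ, EB) ∞ B] (κB : EB ≃L[ℝ] FP × FQ) :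
    Manifold.IsSubmersionOfComplement FP 𝓘(ℝ, EA) 𝓘(ℝ, EB) ∞ P.src := by
  intro g
  obtain ⟨φ, ψ, hφ, hψ, hg⟩ := hS.exists_chartSource g
  obtain ⟨e, he, hes, heκ⟩ := hS.chart_mem φ ψ hφ hψ
  refine Manifold.IsSubmersionAtOfComplement.mk_of_continuousAt
    hS.topology.continuous_src.continuousAt
    (κ.trans ((ContinuousLinearEquiv.prodAssoc ℝ FP FQ FP).symm.trans
      (κB.symm.prodCongr (ContinuousLinearEquiv.refl ℝ FP))))
    e (φ.transHomeomorph κB.symm.toHomeomorph) (hes ▸ hg) hg.1 he (hφ.mem_maximalAtlas κB) ?_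
  intro v hv
  have hv' : v ∈ e.target := by simpa using hv
  have h1 := (P.chartMap_eq (hes ▸ e.map_target hv')).1
  rw [← heκ, e.right_inv hv'] at h1
  show κB.symm (φ (P.src (e.symm v))) = _
  rw [h1]
  rfl

lemma IsSmoothStructure.submersion_tgt [IsManifold 𝓘(ℝ, EB) ∞ B] (κB : EB ≃L[ℝ] FP × FQ) :
    Manifold.IsSubmersionOfComplement FP 𝓘(ℝ, EA) 𝓘(ℝ, EB) ∞ P.tgt := by
  intro g
  obtain ⟨φ, ψ, hφ, hψ, hg⟩ := hS.exists_chartSource g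
  obtain ⟨e, he, hes, heκ⟩ := hS.chart_mem φ ψ hφ hψ
  refine Manifold.IsSubmersionAtOfComplement.mk_of_continuousAt
    hS.topology.continuous_tgt.continuousAt
    (κ.trans ((ContinuousLinearEquiv.prodComm ℝ FP (FQ × FP)).trans
      (((ContinuousLinearEquiv.prodComm ℝ FQ FP).trans κB.symm).prodCongr
        (ContinuousLinearEquiv.refl ℝ FP))))
    e (ψ.transHomeomorph κB.symm.toHomeomorph) (hes ▸ hg) hg.2.1 he (hψ.mem_maximalAtlas κB) ?_
  intro v hv
  have hv' : v ∈ e.target := by simpa using hv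
  have h1 := (P.chartMap_eq (hes ▸ e.map_target hv')).2
  rw [← heκ, e.right_inv hv'] at h1
  show κB.symm (ψ (P.tgt (e.symm v))) = _
  rw [h1]
  rfl

/-- The Lie groupoid defined by a presentation. -/
def IsSmoothStructure.lieGroupoid [FiniteDimensional ℝ EB] [FiniteDimensional ℝ EA] [T2Space B]
    [SecondCountableTopology B] [IsManifold 𝓘(ℝ, EB) ∞ B] (κB : EB ≃L[ℝ] FP × FQ) :
    LieGroupoid EB EA B A where
  isManifold_base := inferInstance
  t2_base := inferInstance
  secondCountable_base := inferInstance
  isManifold_arrows := hS.isManifold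
  src := P.src
  tgt := P.tgt
  one := P.one
  inv := P.inv
  mul := P.mul
  src_one := P.src_one
  tgt_one := P.tgt_one
  src_inv := P.src_inv
  tgt_inv := P.tgt_inv
  src_mul := P.src_mul
  tgt_mul := P.tgt_mul
  one_mul := P.one_mul
  mul_one := P.mul_one
  inv_mul := P.inv_mul
  mul_inv := P.mul_inv
  mul_assoc := P.mul_assoc
  smooth_one := fun x => hS.contMDiffAt hS.topology.continuous_one.continuousAt
    (by simp only [P.src_one]; exact contMDiffAt_id) (by simp only [P.tgt_one]; exact contMDiffAt_id)
  smooth_inv := fun g => hS.contMDiffAt hS.topology.continuous_inv.continuousAt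
    (by simp only [P.src_inv]; exact (hS.submersion_tgt κB).contMDiff g)
    (by simp only [P.tgt_inv]; exact (hS.submersion_src κB).contMDiff g)
  submersion_src := (hS.submersion_src κB).isSubmersion
  submersion_tgt := (hS.submersion_tgt κB).isSubmersion
  smooth_mul := fun n f g c hf hg v => hS.contMDiffAt
    (hS.topology.continuousAt_mul c (hf v).continuousAt (hg v).continuousAt)
    (by simp only [P.src_mul]; exact ((hS.submersion_src κB).contMDiff _).comp v (hg v))
    (by simp only [P.tgt_mul]; exact ((hS.submersion_tgt κB).contMDiff _).comp v (hf v))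
  t2_src_fiber := hS.topology.t2Space_src_fiber
  t2_tgt_fiber := hS.topology.t2Space_tgt_fiber

omit hS in
lemma _root_.IsAdaptedChart.hasMFDerivAt_snd {φ : OpenPartialHomeomorph B (FP × FQ)}
    (hφ : IsAdaptedChart (EB := EB) π d φ) {x : B} (hx : x ∈ φ.source) :
    HasMFDerivAt 𝓘(ℝ, EB) 𝓘(ℝ, FQ) (fun x => (φ x).2) x
      ((ContinuousLinearMap.snd ℝ FP FQ).comp (mfderiv 𝓘(ℝ, EB) 𝓘(ℝ, FP × FQ) φ x)) := by
  have h1 : MDifferentiableAt 𝓘(ℝ, EB) 𝓘(ℝ, FP × FQ) φ x :=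
    (hφ.smooth.contMDiffAt (φ.open_source.mem_nhds hx)).mdifferentiableAt (by simp)
  exact ((ContinuousLinearMap.snd ℝ FP FQ).hasMFDerivAt (x := φ x)).comp x h1.hasMFDerivAt

end LieGroupoid

end GermPresentation

/-- Through `a` and `b` both quotients embed in `W`, compatibly with `f`; surjectivity of `a` makes
the first one all of `W`. -/
lemma Submodule.exists_bijective_mapQ {V V' W : Type*} [AddCommGroup V] [Module ℝ V]
    [AddCommGroup V'] [Module ℝ V'] [AddCommGroup W] [Module ℝ W] {p : Submodule ℝ V}
    {q : Submodule ℝ V'} (a : V →ₗ[ℝ] W) (b : V' →ₗ[ℝ] W) (f : V →ₗ[ℝ] V')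
    (hp : ∀ v, v ∈ p ↔ a v = 0) (hq : ∀ v, v ∈ q ↔ b v = 0) (hf : ∀ v, b (f v) = a v)
    (ha : Function.Surjective a) :
    ∃ c : p ≤ q.comap f, Function.Bijective (Submodule.mapQ p q f c) := by
  have c : p ≤ q.comap f := fun v hv => (hq _).2 ((hf v).trans ((hp v).1 hv))
  refine ⟨c, ?_, ?_⟩
  · rw [← LinearMap.ker_eq_bot, LinearMap.ker_eq_bot']
    intro v hv
    obtain ⟨v, rfl⟩ := Submodule.Quotient.mk_surjective p v
    rw [Submodule.mapQ_apply, Submodule.Quotient.mk_eq_zero, hq, hf] at hv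
    exact (Submodule.Quotient.mk_eq_zero p).2 ((hp v).2 hv)
  · intro w
    obtain ⟨w, rfl⟩ := Submodule.Quotient.mk_surjective q w
    obtain ⟨v, hv⟩ := ha (b w)
    refine ⟨Submodule.Quotient.mk v, ?_⟩
    rw [Submodule.mapQ_apply, Submodule.Quotient.eq, hq, map_sub, hf, hv, sub_self]

namespace GermPresentation

/-! #### Orbits and their tangent spaces -/

section OrbitTangent

variable {B N M A : Type u} [TopologicalSpace B] [TopologicalSpace N] [TopologicalSpace M]
  {Ψ : StructureGroupoid M} {π : N → B} {d : N → M} {P : GermPresentation Ψ π d A}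
  {EB EA FP FQ : Type} [NormedAddCommGroup EB] [NormedSpace ℝ EB]
  [NormedAddCommGroup EA] [NormedSpace ℝ EA]
  [NormedAddCommGroup FP] [NormedSpace ℝ FP] [NormedAddCommGroup FQ] [NormedSpace ℝ FQ]
  [ChartedSpace EB B] [TopologicalSpace A] [ChartedSpace EA A]
  {κ : EA ≃L[ℝ] FP × FQ × FP}

variable (P) in
lemma one_mem_chartSource {φ : OpenPartialHomeomorph B (FP × FQ)}
    (hφ : IsAdaptedChart (EB := EB) π d φ) {x : B} (hx : x ∈ φ.source) :
    P.one x ∈ P.chartSource φ φ := by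
  obtain ⟨y, rfl⟩ := P.surjective x
  refine ⟨by rwa [P.src_one], by rwa [P.tgt_one], y, y, _, P.rep_one y, ?_⟩
  filter_upwards [P.eventually_basic hφ hx] with p hp
  exact hp.2

lemma _root_.IsAdaptedChart.mfderiv_symm_apply {φ : OpenPartialHomeomorph B (FP × FQ)}
    (hφ : IsAdaptedChart (EB := EB) π d φ) {x : B} (hx : x ∈ φ.source) :
    (∀ v : EB, (mfderiv 𝓘(ℝ, FP × FQ) 𝓘(ℝ, EB) φ.symm (φ x) : FP × FQ →L[ℝ] EB)
      ((mfderiv 𝓘(ℝ, EB) 𝓘(ℝ, FP × FQ) φ x : EB →L[ℝ] FP × FQ) v) = v) ∧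
    ∀ w : FP × FQ, (mfderiv 𝓘(ℝ, EB) 𝓘(ℝ, FP × FQ) φ x : EB →L[ℝ] FP × FQ)
      ((mfderiv 𝓘(ℝ, FP × FQ) 𝓘(ℝ, EB) φ.symm (φ x) : FP × FQ →L[ℝ] EB) w) = w := by
  have h1 : MDifferentiableAt 𝓘(ℝ, EB) 𝓘(ℝ, FP × FQ) φ x :=
    (hφ.smooth.contMDiffAt (φ.open_source.mem_nhds hx)).mdifferentiableAt (by simp)
  have h2 : MDifferentiableAt 𝓘(ℝ, FP × FQ) 𝓘(ℝ, EB) φ.symm (φ x) :=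
    (hφ.smooth_symm.contMDiffAt
      (φ.open_target.mem_nhds (φ.map_source hx))).mdifferentiableAt (by simp)
  have h1' : HasMFDerivAt 𝓘(ℝ, EB) 𝓘(ℝ, FP × FQ) φ (φ.symm (φ x))
      (mfderiv 𝓘(ℝ, EB) 𝓘(ℝ, FP × FQ) φ x : EB →L[ℝ] FP × FQ) := by
    rw [φ.left_inv hx]; exact h1.hasMFDerivAt
  constructor
  · have h3 := h2.hasMFDerivAt.comp x h1.hasMFDerivAt
    have h4 : HasMFDerivAt 𝓘(ℝ, EB) 𝓘(ℝ, EB) (φ.symm ∘ φ) x (ContinuousLinearMap.id ℝ EB) :=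
      (hasMFDerivAt_id x).congr_of_eventuallyEq (φ.eventually_left_inverse hx)
    intro v
    exact congrArg (fun L : EB →L[ℝ] EB => L v) (hasMFDerivAt_unique h3 h4)
  · have h3 := h1'.comp (φ x) h2.hasMFDerivAt
    have h4 : HasMFDerivAt 𝓘(ℝ, FP × FQ) 𝓘(ℝ, FP × FQ) (φ ∘ φ.symm) (φ x)
        (ContinuousLinearMap.id ℝ (FP × FQ)) :=
      (hasMFDerivAt_id (φ x)).congr_of_eventuallyEq
        (φ.eventually_right_inverse (φ.map_source hx))
    intro v
    exact congrArg (fun L : FP × FQ →L[ℝ] FP × FQ => L v) (hasMFDerivAt_unique h3 h4)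

lemma _root_.IsAdaptedChart.surjective_mfderiv_snd {φ : OpenPartialHomeomorph B (FP × FQ)}
    (hφ : IsAdaptedChart (EB := EB) π d φ) {x : B} (hx : x ∈ φ.source) :
    Function.Surjective (mfderiv 𝓘(ℝ, EB) 𝓘(ℝ, FQ) (fun x => (φ x).2) x : EB →L[ℝ] FQ) := by
  intro w
  rw [(hφ.hasMFDerivAt_snd hx).mfderiv]
  exact ⟨_, congrArg Prod.snd ((hφ.mfderiv_symm_apply hx).2 (0, w))⟩

variable [FiniteDimensional ℝ EB] [FiniteDimensional ℝ EA] [T2Space B]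
  [SecondCountableTopology B] [IsManifold 𝓘(ℝ, EB) ∞ B]

/-- The tangent space to the orbit is the kernel of the differential of the transverse
coordinates. -/
lemma IsSmoothStructure.mem_orbitTangent_iff (hS : P.IsSmoothStructure (EB := EB) κ)
    (κB : EB ≃L[ℝ] FP × FQ) {φ : OpenPartialHomeomorph B (FP × FQ)}
    (hφ : IsAdaptedChart (EB := EB) π d φ) {x : B} (hx : x ∈ φ.source) (v : EB) :
    v ∈ (hS.lieGroupoid κB).orbitTangent x ↔
      (mfderiv 𝓘(ℝ, EB) 𝓘(ℝ, FQ) (fun x => (φ x).2) x : EB →L[ℝ] FQ) v = 0 := by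
  have hone := P.one_mem_chartSource hφ hx
  have hDs : HasMFDerivAt 𝓘(ℝ, EA) 𝓘(ℝ, EB) P.src (P.one x)
      (mfderiv 𝓘(ℝ, EA) 𝓘(ℝ, EB) P.src (P.one x)) :=
    (((hS.submersion_src κB).contMDiff _).mdifferentiableAt (by simp)).hasMFDerivAt
  have hDt : HasMFDerivAt 𝓘(ℝ, EA) 𝓘(ℝ, EB) P.tgt (P.one x)
      (mfderiv 𝓘(ℝ, EA) 𝓘(ℝ, EB) P.tgt (P.one x)) :=
    (((hS.submersion_tgt κB).contMDiff _).mdifferentiableAt (by simp)).hasMFDerivAt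
  set Ds : EA →L[ℝ] EB := mfderiv 𝓘(ℝ, EA) 𝓘(ℝ, EB) P.src (P.one x)
  set Dt : EA →L[ℝ] EB := mfderiv 𝓘(ℝ, EA) 𝓘(ℝ, EB) P.tgt (P.one x)
  have hDφ := (hφ.hasMFDerivAt_snd hx).mdifferentiableAt.hasMFDerivAt
  set Dφ : EB →L[ℝ] FQ := mfderiv 𝓘(ℝ, EB) 𝓘(ℝ, FQ) (fun x => (φ x).2) x
  have hmem : v ∈ (hS.lieGroupoid κB).orbitTangent x ↔ ∃ w : EA, Ds w = 0 ∧ Dt w = v := Iff.rfl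
  rw [hmem]
  constructor
  · rintro ⟨w, hw, rfl⟩
    have hDφs : HasMFDerivAt 𝓘(ℝ, EB) 𝓘(ℝ, FQ) (fun x => (φ x).2) (P.src (P.one x)) Dφ := by
      rw [P.src_one]; exact hDφ
    have hDφt : HasMFDerivAt 𝓘(ℝ, EB) 𝓘(ℝ, FQ) (fun x => (φ x).2) (P.tgt (P.one x)) Dφ := by
      rw [P.tgt_one]; exact hDφ
    have h1 := hDφs.comp _ hDs
    have h2 := hDφt.comp _ hDt
    -- Arrows near the unit lie in a chart domain where source and target share their transverse
    -- coordinate; differentiating this equality gives `Dφ ∘ Ds = Dφ ∘ Dt`.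
    have h3 : (fun x => (φ x).2) ∘ P.src =ᶠ[𝓝 (P.one x)] (fun x => (φ x).2) ∘ P.tgt := by
      filter_upwards [hS.topology.isOpen_chartSource.mem_nhds hone] with g hg
      exact P.chartSource_snd_eq hg
    have h4 : Dφ.comp Ds = Dφ.comp Dt := hasMFDerivAt_unique h1 (h2.congr_of_eventuallyEq h3)
    calc Dφ (Dt w) = Dφ (Ds w) := (congrArg (fun L : EA →L[ℝ] FQ => L w) h4).symm
      _ = 0 := by rw [hw, map_zero]
  · intro hv
    obtain ⟨e, he, hes, heκ⟩ := hS.chart_mem φ φ hφ hφ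
    have hone' : P.one x ∈ e.source := hes ▸ hone
    -- For the converse, `j c` is the arrow from `x` to the point with leafwise coordinate `c` and
    -- the transverse coordinate of `x`. Along `j` the source is constant, while the target sweeps
    -- out the leaf direction of `φ`.
    let i : FP → EA := fun c => κ.symm ((φ x).1, (φ x).2, c)
    let j : FP → A := fun c => e.symm (i c)
    have hi0 : i (φ x).1 = e (P.one x) := by
      apply κ.injective
      rw [heκ]
      simp [i, chartMap, P.src_one, P.tgt_one]
    have hj0 : j (φ x).1 = P.one x := by
      show e.symm (i (φ x).1) = _
      rw [hi0, e.left_inv hone']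
    have hic : ContDiff ℝ ∞ i := by fun_prop
    have hj : ContMDiffAt 𝓘(ℝ, FP) 𝓘(ℝ, EA) ∞ j (φ x).1 :=
      ContMDiffAt.comp (g := e.symm) _ (by
        rw [hi0]; exact contMDiffAt_symm_of_mem_maximalAtlas he (e.map_source hone'))
        hic.contMDiff.contMDiffAt
    have hjm := (hj.mdifferentiableAt (by simp)).hasMFDerivAt
    set Dj : FP →L[ℝ] EA := mfderiv 𝓘(ℝ, FP) 𝓘(ℝ, EA) j (φ x).1
    have hev : ∀ᶠ c in 𝓝 (φ x).1, i c ∈ e.target :=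
      hic.continuous.continuousAt.eventually
        (e.open_target.mem_nhds (by rw [hi0]; exact e.map_source hone'))
    have hjc : ∀ c, i c ∈ e.target →
        P.src (j c) = x ∧ P.tgt (j c) = φ.symm (c, (φ x).2) := by
      intro c hc
      have h1 : j c ∈ P.chartSource φ φ := hes ▸ e.map_target hc
      have h2 := P.chartMap_eq h1
      have h3 : P.chartMap φ φ (j c) = ((φ x).1, (φ x).2, c) := by
        rw [← heκ]
        show κ (e (e.symm (i c))) = _
        rw [e.right_inv hc]
        exact κ.apply_symm_apply _
      rw [h3] at h2
      refine ⟨φ.injOn h1.1 hx h2.1, ?_⟩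
      rw [← φ.left_inv h1.2.1, h2.2]
    have hDs' : HasMFDerivAt 𝓘(ℝ, EA) 𝓘(ℝ, EB) P.src (j (φ x).1) Ds := by
      rw [hj0]; exact hDs
    have hDt' : HasMFDerivAt 𝓘(ℝ, EA) 𝓘(ℝ, EB) P.tgt (j (φ x).1) Dt := by
      rw [hj0]; exact hDt
    have hs : HasMFDerivAt 𝓘(ℝ, FP) 𝓘(ℝ, EB) (P.src ∘ j) (φ x).1 (0 : FP →L[ℝ] EB) :=
      (hasMFDerivAt_const x _).congr_of_eventuallyEq (hev.mono fun c hc => (hjc c hc).1)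
    have hφs : HasMFDerivAt 𝓘(ℝ, FP × FQ) 𝓘(ℝ, EB) φ.symm ((φ x).1, (φ x).2)
        (mfderiv 𝓘(ℝ, FP × FQ) 𝓘(ℝ, EB) φ.symm (φ x)) :=
      ((hφ.smooth_symm.contMDiffAt
        (φ.open_target.mem_nhds (φ.map_source hx))).mdifferentiableAt (by simp)).hasMFDerivAt
    set L : FP × FQ →L[ℝ] EB := mfderiv 𝓘(ℝ, FP × FQ) 𝓘(ℝ, EB) φ.symm (φ x)
    have hin : HasMFDerivAt 𝓘(ℝ, FP) 𝓘(ℝ, FP × FQ) (fun c => (c, (φ x).2)) (φ x).1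
        (ContinuousLinearMap.inl ℝ FP FQ) := by
      refine HasFDerivAt.hasMFDerivAt ?_
      exact (hasFDerivAt_id _).prodMk (hasFDerivAt_const _ _)
    have ht : HasMFDerivAt 𝓘(ℝ, FP) 𝓘(ℝ, EB) (P.tgt ∘ j) (φ x).1
        (L.comp (ContinuousLinearMap.inl ℝ FP FQ)) :=
      (HasMFDerivAt.comp (f := fun c : FP => (c, (φ x).2)) (φ x).1 hφs hin).congr_of_eventuallyEq (hev.mono fun c hc => (hjc c hc).2)
    have e1 : Ds.comp Dj = 0 := hasMFDerivAt_unique (hDs'.comp _ hjm) hs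
    have e2 : Dt.comp Dj = L.comp (ContinuousLinearMap.inl ℝ FP FQ) :=
      hasMFDerivAt_unique (hDt'.comp _ hjm) ht
    have e3 := (hφ.mfderiv_symm_apply hx).1 v
    have e4 : ((mfderiv 𝓘(ℝ, EB) 𝓘(ℝ, FP × FQ) φ x : EB →L[ℝ] FP × FQ) v).2 = 0 := by
      have h5 : Dφ = (ContinuousLinearMap.snd ℝ FP FQ).comp
        (mfderiv 𝓘(ℝ, EB) 𝓘(ℝ, FP × FQ) φ x : EB →L[ℝ] FP × FQ) :=
        (hφ.hasMFDerivAt_snd hx).mfderiv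
      rw [h5] at hv
      exact hv
    refine ⟨Dj ((mfderiv 𝓘(ℝ, EB) 𝓘(ℝ, FP × FQ) φ x : EB →L[ℝ] FP × FQ) v).1,
      congrArg (fun T : FP →L[ℝ] EB => T _) e1, ?_⟩
    refine (congrArg (fun T : FP →L[ℝ] EB => T _) e2).trans (Eq.trans ?_ e3)
    exact congrArg L (Prod.ext rfl e4.symm)

end OrbitTangent

end GermPresentation

/-! ### Supply of adapted charts, and smooth pseudogroups -/

/-- Every chart of `M` is, locally, the second coordinate of an adapted chart of `B`. -/
def HasAdaptedCharts (EB FP : Type) {FQ : Type} [NormedAddCommGroup EB] [NormedSpace ℝ EB]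
    [NormedAddCommGroup FP] [NormedSpace ℝ FP] [NormedAddCommGroup FQ] [NormedSpace ℝ FQ]
    {B N M : Type u} [TopologicalSpace B] [TopologicalSpace N] [TopologicalSpace M]
    [ChartedSpace EB B] [ChartedSpace FQ M] (π : N → B) (d : N → M) : Prop :=
  ∀ y, ∀ c ∈ IsManifold.maximalAtlas 𝓘(ℝ, FQ) ∞ M, d y ∈ c.source →
    ∃ φ : OpenPartialHomeomorph B (FP × FQ), IsAdaptedChart (EB := EB) π d φ ∧ π y ∈ φ.source ∧
      ∀ᶠ y' in 𝓝 y, (φ (π y')).2 = c (d y')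

/-- The elements of a pseudogroup are smooth. -/
def IsSmoothPseudogroup {FQ : Type} [NormedAddCommGroup FQ] [NormedSpace ℝ FQ] {M : Type u}
    [TopologicalSpace M] [ChartedSpace FQ M] (Ψ : StructureGroupoid M) : Prop :=
  ∀ θ ∈ Ψ, ContMDiffOn 𝓘(ℝ, FQ) 𝓘(ℝ, FQ) ∞ θ θ.source

lemma IsSmoothPseudogroup.trans_mem_maximalAtlas {FQ : Type} [NormedAddCommGroup FQ]
    [NormedSpace ℝ FQ] {M : Type u} [TopologicalSpace M] [ChartedSpace FQ M]
    [IsManifold 𝓘(ℝ, FQ) ∞ M] {Ψ : StructureGroupoid M} (hΨ : IsSmoothPseudogroup (FQ := FQ) Ψ)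
    {θ : OpenPartialHomeomorph M M} (hθ : θ ∈ Ψ) {c : OpenPartialHomeomorph M FQ}
    (hc : c ∈ IsManifold.maximalAtlas 𝓘(ℝ, FQ) ∞ M) :
    θ.trans c ∈ IsManifold.maximalAtlas 𝓘(ℝ, FQ) ∞ M := by
  obtain ⟨h1, h2⟩ := (IsManifold.mem_maximalAtlas_iff_contMDiffOn (I := 𝓘(ℝ, FQ)) (n := ∞) c).1 hc
  refine (IsManifold.mem_maximalAtlas_iff_contMDiffOn (I := 𝓘(ℝ, FQ)) (n := ∞) _).2 ⟨?_, ?_⟩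
  · rw [OpenPartialHomeomorph.trans_source]
    exact h1.comp ((hΨ θ hθ).mono inter_subset_left) fun _ h => h.2
  · rw [OpenPartialHomeomorph.trans_target]
    exact (hΨ θ.symm (Ψ.symm hθ)).comp (h2.mono inter_subset_left) fun _ h => h.2

namespace GermPresentation

variable {FQ : Type} [NormedAddCommGroup FQ] [NormedSpace ℝ FQ]
  {M : Type u} [TopologicalSpace M] [ChartedSpace FQ M] [IsManifold 𝓘(ℝ, FQ) ∞ M]
  {Ψ : StructureGroupoid M}

/-- With `c` a chart of `M` at `d z`, the composite `c ∘ θ` is a chart at `d y`, and `θ` is the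
identity from the coordinates `c ∘ θ` to the coordinates `c`. Adapted charts realizing these two as
transverse coordinates do the job. -/
lemma exists_mem_chartSource {EB FP : Type} [NormedAddCommGroup EB] [NormedSpace ℝ EB]
    [NormedAddCommGroup FP] [NormedSpace ℝ FP] {B N A : Type u} [TopologicalSpace B]
    [TopologicalSpace N] [ChartedSpace EB B] {π : N → B} {d : N → M}
    (P : GermPresentation Ψ π d A) (hΨ : IsSmoothPseudogroup (FQ := FQ) Ψ)
    (hC : HasAdaptedCharts EB FP (FQ := FQ) π d) (g : A) :
    ∃ φ ψ : OpenPartialHomeomorph B (FP × FQ), IsAdaptedChart (EB := EB) π d φ ∧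
      IsAdaptedChart (EB := EB) π d ψ ∧ g ∈ P.chartSource φ ψ := by
  obtain ⟨y, z, θ, h⟩ := P.exists_reps g
  have hc := IsManifold.chart_mem_maximalAtlas (I := 𝓘(ℝ, FQ)) (n := ∞) (d z)
  obtain ⟨ψ, hψ, hz, hψz⟩ := hC z _ hc (mem_chart_source FQ (d z))
  obtain ⟨φ, hφ, hy, hφy⟩ := hC y _ (hΨ.trans_mem_maximalAtlas (P.mem h) hc) (by
    rw [OpenPartialHomeomorph.trans_source]
    exact ⟨P.base_mem h, by rw [mem_preimage, P.map_base h]; exact mem_chart_source FQ (d z)⟩)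
  refine ⟨φ, ψ, hφ, hψ, P.src_eq h ▸ hy, P.tgt_eq h ▸ hz, y, z, θ, h, ?_⟩
  filter_upwards [continuousAt_fst.eventually hφy, continuousAt_snd.eventually hψz]
    with p h1 h2 h3
  rw [h1, h2, ← h3]
  rfl

/-! #### Morita maps -/

section Morita

variable {N₀ A₀ B N A : Type u} [TopologicalSpace N₀] [TopologicalSpace B] [TopologicalSpace N]
  {d₀ : N₀ → M} {π : N → B} {d : N → M}
  (Q : GermPresentation Ψ (id : N₀ → N₀) d₀ A₀) (P : GermPresentation Ψ π d A)
  {f : N₀ → N} (hf : ∀ y, d (f y) = d₀ y)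

include hf in
-- The presentation `Q` has identity lifts, so its lifts are unique, and `d ∘ f = d₀` allows the
-- same `θ` to be used over `f y` and `f z`.
lemma exists_map (g : A₀) : ∃ k, ∀ y z θ, Q.Rep g y z θ → P.Rep k (f y) (f z) θ := by
  obtain ⟨y, z, θ, h⟩ := Q.exists_reps g
  obtain ⟨k, hk⟩ := P.exists_arrow (y := f y) (z := f z) (Q.mem h)
    (by rw [hf]; exact Q.base_mem h) (by rw [hf, hf]; exact Q.map_base h)
  refine ⟨k, fun y' z' θ' h' => ?_⟩
  obtain rfl : y = y' := (Q.src_eq h).trans (Q.src_eq h').symm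
  obtain rfl : z = z' := (Q.tgt_eq h).trans (Q.tgt_eq h').symm
  exact P.rep_congr hk (Q.mem h') (by rw [hf]; exact Q.base_mem h')
    (by rw [hf]; exact ((Q.eq_iff h h').1 rfl).symm)

/-- The map of arrow spaces induced by a map of the bases of two presentations. -/
def map (g : A₀) : A := (exists_map Q P hf g).choose

variable {Q} in
lemma Rep.map {g : A₀} {y z : N₀} {θ : OpenPartialHomeomorph M M} (h : Q.Rep g y z θ) :
    P.Rep (map Q P hf g) (f y) (f z) θ :=
  (exists_map Q P hf g).choose_spec y z θ h

lemma src_map (g : A₀) : P.src (map Q P hf g) = π (f (Q.src g)) := by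
  obtain ⟨y, z, θ, h⟩ := Q.exists_reps g
  rw [← P.src_eq (h.map P hf), ← Q.src_eq h, id]

lemma tgt_map (g : A₀) : P.tgt (map Q P hf g) = π (f (Q.tgt g)) := by
  obtain ⟨y, z, θ, h⟩ := Q.exists_reps g
  rw [← P.tgt_eq (h.map P hf), ← Q.tgt_eq h, id]

lemma map_one (x : N₀) : map Q P hf (Q.one x) = P.one (π (f x)) :=
  P.rep_ext ((Q.rep_one x).map P hf) (P.rep_one (f x))

lemma map_mul (g h : A₀) (c) (c') :
    map Q P hf (Q.mul g h c) = P.mul (map Q P hf g) (map Q P hf h) c' := by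
  obtain ⟨y, z, w, θ, θ', h1, h2⟩ := Q.exists_reps_mul c
  exact P.rep_ext ((h1.mul c h2).map P hf) ((h1.map P hf).mul c' (h2.map P hf))

variable [TopologicalSpace A₀] [TopologicalSpace A]

lemma continuous_map (hQ : Q.IsGermTopology) (hP : P.IsGermTopology) (hfc : Continuous f) :
    Continuous (map Q P hf) := by
  refine continuous_iff_continuousAt.2 fun g => ?_
  obtain ⟨y, z, θ, h⟩ := Q.exists_reps g
  intro U hU
  have h1 := (hP.eventually_iff (h.map P hf) (Q := fun k => k ∈ U)).1 hU
  have c : ContinuousAt (Prod.map f f) (y, z) := (hfc.prodMap hfc).continuousAt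
  refine mem_map.2 ?_
  filter_upwards [hQ.eventually_exists_rep h (c.eventually h1)] with k ⟨p, hp, hk⟩
  exact hp _ (hk.map P hf)

variable {E₀ F₀ EA₀ EB FP EA : Type} [NormedAddCommGroup E₀] [NormedSpace ℝ E₀]
  [NormedAddCommGroup F₀] [NormedSpace ℝ F₀] [NormedAddCommGroup EA₀] [NormedSpace ℝ EA₀]
  [NormedAddCommGroup EB] [NormedSpace ℝ EB] [NormedAddCommGroup FP] [NormedSpace ℝ FP]
  [NormedAddCommGroup EA] [NormedSpace ℝ EA]
  [FiniteDimensional ℝ E₀] [FiniteDimensional ℝ EA₀] [FiniteDimensional ℝ EB]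
  [FiniteDimensional ℝ EA]
  [ChartedSpace E₀ N₀] [ChartedSpace EA₀ A₀] [ChartedSpace EB B] [ChartedSpace EA A]
  {κ₀ : EA₀ ≃L[ℝ] F₀ × FQ × F₀} {κ : EA ≃L[ℝ] FP × FQ × FP}
  [T2Space N₀] [SecondCountableTopology N₀] [IsManifold 𝓘(ℝ, E₀) ∞ N₀]
  [T2Space B] [SecondCountableTopology B] [IsManifold 𝓘(ℝ, EB) ∞ B]

variable {Q P}

/-- The functor induced by a map of the bases of two presentations. -/
def functor (hQ : Q.IsSmoothStructure (EB := E₀) κ₀) (κ₀' : E₀ ≃L[ℝ] F₀ × FQ)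
    (hP : P.IsSmoothStructure (EB := EB) κ) (κ' : EB ≃L[ℝ] FP × FQ)
    (hfc : Continuous f) (hfs : ContMDiff 𝓘(ℝ, E₀) 𝓘(ℝ, EB) ∞ (fun y => π (f y))) :
    LieGroupoid.Functor (hQ.lieGroupoid κ₀') (hP.lieGroupoid κ') where
  obj y := π (f y)
  map := map Q P hf
  smooth_obj := hfs
  smooth_map := fun g => hP.contMDiffAt
    (continuous_map Q P hf hQ.topology hP.topology hfc).continuousAt
    (by simp only [src_map]; exact (hfs _).comp g ((hQ.submersion_src κ₀').contMDiff g))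
    (by simp only [tgt_map]; exact (hfs _).comp g ((hQ.submersion_tgt κ₀').contMDiff g))
  src_map := src_map Q P hf
  tgt_map := tgt_map Q P hf
  map_one := map_one Q P hf
  map_mul := fun g h c => map_mul Q P hf g h c
    ((src_map Q P hf g).trans ((congrArg (fun y => π (f y)) c).trans (tgt_map Q P hf h).symm))

/-- The functor keeps germs unchanged. Two points of `N₀` are joined by an arrow exactly when `Ψ`
relates their images in `M`, which is the same condition after applying `f`; every orbit is met
because `d₀` is onto. Isotropy groups are discrete groups of germs at the same point of `M`, and
normal spaces are copies of the tangent space of `M`. -/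
lemma functor_isMorita (hQ : Q.IsSmoothStructure (EB := E₀) κ₀) (κ₀' : E₀ ≃L[ℝ] F₀ × FQ)
    (hP : P.IsSmoothStructure (EB := EB) κ) (κ' : EB ≃L[ℝ] FP × FQ)
    (hfc : Continuous f) (hfs : ContMDiff 𝓘(ℝ, E₀) 𝓘(ℝ, EB) ∞ (fun y => π (f y)))
    (hd₀ : Function.Surjective d₀) (hQC : HasAdaptedCharts E₀ F₀ (FQ := FQ) (id : N₀ → N₀) d₀)
    (hPC : HasAdaptedCharts EB FP (FQ := FQ) π d) :
    (functor hf hQ κ₀' hP κ' hfc hfs).IsMorita := by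
  have hπf : Continuous fun y => π (f y) := P.continuous_π.comp hfc
  have hmap : ∀ x y : N₀, (hQ.lieGroupoid κ₀').orbitSetoid x y ↔
      (hP.lieGroupoid κ').orbitSetoid (π (f x)) (π (f y)) := by
    intro x y
    constructor
    · rintro ⟨g, rfl, rfl⟩
      exact ⟨map Q P hf g, src_map Q P hf g, tgt_map Q P hf g⟩
    · rintro ⟨k, hx, hy⟩
      obtain ⟨θ, h⟩ := P.exists_rep hx.symm hy.symm
      obtain ⟨g, hg⟩ := Q.exists_arrow (y := x) (z := y) (P.mem h) (by rw [← hf]; exact P.base_mem h)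
        (by rw [← hf x, ← hf y]; exact P.map_base h)
      exact ⟨g, (Q.src_eq hg).symm, (Q.tgt_eq hg).symm⟩
  have hsurj : ∀ y : N, ∃ x, (hP.lieGroupoid κ').orbitSetoid (π (f x)) (π y) := by
    intro y
    obtain ⟨x, hx⟩ := hd₀ (d y)
    obtain ⟨g, hg⟩ := P.exists_arrow (y := f x) (z := y) Ψ.id_mem (mem_univ _) (by
      rw [hf, hx]; rfl)
    exact ⟨x, g, (P.src_eq hg).symm, (P.tgt_eq hg).symm⟩
  refine ⟨?_, ?_, ?_⟩
  · let e : (hQ.lieGroupoid κ₀').OrbitSpace → (hP.lieGroupoid κ').OrbitSpace :=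
      Quotient.map (fun y => π (f y)) fun x y h => (hmap x y).1 h
    have he : Continuous e := hπf.quotient_map' _
    have hbij : Function.Bijective e := by
      constructor
      · rintro ⟨x⟩ ⟨y⟩ h
        exact Quotient.sound ((hmap x y).2 (Quotient.exact h))
      · rintro ⟨x⟩
        obtain ⟨y, rfl⟩ := P.surjective x
        obtain ⟨x, hx⟩ := hsurj y
        exact ⟨Quotient.mk _ x, Quotient.sound hx⟩
    have hopen : IsOpenMap e := by
      intro U hU
      have hU' := hU.preimage (continuous_quotient_mk' (s := (hQ.lieGroupoid κ₀').orbitSetoid))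
      refine isOpen_coinduced.2 (isOpen_iff_mem_nhds.2 ?_)
      rintro x ⟨⟨x₀⟩, hx₀, hx⟩
      obtain ⟨k, hk1, hk2⟩ : (hP.lieGroupoid κ').orbitSetoid (π (f x₀)) x := Quotient.exact hx
      obtain ⟨y, rfl⟩ := P.surjective x
      obtain ⟨θ, h⟩ := P.exists_rep hk1.symm hk2.symm
      have ht : d y ∈ θ.target := by
        rw [← P.map_base h]; exact θ.map_source (P.base_mem h)
      have c1 : ContinuousAt (fun y' => θ.symm (d y')) y :=
        ContinuousAt.comp (f := d) (g := θ.symm) (θ.symm.continuousAt ht)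
          P.continuous_d.continuousAt
      have e1 : d₀ x₀ = θ.symm (d y) := by
        rw [← P.map_base h, θ.left_inv (P.base_mem h), hf]
      -- For `y'` near `y`, the point `θ.symm (d y')` is `d₀ x₁` with `x₁` near `x₀`; then `θ`
      -- presents an arrow from `π (f x₁)` to `π y'`, so nearby orbits come from the given open set.
      have h2 := Q.isOpenMap_d.eventually_exists_lift c1 e1
        (continuousAt_fst.eventually (hU'.mem_nhds hx₀))
      have h3 : ∀ᶠ y' in 𝓝 y, d y' ∈ θ.target :=
        P.continuous_d.continuousAt.eventually (θ.open_target.mem_nhds ht)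
      filter_upwards [P.isOpenMap_π.image_mem_nhds (h2.and h3)]
        with x' ⟨y', ⟨⟨x₁, hx₁, hU₁⟩, hy'⟩, hx'⟩
      subst hx'
      refine ⟨Quotient.mk _ x₁, hU₁, Quotient.sound ?_⟩
      obtain ⟨k', hk'⟩ := P.exists_arrow (y := f x₁) (z := y') (P.mem h)
        (by rw [hf, hx₁]; exact θ.map_target hy') (by rw [hf, hx₁, θ.right_inv hy'])
      exact ⟨k', (P.src_eq hk').symm, (P.tgt_eq hk').symm⟩
    exact ⟨(Equiv.ofBijective e hbij).toHomeomorphOfContinuousOpen he hopen, fun x => rfl⟩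
  · intro x
    have d1 : DiscreteTopology ((hQ.lieGroupoid κ₀').Isotropy x) :=
      hQ.topology.discrete_isotropy x
    have d2 : DiscreteTopology
        ((hP.lieGroupoid κ').Isotropy ((functor hf hQ κ₀' hP κ' hfc hfs).obj x)) :=
      hP.topology.discrete_isotropy (π (f x))
    refine ⟨continuous_of_discreteTopology, fun U _ => isOpen_discrete _, ?_, ?_⟩
    · rintro ⟨g, hg1, hg2⟩ ⟨g', hg1', hg2'⟩ h
      have hgg : map Q P hf g = map Q P hf g' := congrArg Subtype.val h
      obtain ⟨θ, hg⟩ := Q.exists_rep (y := x) (z := x) hg1.symm hg2.symm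
      obtain ⟨θ', hg'⟩ := Q.exists_rep (y := x) (z := x) hg1'.symm hg2'.symm
      refine Subtype.ext ((Q.eq_iff hg hg').2 ?_)
      have := (P.eq_iff (hg.map P hf) (hg'.map P hf)).1 hgg
      rwa [hf] at this
    · rintro ⟨k, hk1, hk2⟩
      obtain ⟨θ, h⟩ := P.exists_rep (y := f x) (z := f x) hk1.symm hk2.symm
      obtain ⟨g, hg⟩ := Q.exists_arrow (y := x) (z := x) (P.mem h)
        (by rw [← hf]; exact P.base_mem h) (by rw [← hf]; exact P.map_base h)
      exact ⟨⟨g, (Q.src_eq hg).symm, (Q.tgt_eq hg).symm⟩,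
        Subtype.ext (P.rep_ext (hg.map P hf) h)⟩
  · intro x
    -- One chart of `M` serves both presentations, so the transverse coordinate of `φ` is that of
    -- `ψ` composed with `π ∘ f`. Their differentials have the orbit tangents as kernels.
    have hc := IsManifold.chart_mem_maximalAtlas (I := 𝓘(ℝ, FQ)) (n := ∞) (d₀ x)
    obtain ⟨φ, hφ, hx, hφx⟩ := hQC x _ hc (mem_chart_source FQ (d₀ x))
    obtain ⟨ψ, hψ, hy, hψy⟩ := hPC (f x) _ hc (by rw [hf]; exact mem_chart_source FQ (d₀ x))
    have hψx := hfc.continuousAt.eventually hψy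
    have hev : (fun x => (φ x).2) =ᶠ[𝓝 x] (fun x => (ψ x).2) ∘ fun y => π (f y) := by
      filter_upwards [hφx, hψx] with x' h1 h2
      exact h1.trans (by rw [Function.comp, h2, hf])
    have hcomp := (((hψ.hasMFDerivAt_snd hy).mdifferentiableAt.hasMFDerivAt.comp x
      ((hfs x).mdifferentiableAt (by simp)).hasMFDerivAt).congr_of_eventuallyEq hev).mfderiv
    exact Submodule.exists_bijective_mapQ (V := E₀) (V' := EB)
      (mfderiv 𝓘(ℝ, E₀) 𝓘(ℝ, FQ) (fun x => (φ x).2) x : E₀ →L[ℝ] FQ).toLinearMap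
      (mfderiv 𝓘(ℝ, EB) 𝓘(ℝ, FQ) (fun x => (ψ x).2) (π (f x)) : EB →L[ℝ] FQ).toLinearMap
      (mfderiv 𝓘(ℝ, E₀) 𝓘(ℝ, EB) (fun y => π (f y)) x : E₀ →L[ℝ] EB).toLinearMap
      (hQ.mem_orbitTangent_iff κ₀' hφ hx) (hP.mem_orbitTangent_iff κ' hψ hy)
      (fun v => (congrArg (fun L : E₀ →L[ℝ] FQ => L v) hcomp).symm)
      (hφ.surjective_mfderiv_snd hx)

end Morita

end GermPresentation

/-! ### The germ groupoid and its pullbacks -/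

section GermGroupoid

variable {M : Type u} [TopologicalSpace M] (Ψ : StructureGroupoid M)

variable {Ψ} in
lemma GermArrow.of_eq_of_iff {θ θ' : OpenPartialHomeomorph M M} {hθ : θ ∈ Ψ} {hθ' : θ' ∈ Ψ} {x : M}
    {hx : x ∈ θ.source} {hx' : x ∈ θ'.source} :
    GermArrow.of θ hθ x hx = GermArrow.of θ' hθ' x hx' ↔ θ =ᶠ[𝓝 x] θ' := by
  simp [GermArrow.of]

/-- The arrows of the germ groupoid, presented by germs. -/
def germPresentation : GermPresentation Ψ (id : M → M) (id : M → M) (GermArrow Ψ) where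
  src g := g.base
  tgt g := g.germ.value
  Rep g y z θ := θ y = z ∧ ∃ (hθ : θ ∈ Ψ) (hy : y ∈ θ.source), g = GermArrow.of θ hθ y hy
  isLocalHomeomorph := (Homeomorph.refl M).isLocalHomeomorph
  surjective := Function.surjective_id
  continuous_d := continuous_id
  isOpenMap_d := IsOpenMap.id
  mem := fun ⟨_, h, _⟩ => h
  base_mem := fun ⟨_, _, h, _⟩ => h
  map_base := fun ⟨h, _⟩ => h
  src_eq := by rintro _ y z θ ⟨h, hθ, hy, rfl⟩; rfl
  tgt_eq := by rintro _ y z θ ⟨rfl, hθ, hy, rfl⟩; rfl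
  exists_rep := by
    rintro ⟨_, _, θ, hθ, hx, rfl⟩ y z rfl rfl
    exact ⟨θ, rfl, hθ, hx, rfl⟩
  exists_arrow := fun {y z θ} hθ hy h => ⟨GermArrow.of θ hθ y hy, h, hθ, hy, rfl⟩
  eq_iff := by
    rintro _ _ y z θ θ' ⟨h, hθ, hy, rfl⟩ ⟨h', hθ', hy', rfl⟩
    exact GermArrow.of_eq_of_iff
  change := by
    rintro y _ rfl
    refine ⟨_, Ψ.id_mem, mem_univ _, Eventually.of_forall ?_⟩
    rintro ⟨a, b⟩ (rfl : a = b)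
    refine ⟨rfl, fun g z θ h => ?_, fun g z θ h => ?_⟩
    · rwa [OpenPartialHomeomorph.refl_trans]
    · rwa [OpenPartialHomeomorph.trans_refl]

variable {Ψ}

lemma germPresentation_rep {θ : OpenPartialHomeomorph M M} (hθ : θ ∈ Ψ) {x : M}
    (hx : x ∈ θ.source) : (germPresentation Ψ).Rep (GermArrow.of θ hθ x hx) x (θ x) θ :=
  ⟨rfl, hθ, hx, rfl⟩

/-- The pullback of a presentation along an open map. -/
def GermPresentation.pullback {A N : Type u} [TopologicalSpace N]
    (P : GermPresentation Ψ (id : M → M) (id : M → M) A) {d : N → M} (hd : Continuous d)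
    (hd' : IsOpenMap d) : GermPresentation Ψ (id : N → N) d
      {k : N × N × A // P.src k.2.2 = d k.1 ∧ P.tgt k.2.2 = d k.2.1} where
  src k := k.1.1
  tgt k := k.1.2.1
  Rep k y z θ := k.1.1 = y ∧ k.1.2.1 = z ∧ P.Rep k.1.2.2 (d y) (d z) θ
  isLocalHomeomorph := (Homeomorph.refl N).isLocalHomeomorph
  surjective := Function.surjective_id
  continuous_d := hd
  isOpenMap_d := hd'
  mem := fun h => P.mem h.2.2
  base_mem := fun h => P.base_mem h.2.2
  map_base := fun h => P.map_base h.2.2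
  src_eq := fun h => h.1.symm
  tgt_eq := fun h => h.2.1.symm
  exists_rep := by
    rintro ⟨⟨y, z, g⟩, h1, h2⟩ _ _ rfl rfl
    obtain ⟨θ, h⟩ := P.exists_rep (g := g) (y := _) (z := _) h1.symm h2.symm
    exact ⟨θ, rfl, rfl, h⟩
  exists_arrow := by
    intro y z θ hθ hy h
    obtain ⟨g, hg⟩ := P.exists_arrow (y := d y) (z := d z) hθ hy h
    exact ⟨⟨(y, z, g), (P.src_eq hg).symm, (P.tgt_eq hg).symm⟩, rfl, rfl, hg⟩
  eq_iff := by
    rintro ⟨⟨_, _, g⟩, h1⟩ ⟨⟨_, _, g'⟩, h1'⟩ y z θ θ' ⟨rfl, rfl, h⟩ ⟨e, e', h'⟩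
    dsimp only at e e' h h'
    subst e e'
    refine Iff.trans ?_ (P.eq_iff h h')
    simp
  change := by
    rintro y _ rfl
    refine ⟨_, Ψ.id_mem, mem_univ _, Eventually.of_forall ?_⟩
    rintro ⟨a, b⟩ (rfl : a = b)
    refine ⟨rfl, fun g z θ h => ?_, fun g z θ h => ?_⟩
    · rwa [OpenPartialHomeomorph.refl_trans]
    · rwa [OpenPartialHomeomorph.trans_refl]

variable {E : Type} [NormedAddCommGroup E] [NormedSpace ℝ E] [ChartedSpace E M]

/-- A chart of `M`, as an adapted chart for the foliation by points. -/
lemma isAdaptedChart_uniqueProd {c : OpenPartialHomeomorph M E}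
    (h1 : ContMDiffOn 𝓘(ℝ, E) 𝓘(ℝ, E) ∞ c c.source)
    (h2 : ContMDiffOn 𝓘(ℝ, E) 𝓘(ℝ, E) ∞ c.symm c.target) :
    IsAdaptedChart (EB := E) (id : M → M) (id : M → M)
      (c.transHomeomorph (ContinuousLinearEquiv.uniqueProd ℝ E (Cart 0)).symm.toHomeomorph) := by
  refine ⟨?_, ?_, ?_⟩
  · exact (ContinuousLinearEquiv.uniqueProd ℝ E (Cart 0)).symm.contDiff.contMDiff.comp_contMDiffOn h1
  · exact h2.comp (ContinuousLinearEquiv.uniqueProd ℝ E (Cart 0)).contDiff.contMDiff.contMDiffOn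
      fun v hv => hv
  · intro x hx
    refine ⟨x, rfl, ?_⟩
    have hx' : x ∈ c.source := hx
    filter_upwards [prod_mem_nhds (c.open_source.mem_nhds hx') (c.open_source.mem_nhds hx')]
      with p hp
    exact ⟨fun h => c.injOn hp.1 hp.2 h, fun h => congrArg c h⟩

lemma hasAdaptedCharts_id [IsManifold 𝓘(ℝ, E) ∞ M] :
    HasAdaptedCharts E (Cart 0) (FQ := E) (id : M → M) (id : M → M) := by
  intro y c hc hy
  obtain ⟨h1, h2⟩ := (IsManifold.mem_maximalAtlas_iff_contMDiffOn (I := 𝓘(ℝ, E)) (n := ∞) c).1 hc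
  exact ⟨_, isAdaptedChart_uniqueProd h1 h2, hy, Eventually.of_forall fun _ => rfl⟩

end GermGroupoid

/-! ### Submersions -/

section Submersion

variable {p q : ℕ} {Y M : Type u} [TopologicalSpace Y] [ChartedSpace (Cart (p + q)) Y]
  [IsManifold 𝓘(ℝ, Cart (p + q)) ∞ Y] [TopologicalSpace M] [ChartedSpace (Cart q) M]
  [IsManifold 𝓘(ℝ, Cart q) ∞ M] {d : Y → M}

lemma contDiffOn_transition_of_mem_maximalAtlas {c c' : OpenPartialHomeomorph M (Cart q)}
    (hc : c ∈ IsManifold.maximalAtlas 𝓘(ℝ, Cart q) ∞ M)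
    (hc' : c' ∈ IsManifold.maximalAtlas 𝓘(ℝ, Cart q) ∞ M) :
    ContDiffOn ℝ ∞ (c.symm.trans c') (c.symm.trans c').source := by
  rw [← contMDiffOn_iff_contDiffOn, OpenPartialHomeomorph.trans_source]
  exact (contMDiffOn_of_mem_maximalAtlas hc').comp
    ((contMDiffOn_symm_of_mem_maximalAtlas hc).mono inter_subset_left) fun _ h => h.2

/-- A submersion is a projection in suitable coordinates; the coordinates on the target can be
prescribed. -/
lemma Manifold.IsSubmersion.exists_productChart
    (hd : Manifold.IsSubmersion 𝓘(ℝ, Cart (p + q)) 𝓘(ℝ, Cart q) ∞ d) (y : Y)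
    {c : OpenPartialHomeomorph M (Cart q)} (hc : c ∈ IsManifold.maximalAtlas 𝓘(ℝ, Cart q) ∞ M)
    (hy : d y ∈ c.source) : ∃ φ : OpenPartialHomeomorph Y (Cart p × Cart q),
      IsSmoothProductChart φ ∧ y ∈ φ.source ∧
        ∀ z ∈ φ.source, d z ∈ c.source ∧ (φ z).2 = c (d z) := by
  have h := hd.isSubmersionAt y
  have hfin : FiniteDimensional ℝ (Cart q × h.complement) :=
    h.equiv.toLinearEquiv.finiteDimensional
  have hfin' : FiniteDimensional ℝ h.complement :=
    Module.Finite.of_surjective (LinearMap.snd ℝ (Cart q) h.complement) LinearMap.snd_surjective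
  -- Dimension count: the complement of `ℝ^q` in `ℝ^(p + q)` has dimension `p`.
  have hrank : Module.finrank ℝ h.complement = Module.finrank ℝ (Cart p) := by
    have := h.equiv.toLinearEquiv.finrank_eq
    rw [Module.finrank_prod] at this
    simp only [finrank_euclideanSpace, Fintype.card_fin] at this ⊢
    omega
  let E : Cart (p + q) ≃L[ℝ] Cart p × Cart q :=
    h.equiv.trans ((ContinuousLinearEquiv.prodComm ℝ _ _).trans
      ((ContinuousLinearEquiv.ofFinrankEq hrank).prodCongr (ContinuousLinearEquiv.refl ℝ _)))
  have hE : ∀ v, (E v).2 = (h.equiv v).1 := fun v => rfl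
  let φ₀ : OpenPartialHomeomorph Y (Cart p × Cart q) :=
    h.domChart.transHomeomorph E.toHomeomorph
  -- `T` replaces the target chart supplied by the submersion with the prescribed chart `c`; it acts
  -- only on the transverse factor.
  let T := h.codChart.symm.trans c
  let φ := φ₀.trans ((OpenPartialHomeomorph.refl (Cart p)).prod T)
  have hφ₀ : ∀ z ∈ h.domChart.source, (φ₀ z).2 = h.codChart (d z) := by
    intro z hz
    have h1 := h.writtenInCharts (show h.domChart z ∈
      (h.domChart.extend 𝓘(ℝ, Cart (p + q))).target by simpa using h.domChart.map_source hz)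
    have h2 : h.codChart (d (h.domChart.symm (h.domChart z))) = (h.equiv (h.domChart z)).1 := h1
    rw [h.domChart.left_inv hz] at h2
    exact h2.symm
  have hsrc : ∀ z, z ∈ φ.source ↔ z ∈ h.domChart.source ∧ d z ∈ c.source := by
    intro z
    have h0 : z ∈ φ.source ↔ z ∈ h.domChart.source ∧ (φ₀ z).2 ∈ T.source := by
      simp only [φ, OpenPartialHomeomorph.trans_source, OpenPartialHomeomorph.prod_source,
        mem_inter_iff, mem_preimage, mem_prod]
      exact and_congr_right fun _ => ⟨fun h => h.2, fun h => ⟨mem_univ _, h⟩⟩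
    rw [h0]
    refine and_congr_right fun hz => ?_
    have hz' : d z ∈ h.codChart.source := h.source_subset_preimage_source hz
    rw [hφ₀ z hz, OpenPartialHomeomorph.trans_source]
    constructor
    · intro h3
      have h4 := h3.2
      rwa [mem_preimage, h.codChart.left_inv hz'] at h4
    · intro h3
      refine ⟨h.codChart.map_source hz', ?_⟩
      rwa [mem_preimage, h.codChart.left_inv hz']
  have hφ : ∀ z ∈ φ.source, φ z = ((φ₀ z).1, c (d z)) := by
    intro z hz
    have hz1 := ((hsrc z).1 hz).1
    have hz' : d z ∈ h.codChart.source := h.source_subset_preimage_source hz1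
    refine Prod.ext rfl ?_
    show c (h.codChart.symm (φ₀ z).2) = c (d z)
    rw [hφ₀ z hz1, h.codChart.left_inv hz']
  have hφ₀s : ContMDiffOn 𝓘(ℝ, Cart (p + q)) 𝓘(ℝ, Cart p × Cart q) ∞ φ₀ φ₀.source :=
    E.contDiff.contMDiff.comp_contMDiffOn
      (contMDiffOn_of_mem_maximalAtlas h.domChart_mem_maximalAtlas)
  have hφ₀s' : ContMDiffOn 𝓘(ℝ, Cart p × Cart q) 𝓘(ℝ, Cart (p + q)) ∞ φ₀.symm φ₀.target :=
    (contMDiffOn_symm_of_mem_maximalAtlas h.domChart_mem_maximalAtlas).comp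
      E.symm.contDiff.contMDiff.contMDiffOn fun v hv => hv
  have hT := contDiffOn_transition_of_mem_maximalAtlas h.codChart_mem_maximalAtlas hc
  have hT' := contDiffOn_transition_of_mem_maximalAtlas hc h.codChart_mem_maximalAtlas
  have hTp : ContDiffOn ℝ ∞ (fun v : Cart p × Cart q => (v.1, T v.2)) (univ ×ˢ T.source) :=
    contDiff_fst.contDiffOn.prodMk (hT.comp contDiff_snd.contDiffOn fun v hv => hv.2)
  have hTp' : ContDiffOn ℝ ∞ (fun v : Cart p × Cart q => (v.1, T.symm v.2)) (univ ×ˢ T.target) :=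
    contDiff_fst.contDiffOn.prodMk (hT'.comp contDiff_snd.contDiffOn fun v hv => by
      have h1 : v.2 ∈ T.target := hv.2
      simpa [T, and_comm] using h1)
  refine ⟨φ, ⟨?_, ?_⟩, (hsrc y).2 ⟨h.mem_domChart_source, hy⟩, fun z hz => ⟨((hsrc z).1 hz).2, ?_⟩⟩
  · exact hTp.contMDiffOn.comp (hφ₀s.mono inter_subset_left) fun z hz => hz.2
  · exact hφ₀s'.comp (hTp'.contMDiffOn.mono inter_subset_left) fun z hz => hz.2
  · rw [hφ z hz]

/-- A submersion has smooth local sections. -/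
lemma Manifold.IsSubmersion.exists_section
    (hd : Manifold.IsSubmersion 𝓘(ℝ, Cart (p + q)) 𝓘(ℝ, Cart q) ∞ d) (y : Y) :
    ∃ s : M → Y, ContMDiffAt 𝓘(ℝ, Cart q) 𝓘(ℝ, Cart (p + q)) ∞ s (d y) ∧ s (d y) = y ∧
      ∀ᶠ m in 𝓝 (d y), d (s m) = m := by
  have hc := IsManifold.chart_mem_maximalAtlas (I := 𝓘(ℝ, Cart q)) (n := ∞) (d y)
  set c := chartAt (Cart q) (d y)
  have hcy : d y ∈ c.source := mem_chart_source _ _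
  obtain ⟨φ, hφ, hy, hφd⟩ := hd.exists_productChart y hc hcy
  have h0 : ((φ y).1, c (d y)) = φ y := Prod.ext rfl (hφd y hy).2.symm
  have hcs : ContMDiffAt 𝓘(ℝ, Cart q) 𝓘(ℝ, Cart q) ∞ c (d y) :=
    contMDiffAt_of_mem_maximalAtlas hc hcy
  have h1 : ContMDiffAt 𝓘(ℝ, Cart q) 𝓘(ℝ, Cart p × Cart q) ∞ (fun m => ((φ y).1, c m)) (d y) :=
    contMDiffAt_const.prodMk_space hcs
  have h2 : ((φ y).1, c (d y)) ∈ φ.target := by rw [h0]; exact φ.map_source hy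
  refine ⟨fun m => φ.symm ((φ y).1, c m), ?_, ?_, ?_⟩
  · exact ContMDiffAt.comp (g := φ.symm) (d y)
      (hφ.smooth_symm.contMDiffAt (φ.open_target.mem_nhds h2)) h1
  · show φ.symm ((φ y).1, c (d y)) = y
    rw [h0, φ.left_inv hy]
  · filter_upwards [c.open_source.mem_nhds hcy,
      h1.continuousAt.eventually (φ.open_target.mem_nhds h2)] with m hm1 hm2
    obtain ⟨h3, h4⟩ := hφd _ (φ.map_target hm2)
    rw [φ.right_inv hm2] at h4
    exact c.injOn h3 hm1 h4.symm

lemma Manifold.IsSubmersion.isOpenMap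
    (hd : Manifold.IsSubmersion 𝓘(ℝ, Cart (p + q)) 𝓘(ℝ, Cart q) ∞ d) : IsOpenMap d := by
  refine IsOpenMap.of_nhds_le fun y V hV => ?_
  obtain ⟨s, hs, hsy, hds⟩ := hd.exists_section y
  have h1 : ∀ᶠ m in 𝓝 (d y), d (s m) ∈ V :=
    hs.continuousAt.eventually (by rw [hsy]; exact hV)
  filter_upwards [h1, hds] with m h2 h3
  rwa [h3] at h2

/-- Submersions have adapted charts. -/
lemma Manifold.IsSubmersion.hasAdaptedCharts
    (hd : Manifold.IsSubmersion 𝓘(ℝ, Cart (p + q)) 𝓘(ℝ, Cart q) ∞ d) :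
    HasAdaptedCharts (Cart (p + q)) (Cart p) (FQ := Cart q) (id : Y → Y) d := by
  intro y c hc hy
  obtain ⟨φ, hφ, hyφ, hφd⟩ := hd.exists_productChart y hc hy
  refine ⟨φ, ⟨hφ.smooth, hφ.smooth_symm, fun x hx => ⟨x, rfl, ?_⟩⟩, hyφ, ?_⟩
  · filter_upwards [prod_mem_nhds (φ.open_source.mem_nhds hx) (φ.open_source.mem_nhds hx)]
      with r hr
    obtain ⟨h1, h2⟩ := hφd _ hr.1
    obtain ⟨h3, h4⟩ := hφd _ hr.2
    rw [id, id, h2, h4]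
    exact ⟨fun h => c.injOn h1 h3 h, fun h => congrArg c h⟩
  · filter_upwards [φ.open_source.mem_nhds hyφ] with z hz using (hφd z hz).2

/-- A submersion composed with the local inverses of a local diffeomorphism has adapted charts. -/
lemma Manifold.IsSubmersion.hasAdaptedCharts_of_isLocalDiffeomorph {X : Type u}
    [TopologicalSpace X] [ChartedSpace (Cart (p + q)) X] {π : Y → X}
    (hπ : IsLocalDiffeomorph 𝓘(ℝ, Cart (p + q)) 𝓘(ℝ, Cart (p + q)) ∞ π)
    (hd : Manifold.IsSubmersion 𝓘(ℝ, Cart (p + q)) 𝓘(ℝ, Cart q) ∞ d) :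
    HasAdaptedCharts (Cart (p + q)) (Cart p) (FQ := Cart q) π d := by
  intro y c hc hy
  obtain ⟨φ, hφ, hyφ, hφd⟩ := hd.exists_productChart y hc hy
  obtain ⟨Φ, hyΦ, hΦ⟩ := hπ y
  have hyΦ' : y ∈ Φ.toOpenPartialHomeomorph.source := hyΦ
  have hev : ∀ a ∈ Φ.source, ∀ᶠ a' in 𝓝 a,
      (Φ.toOpenPartialHomeomorph.symm.trans φ) (π a') = φ a' := by
    intro a ha
    filter_upwards [Φ.open_source.mem_nhds ha] with a' ha'
    rw [hΦ ha']
    exact congrArg φ (Φ.toOpenPartialHomeomorph.left_inv ha')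
  refine ⟨Φ.toOpenPartialHomeomorph.symm.trans φ, ⟨?_, ?_, ?_⟩, ?_, ?_⟩
  · rw [OpenPartialHomeomorph.trans_source]
    exact hφ.smooth.comp (Φ.contMDiffOn_invFun.mono inter_subset_left) fun x hx => hx.2
  · rw [OpenPartialHomeomorph.trans_target]
    exact Φ.contMDiffOn_toFun.comp (hφ.smooth_symm.mono inter_subset_left) fun x hx => hx.2
  · intro x hx
    rw [OpenPartialHomeomorph.trans_source] at hx
    have ha : Φ.toOpenPartialHomeomorph.symm x ∈ Φ.source :=
      Φ.toOpenPartialHomeomorph.map_target hx.1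
    refine ⟨Φ.toOpenPartialHomeomorph.symm x,
      (hΦ ha).trans (Φ.toOpenPartialHomeomorph.right_inv hx.1), ?_⟩
    filter_upwards [continuousAt_fst.eventually (hev _ ha), continuousAt_snd.eventually (hev _ ha),
      prod_mem_nhds (φ.open_source.mem_nhds hx.2) (φ.open_source.mem_nhds hx.2)] with r r1 r2 hr
    obtain ⟨h1, h2⟩ := hφd _ hr.1
    obtain ⟨h3, h4⟩ := hφd _ hr.2
    rw [r1, r2, h2, h4]
    exact ⟨fun h => c.injOn h1 h3 h, fun h => congrArg c h⟩
  · rw [OpenPartialHomeomorph.trans_source]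
    refine ⟨?_, ?_⟩
    · rw [hΦ hyΦ]; exact Φ.toOpenPartialHomeomorph.map_source hyΦ
    · rw [mem_preimage, hΦ hyΦ]
      exact (Φ.toOpenPartialHomeomorph.left_inv hyΦ').symm ▸ hyφ
  · filter_upwards [hev y hyΦ, φ.open_source.mem_nhds hyφ] with z h1 h2
    rw [h1, (hφd z h2).2]

end Submersion

/-! ### The action of the deck transformations on the leaf space -/

/-- Near each point, `γ` is `π` followed by a local inverse of `π`. -/
lemma IsLocalDiffeomorph.contMDiff_of_comp_eq {n : ℕ} {X Y : Type u} [TopologicalSpace X]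
    [ChartedSpace (Cart n) X] [TopologicalSpace Y] [ChartedSpace (Cart n) Y] {π : Y → X}
    (hπ : IsLocalDiffeomorph 𝓘(ℝ, Cart n) 𝓘(ℝ, Cart n) ∞ π) {γ : Y → Y} (hγ : Continuous γ)
    (h : ∀ y, π (γ y) = π y) : ContMDiff 𝓘(ℝ, Cart n) 𝓘(ℝ, Cart n) ∞ γ := by
  intro y
  obtain ⟨Φ, hyΦ, hΦ⟩ := hπ (γ y)
  have h1 : π y ∈ Φ.target := by
    rw [← h, hΦ hyΦ]; exact Φ.toOpenPartialHomeomorph.map_source hyΦ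
  refine (ContMDiffAt.comp (g := Φ.invFun) y (Φ.contMDiffOn_invFun.contMDiffAt
    (Φ.open_target.mem_nhds h1)) (hπ.contMDiff y)).congr_of_eventuallyEq ?_
  filter_upwards [hγ.continuousAt.eventually (Φ.open_source.mem_nhds hyΦ)] with z hz
  show γ z = Φ.invFun (π z)
  rw [← h, hΦ hz]
  exact (Φ.toOpenPartialHomeomorph.left_inv hz).symm

namespace Foliation

variable {p q : ℕ} {X Y M : Type u} [TopologicalSpace X] [ChartedSpace (Cart (p + q)) X]
  [TopologicalSpace Y] [ChartedSpace (Cart (p + q)) Y]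
  [IsManifold 𝓘(ℝ, Cart (p + q)) ∞ Y] [TopologicalSpace M] [ChartedSpace (Cart q) M]
  [IsManifold 𝓘(ℝ, Cart q) ∞ M] {F : Foliation p q X} {π : Y → X} {d : Y → M}
  (hd : F.IsDevelopable π d)

include hd in
lemma IsDevelopable.isLocalHomeomorph : IsLocalHomeomorph π := hd.cover.covering.isLocalHomeomorph

include hd in
lemma IsDevelopable.contMDiff : ContMDiff 𝓘(ℝ, Cart (p + q)) 𝓘(ℝ, Cart q) ∞ d :=
  hd.simple.submersion.isSubmersionOfComplement_complement.contMDiff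

include hd in
lemma IsDevelopable.isOpenMap : IsOpenMap d := hd.simple.submersion.isOpenMap

lemma leafAction_apply (γ : deckGroup π) (y : Y) : leafAction hd γ (d y) = d (γ.1 y) :=
  leafMap_apply hd γ y

/-- Near each point, `h(γ)` equals `d ∘ γ ∘ s` for a smooth local section `s` of `d`. -/
lemma contMDiff_leafAction (γ : deckGroup π) :
    ContMDiff 𝓘(ℝ, Cart q) 𝓘(ℝ, Cart q) ∞ (leafAction hd γ) := by
  intro m
  obtain ⟨y, rfl⟩ := hd.simple.surjective m
  obtain ⟨s, hs, hsy, hds⟩ := hd.simple.submersion.exists_section y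
  have hγ : ContMDiff 𝓘(ℝ, Cart (p + q)) 𝓘(ℝ, Cart (p + q)) ∞ γ.1 :=
    hd.cover.localDiffeo.contMDiff_of_comp_eq γ.1.continuous γ.2
  refine (((hd.contMDiff.comp hγ) (s (d y))).comp (d y) hs).congr_of_eventuallyEq ?_
  filter_upwards [hds] with m hm
  show leafAction hd γ m = d (γ.1 (s m))
  rw [← leafAction_apply hd, hm]

/-- The homeomorphism of the leaf space given by a deck transformation. -/
def leafHomeo (γ : deckGroup π) : M ≃ₜ M where
  toEquiv := leafAction hd γ
  continuous_toFun := (contMDiff_leafAction hd γ).continuous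
  continuous_invFun := by
    have h : (leafAction hd γ).symm = leafAction hd γ⁻¹ := (map_inv (leafAction hd) γ).symm
    show Continuous (leafAction hd γ).symm
    rw [h]
    exact (contMDiff_leafAction hd γ⁻¹).continuous

lemma leafHomeo_apply (γ : deckGroup π) (y : Y) :
    (leafHomeo hd γ).toOpenPartialHomeomorph (d y) = d (γ.1 y) :=
  leafAction_apply hd γ y

lemma leafHomeo_mem (γ : deckGroup π) :
    (leafHomeo hd γ).toOpenPartialHomeomorph ∈ developingPseudogroup hd := by
  have h : ∀ G ∈ {Ψ : StructureGroupoid M | ClosedUnderRestriction Ψ ∧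
      ∀ e ∈ {e : OpenPartialHomeomorph M M | e.source = univ ∧
        ∃ γ : deckGroup π, ∀ m, e m = leafAction hd γ m}, e ∈ Ψ},
      (leafHomeo hd γ).toOpenPartialHomeomorph ∈ G :=
    fun G hG => hG.2 _ ⟨rfl, γ, fun m => rfl⟩
  exact mem_iInter₂.2 fun G hG => h G hG

/-- The pseudogroup of all transitions which locally agree with the action of a deck
transformation. -/
def locallyLeafAction : StructureGroupoid M :=
  Pregroupoid.groupoid
    { property := fun f u => ∀ x ∈ u, ∃ γ : deckGroup π, f =ᶠ[𝓝 x] leafAction hd γ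
      comp := by
        intro f g u v hf hg hu hv huv x hx
        obtain ⟨γ, h1⟩ := hf x hx.1
        obtain ⟨δ, h2⟩ := hg (f x) hx.2
        refine ⟨δ * γ, ?_⟩
        have h3 : Tendsto f (𝓝 x) (𝓝 (f x)) := by
          have h4 : ContinuousAt (leafAction hd γ) x :=
            (contMDiff_leafAction hd γ).continuous.continuousAt
          exact h4.congr h1.symm
        filter_upwards [h1, h3.eventually h2] with x' e1 e2
        rw [Function.comp, e2, e1, map_mul]
        rfl
      id_mem := fun x _ => ⟨1, by simp only [map_one]; exact EventuallyEq.refl _ _⟩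
      locality := by
        intro f u hu h x hx
        obtain ⟨v, hv, hxv, h⟩ := h x hx
        exact h x ⟨hx, hxv⟩
      congr := by
        intro f g u hu h hf x hx
        obtain ⟨γ, h1⟩ := hf x hx
        refine ⟨γ, EventuallyEq.trans ?_ h1⟩
        filter_upwards [hu.mem_nhds hx] with x' hx' using h x' hx' }

lemma mem_locallyLeafAction {e : OpenPartialHomeomorph M M} : e ∈ locallyLeafAction hd ↔
    (∀ x ∈ e.source, ∃ γ : deckGroup π, e =ᶠ[𝓝 x] leafAction hd γ) ∧
      ∀ x ∈ e.target, ∃ γ : deckGroup π, e.symm =ᶠ[𝓝 x] leafAction hd γ :=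
  Iff.rfl

/-- Transitions that locally agree with some `h(γ)` already form a pseudogroup containing the
generators, so the smallest such pseudogroup lies inside. This is the only access to its elements.
-/
lemma developingPseudogroup_le : developingPseudogroup hd ≤ locallyLeafAction hd := by
  refine sInf_le ⟨⟨fun {e} he s hs => ?_⟩, ?_⟩
  · rw [mem_locallyLeafAction] at he ⊢
    exact ⟨fun x hx => he.1 x hx.1, fun x hx => he.2 x hx.1⟩
  · rintro e ⟨hsrc, γ, hγ⟩
    rw [mem_locallyLeafAction]
    refine ⟨fun x _ => ⟨γ, Eventually.of_forall hγ⟩, fun x hx => ⟨γ⁻¹, ?_⟩⟩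
    filter_upwards [e.open_target.mem_nhds hx] with x' hx'
    rw [map_inv, ← (leafAction hd γ).symm_apply_apply (e.symm x'), ← hγ, e.right_inv hx']
    rfl

lemma eventuallyEq_leafAction {θ : OpenPartialHomeomorph M M} (hθ : θ ∈ developingPseudogroup hd)
    {m : M} (hm : m ∈ θ.source) : ∃ γ : deckGroup π, θ =ᶠ[𝓝 m] leafAction hd γ :=
  ((mem_locallyLeafAction hd).1 (developingPseudogroup_le hd hθ)).1 m hm

lemma isSmoothPseudogroup_developingPseudogroup :
    IsSmoothPseudogroup (FQ := Cart q) (developingPseudogroup hd) := by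
  intro θ hθ m hm
  obtain ⟨γ, h⟩ := eventuallyEq_leafAction hd hθ hm
  exact ((contMDiff_leafAction hd γ m).congr_of_eventuallyEq h).contMDiffWithinAt

end Foliation

namespace Foliation

/-! ### Foliated charts with convex image -/

section Convex

variable {p q : ℕ} {X : Type u} [TopologicalSpace X] [ChartedSpace (Cart (p + q)) X]
  {F : Foliation p q X}

/-- The target is cut down to a ball, and maximality of the atlas keeps the restricted chart. In a
chart with convex target a plaque is a full level set of the transverse coordinate (`mem_plaque`),
so connected components need no further attention. -/
lemma exists_convex_chart {φ : OpenPartialHomeomorph X (Cart p × Cart q)} (hφ : φ ∈ F.charts)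
    {x : X} (hx : x ∈ φ.source) : ∃ ψ ∈ F.charts, x ∈ ψ.source ∧ Convex ℝ ψ.target := by
  obtain ⟨r, hr, hball⟩ := Metric.isOpen_iff.1 φ.open_target (φ x) (φ.map_source hx)
  let ψ := (φ.symm.restrOpen (Metric.ball (φ x) r) Metric.isOpen_ball).symm
  have hsrc : ψ.source ⊆ φ.source := by
    intro z hz
    have h1 := ψ.map_source hz
    have h2 : ψ.symm (ψ z) = z := ψ.left_inv hz
    rw [← h2]
    exact φ.map_target h1.1
  have hx' : x ∈ ψ.source := by
    have h1 : φ x ∈ ψ.target := ⟨φ.map_source hx, Metric.mem_ball_self hr⟩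
    have h2 : ψ.symm (φ x) = x := φ.left_inv hx
    rw [← h2]
    exact ψ.map_target h1
  refine ⟨ψ, F.maximal ψ ⟨(F.smooth φ hφ).smooth.mono hsrc,
    (F.smooth φ hφ).smooth_symm.mono inter_subset_left⟩ fun χ hχ => ⟨?_, ?_⟩, hx', ?_⟩
  · intro z hz
    exact F.compatible φ hφ χ hχ z ⟨hsrc hz.1, hz.2⟩
  · intro z hz
    exact F.compatible χ hχ φ hφ z ⟨hz.1, hsrc hz.2⟩
  · have h1 : ψ.target = Metric.ball (φ x) r := inter_eq_right.2 hball
    rw [h1]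
    exact convex_ball _ _

lemma mem_plaque {φ : OpenPartialHomeomorph X (Cart p × Cart q)} (hφ : Convex ℝ φ.target)
    {z w : X} (hz : z ∈ φ.source) (hw : w ∈ φ.source) (h : (φ w).2 = (φ z).2) :
    w ∈ plaque φ z := by
  have h1 : Convex ℝ (φ.target ∩ {v | v.2 = (φ z).2}) := by
    refine hφ.inter ?_
    intro a ha b hb s t _ _ hst
    show s • a.2 + t • b.2 = (φ z).2
    rw [show a.2 = (φ z).2 from ha, show b.2 = (φ z).2 from hb, ← add_smul, hst, one_smul]
  have h2 : IsPreconnected (φ.symm '' (φ.target ∩ {v | v.2 = (φ z).2})) :=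
    h1.isPreconnected.image _ (φ.continuousOn_symm.mono inter_subset_left)
  have h3 : ∀ w ∈ φ.source, (φ w).2 = (φ z).2 →
      w ∈ φ.symm '' (φ.target ∩ {v | v.2 = (φ z).2}) :=
    fun w hw h => ⟨φ w, ⟨φ.map_source hw, h⟩, φ.left_inv hw⟩
  refine h2.subset_connectedComponentIn (h3 z hz rfl) ?_ (h3 w hw h)
  rintro _ ⟨v, ⟨hv, hv'⟩, rfl⟩
  exact ⟨φ.map_target hv, by rw [φ.right_inv hv]; exact hv'⟩

/-- The straight segment in the coordinates stays in the target and has constant transverse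
coordinate. -/
lemma sameLeaf_of_convex {φ : OpenPartialHomeomorph X (Cart p × Cart q)} (hφF : φ ∈ F.charts)
    (hφ : Convex ℝ φ.target) {z w : X} (hz : z ∈ φ.source) (hw : w ∈ φ.source)
    (h : (φ z).2 = (φ w).2) : F.SameLeaf z w := by
  have hline : ∀ t : unitInterval, AffineMap.lineMap (φ z) (φ w) (t : ℝ) ∈ φ.target := fun t =>
    hφ.segment_subset (φ.map_source hz) (φ.map_source hw)
      (segment_eq_image_lineMap ℝ (φ z) (φ w) ▸ mem_image_of_mem _ t.2)
  have hsnd : ∀ t : unitInterval, (AffineMap.lineMap (φ z) (φ w) (t : ℝ)).2 = (φ z).2 := by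
    intro t
    simp [AffineMap.lineMap_apply, h]
  have hcont : Continuous fun t : unitInterval =>
      φ.symm (AffineMap.lineMap (φ z) (φ w) (t : ℝ)) :=
    φ.continuousOn_symm.comp_continuous
      (AffineMap.lineMap_continuous.comp continuous_subtype_val) hline
  refine ⟨⟨⟨⟨_, hcont⟩, by simp [φ.left_inv hz], by simp [φ.left_inv hw]⟩, ?_⟩⟩
  intro χ hχ t ht
  have ht' : φ.symm (AffineMap.lineMap (φ z) (φ w) (t : ℝ)) ∈ χ.source := ht
  obtain ⟨k, hk⟩ := F.compatible φ hφF χ hχ _ ⟨φ.map_target (hline t), ht'⟩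
  have h1 : ∀ᶠ s : unitInterval in 𝓝 t,
      (χ (φ.symm (AffineMap.lineMap (φ z) (φ w) (s : ℝ)))).2 = k (φ z).2 := by
    filter_upwards [hcont.continuousAt.eventually hk] with s hs
    rw [hs, φ.right_inv (hline s), hsnd]
  filter_upwards [h1] with s hs
  exact hs.trans h1.self_of_nhds.symm

lemma LeafPath.sameLeaf {x y : X} (σ : F.LeafPath x y) (s t : unitInterval) :
    F.SameLeaf (σ.toPath s) (σ.toPath t) :=
  have : PathConnectedSpace unitInterval := isPathConnected_iff_pathConnectedSpace.1
    ((convex_Icc (0 : ℝ) 1).isPathConnected ⟨0, by simp⟩)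
  ⟨⟨(PathConnectedSpace.somePath s t).map σ.toPath.continuous,
    σ.leafwise.comp (PathConnectedSpace.somePath s t).continuous⟩⟩

end Convex

/-! ### Foliated charts are adapted to the developing map -/

variable {p q : ℕ} {X Y M : Type u} [TopologicalSpace X] [ChartedSpace (Cart (p + q)) X]
  [TopologicalSpace Y] [ChartedSpace (Cart (p + q)) Y]
  [IsManifold 𝓘(ℝ, Cart (p + q)) ∞ Y] [TopologicalSpace M] [ChartedSpace (Cart q) M]
  [IsManifold 𝓘(ℝ, Cart q) ∞ M] {F : Foliation p q X} {π : Y → X} {d : Y → M}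
  (hd : F.IsDevelopable π d)

include hd

lemma eq_of_sameLeaf {y z : Y} (h : (F.pullback π hd.cover.localDiffeo).SameLeaf y z) :
    d y = d z :=
  (hd.simple.fibers y z).2 h

/-- Near `y`, the transverse coordinate of `φ` determines that of a convex chart of the pullback
foliation, and points of that chart with equal transverse coordinates lie in one leaf, that is, in
one fiber of `d`. -/
lemma eventually_eq_of_snd_eq {φ : OpenPartialHomeomorph X (Cart p × Cart q)} (hφ : φ ∈ F.charts)
    {y : Y} (hy : π y ∈ φ.source) :
    ∀ᶠ r in 𝓝 (y, y), (φ (π r.1)).2 = (φ (π r.2)).2 → d r.1 = d r.2 := by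
  obtain ⟨χ₀, hχ₀, hyχ₀⟩ := (F.pullback π hd.cover.localDiffeo).covers y
  obtain ⟨χ, hχ, hyχ, hconv⟩ := exists_convex_chart hχ₀ hyχ₀
  obtain ⟨h, hh⟩ := IsPullbackChart.of_base hχ φ hφ y hyχ hy
  filter_upwards [prod_mem_nhds (χ.open_source.mem_nhds hyχ) (χ.open_source.mem_nhds hyχ),
    continuousAt_fst.eventually hh, continuousAt_snd.eventually hh] with r hr h1 h2 h3
  exact eq_of_sameLeaf hd (sameLeaf_of_convex hχ hconv hr.1 hr.2 (by rw [h1, h2, h3]))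

omit hd in
lemma _root_.ContDiffAt.eventually_injective {E : Type*} [NormedAddCommGroup E]
    [NormedSpace ℝ E] [FiniteDimensional ℝ E] {k : E → E} {b : E} (hk : ContDiffAt ℝ ∞ k b)
    (hsurj : Function.Surjective (fderiv ℝ k b)) :
    ∀ᶠ r in 𝓝 (b, b), k r.1 = k r.2 → r.1 = r.2 := by
  have : CompleteSpace E := FiniteDimensional.complete ℝ E
  let L : E ≃L[ℝ] E := (LinearEquiv.ofBijective (fderiv ℝ k b).toLinearMap
    ⟨LinearMap.injective_iff_surjective.2 hsurj, hsurj⟩).toContinuousLinearEquiv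
  have hL : HasFDerivAt k (L : E →L[ℝ] E) b :=
    (hk.differentiableAt (by simp)).hasFDerivAt
  let e := hk.toOpenPartialHomeomorph k hL (by simp)
  have hb : b ∈ e.source := hk.mem_toOpenPartialHomeomorph_source hL (by simp)
  filter_upwards [prod_mem_nhds (e.open_source.mem_nhds hb) (e.open_source.mem_nhds hb)]
    with r hr h
  exact e.injOn hr.1 hr.2 h

/-- Fibers of `d` are leaves only globally, and a leaf could meet a chart in many plaques, so the
converse direction needs that `d` is a submersion. By the first direction `d` is, in coordinates, a
smooth function `k` of the transverse coordinate of `φ`; the derivative of `k` is onto, hence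
invertible, and `k` is locally injective. -/
lemma eventually_snd_eq_iff {φ : OpenPartialHomeomorph X (Cart p × Cart q)} (hφ : φ ∈ F.charts)
    {y : Y} (hy : π y ∈ φ.source) :
    ∀ᶠ r in 𝓝 (y, y), (φ (π r.1)).2 = (φ (π r.2)).2 ↔ d r.1 = d r.2 := by
  have h₁ := eventually_eq_of_snd_eq hd hφ hy
  obtain ⟨Φ, hyΦ, hΦ⟩ := hd.cover.localDiffeo y
  let s : X → Y := fun x => Φ.toOpenPartialHomeomorph.symm x
  have hsy : s (π y) = y := by
    rw [hΦ hyΦ]; exact Φ.toOpenPartialHomeomorph.left_inv hyΦ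
  have hyt : π y ∈ Φ.target := by
    rw [hΦ hyΦ]; exact Φ.toOpenPartialHomeomorph.map_source hyΦ
  have hs : ContMDiffAt 𝓘(ℝ, Cart (p + q)) 𝓘(ℝ, Cart (p + q)) ∞ s (π y) :=
    Φ.contMDiffOn_invFun.contMDiffAt (Φ.open_target.mem_nhds hyt)
  have hπs : ∀ᶠ x in 𝓝 (π y), π (s x) = x := by
    filter_upwards [Φ.open_target.mem_nhds hyt] with x hx
    have h1 : s x ∈ Φ.source := Φ.toOpenPartialHomeomorph.map_target hx
    rw [hΦ h1]
    exact Φ.toOpenPartialHomeomorph.right_inv hx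
  have hc := IsManifold.chart_mem_maximalAtlas (I := 𝓘(ℝ, Cart q)) (n := ∞) (d y)
  set c := chartAt (Cart q) (d y)
  have hcy : d y ∈ c.source := mem_chart_source _ _
  obtain ⟨χ, hχ, hyχ, hχd⟩ := hd.simple.submersion.exists_productChart y hc hcy
  have hφs := F.smooth φ hφ
  have hφy : ((φ (π y)).1, (φ (π y)).2) ∈ φ.target := φ.map_source hy
  -- the leafwise coordinates of `y` and given transverse coordinates determine a point near `y`
  let i : Cart q → Y := fun b => s (φ.symm ((φ (π y)).1, b))
  have hi₁ : ContMDiffAt 𝓘(ℝ, Cart q) 𝓘(ℝ, Cart (p + q)) ∞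
      (fun b => φ.symm ((φ (π y)).1, b)) (φ (π y)).2 :=
    ContMDiffAt.comp (g := φ.symm) (f := fun b : Cart q => ((φ (π y)).1, b)) _
      (hφs.smooth_symm.contMDiffAt (φ.open_target.mem_nhds hφy))
      (contMDiffAt_const.prodMk_space contMDiffAt_id)
  have hi₀ : φ.symm ((φ (π y)).1, (φ (π y)).2) = π y := φ.left_inv hy
  have hiy : i (φ (π y)).2 = y := by
    show s (φ.symm ((φ (π y)).1, (φ (π y)).2)) = y
    rw [hi₀, hsy]
  have hi : ContMDiffAt 𝓘(ℝ, Cart q) 𝓘(ℝ, Cart (p + q)) ∞ i (φ (π y)).2 :=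
    ContMDiffAt.comp (g := s) (f := fun b => φ.symm ((φ (π y)).1, b)) _
      (by rw [hi₀]; exact hs) hi₁
  let k : Cart q → Cart q := fun b => (χ (i b)).2
  have hk : ContDiffAt ℝ ∞ k (φ (π y)).2 := by
    have h1 : ContMDiffAt 𝓘(ℝ, Cart q) 𝓘(ℝ, Cart p × Cart q) ∞ (fun b => χ (i b)) (φ (π y)).2 :=
      ContMDiffAt.comp (g := χ) (f := i) _
        (by rw [hiy]; exact hχ.smooth.contMDiffAt (χ.open_source.mem_nhds hyχ)) hi
    exact h1.contDiffAt.snd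
  have hm₀ : ContMDiffAt 𝓘(ℝ, Cart (p + q)) 𝓘(ℝ, Cart p × Cart q) ∞ (fun z => φ (π z)) y :=
    ContMDiffAt.comp (g := φ) (f := π) y
      (hφs.smooth.contMDiffAt (φ.open_source.mem_nhds hy)) (hd.cover.localDiffeo.contMDiff y)
  have hτ : ContinuousAt (fun z => (φ (π z)).2) y := hm₀.continuousAt.snd
  -- in these terms, `k` is the change of transverse coordinates
  have hkey : ∀ᶠ z in 𝓝 y, (χ z).2 = k (φ (π z)).2 := by
    have c1 : Tendsto (fun z => (z, i (φ (π z)).2)) (𝓝 y) (𝓝 (y, y)) := by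
      have h2 : ContinuousAt (fun z => i (φ (π z)).2) y :=
        ContinuousAt.comp (g := i) (f := fun z => (φ (π z)).2) hi.continuousAt hτ
      have h3 := continuousAt_id.prodMk h2
      have h4 : Tendsto (fun z => (z, i (φ (π z)).2)) (𝓝 y) (𝓝 (y, i (φ (π y)).2)) := h3
      rwa [hiy] at h4
    have c2 : ContinuousAt (fun z => ((φ (π y)).1, (φ (π z)).2)) y :=
      continuousAt_const.prodMk hτ
    have c3 : Tendsto (fun z => φ.symm ((φ (π y)).1, (φ (π z)).2)) (𝓝 y) (𝓝 (π y)) := by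
      have h2 : ContinuousAt (fun z => φ.symm ((φ (π y)).1, (φ (π z)).2)) y :=
        ContinuousAt.comp (g := φ.symm) (f := fun z => ((φ (π y)).1, (φ (π z)).2))
          (φ.symm.continuousAt hφy) c2
      rwa [ContinuousAt, hi₀] at h2
    filter_upwards [c1.eventually h₁, c1.eventually
      (prod_mem_nhds (χ.open_source.mem_nhds hyχ) (χ.open_source.mem_nhds hyχ)),
      c2.eventually (φ.open_target.mem_nhds hφy), c3.eventually hπs] with z z1 z2 z3 z4
    have h5 : d z = d (i (φ (π z)).2) := z1 (by
      show _ = (φ (π (s (φ.symm ((φ (π y)).1, (φ (π z)).2))))).2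
      rw [z4, φ.right_inv z3])
    show (χ z).2 = (χ (i (φ (π z)).2)).2
    rw [(hχd _ z2.1).2, (hχd _ z2.2).2, h5]
  -- In the coordinates `χ`, `hkey` writes the projection to the second factor as `k ∘ m`, so the
  -- derivative of `k` must be onto.
  have hsurj : Function.Surjective (fderiv ℝ k (φ (π y)).2) := by
    have hχy : χ.symm (χ y) = y := χ.left_inv hyχ
    let m : Cart p × Cart q → Cart q := fun v => (φ (π (χ.symm v))).2
    have hχs : ContMDiffAt 𝓘(ℝ, Cart p × Cart q) 𝓘(ℝ, Cart (p + q)) ∞ χ.symm (χ y) :=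
      hχ.smooth_symm.contMDiffAt (χ.open_target.mem_nhds (χ.map_source hyχ))
    have hm : ContDiffAt ℝ ∞ m (χ y) := by
      have h1 : ContMDiffAt 𝓘(ℝ, Cart p × Cart q) 𝓘(ℝ, Cart p × Cart q) ∞
          (fun v => φ (π (χ.symm v))) (χ y) :=
        ContMDiffAt.comp (g := fun z => φ (π z)) (f := χ.symm) _ (by rw [hχy]; exact hm₀) hχs
      exact h1.contDiffAt.snd
    have hmy : m (χ y) = (φ (π y)).2 := by
      show (φ (π (χ.symm (χ y)))).2 = _
      rw [hχy]
    have h1 : HasFDerivAt k (fderiv ℝ k (φ (π y)).2) (m (χ y)) := by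
      rw [hmy]; exact (hk.differentiableAt (by simp)).hasFDerivAt
    have h2 := h1.comp _ (hm.differentiableAt (by simp)).hasFDerivAt
    have h3 : (fun v : Cart p × Cart q => v.2) =ᶠ[𝓝 (χ y)] k ∘ m := by
      have h4 : Tendsto χ.symm (𝓝 (χ y)) (𝓝 y) := by
        have := hχs.continuousAt
        rwa [ContinuousAt, hχy] at this
      filter_upwards [h4.eventually hkey, χ.open_target.mem_nhds (χ.map_source hyχ)] with v v1 v2
      rw [χ.right_inv v2] at v1
      exact v1
    have h4 : ContinuousLinearMap.snd ℝ (Cart p) (Cart q) =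
        (fderiv ℝ k (φ (π y)).2).comp (fderiv ℝ m (χ y)) :=
      hasFDerivAt_snd.unique (h2.congr_of_eventuallyEq h3)
    intro w
    exact ⟨fderiv ℝ m (χ y) (0, w),
      (congrArg (fun T : Cart p × Cart q →L[ℝ] Cart q => T (0, w)) h4).symm⟩
  have hinj := hk.eventually_injective hsurj
  have c4 : ContinuousAt (fun r : Y × Y => ((φ (π r.1)).2, (φ (π r.2)).2)) (y, y) :=
    (ContinuousAt.comp (g := fun z => (φ (π z)).2) (f := Prod.fst) hτ continuousAt_fst).prodMk
      (ContinuousAt.comp (g := fun z => (φ (π z)).2) (f := Prod.snd) hτ continuousAt_snd)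
  filter_upwards [h₁, c4.eventually hinj, continuousAt_fst.eventually hkey,
    continuousAt_snd.eventually hkey,
    prod_mem_nhds (χ.open_source.mem_nhds hyχ) (χ.open_source.mem_nhds hyχ)] with r r1 r2 r3 r4 r5
  refine ⟨r1, fun h => r2 ?_⟩
  rw [← r3, ← r4, (hχd _ r5.1).2, (hχd _ r5.2).2, h]

lemma isAdaptedChart_of_mem_charts {φ : OpenPartialHomeomorph X (Cart p × Cart q)}
    (hφ : φ ∈ F.charts) : IsAdaptedChart (EB := Cart (p + q)) π d φ := by
  refine ⟨(F.smooth φ hφ).smooth, (F.smooth φ hφ).smooth_symm, fun x hx => ?_⟩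
  obtain ⟨y, rfl⟩ := hd.cover.surjective x
  exact ⟨y, rfl, eventually_snd_eq_iff hd hφ hx⟩

end Foliation

/-- Version along a filter, needed because sliding maps are controlled only along the transversal
`S`. -/
lemma IsOpenMap.eventually_exists_lift_of_tendsto {E E' B : Type*} [TopologicalSpace E]
    [TopologicalSpace B] {f : E → B} (hf : IsOpenMap f) {g : E' → B} {a₀ : E} {l : Filter E'}
    (hg : Tendsto g l (𝓝 (f a₀))) {Q : E × E' → Prop} (hQ : ∀ᶠ r in 𝓝 a₀ ×ˢ l, Q r) :
    ∀ᶠ b in l, ∃ b₀, f b₀ = g b ∧ Q (b₀, b) := by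
  rw [eventually_prod_iff] at hQ
  obtain ⟨pa, ha, pb, hb, hQ⟩ := hQ
  have h1 : f '' {x | pa x} ∈ 𝓝 (f a₀) := hf.image_mem_nhds ha
  filter_upwards [hb, hg h1] with b hb1 hb2
  obtain ⟨b₀, hb₀, hb₁⟩ := hb2
  exact ⟨b₀, hb₁, hQ hb₀ hb1⟩

namespace Foliation

/-! ### Slices -/

section Slice

variable {p q : ℕ} {X : Type u} [TopologicalSpace X] [ChartedSpace (Cart (p + q)) X]
  {F : Foliation p q X}

/-- The slice through `x` of a chart `φ`, transverse to the leaves. -/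
def slice (φ : OpenPartialHomeomorph X (Cart p × Cart q)) (x : X) : Set X :=
  {z | z ∈ φ.source ∧ (φ z).1 = (φ x).1}

lemma isTransversal_slice {φ : OpenPartialHomeomorph X (Cart p × Cart q)} (hφ : φ ∈ F.charts)
    (x : X) : F.IsTransversal (slice φ x) := fun _ hz =>
  ⟨φ, hφ, hz.1, fun _ hw => ⟨fun h => h.2.trans hz.2.symm, fun h => ⟨hw, h.trans hz.2⟩⟩⟩

end Slice

/-! ### Holonomy in terms of the developing map -/

variable {p q : ℕ} {X Y M : Type u} [TopologicalSpace X] [ChartedSpace (Cart (p + q)) X]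
  [TopologicalSpace Y] [ChartedSpace (Cart (p + q)) Y]
  [IsManifold 𝓘(ℝ, Cart (p + q)) ∞ Y] [TopologicalSpace M] [ChartedSpace (Cart q) M]
  [IsManifold 𝓘(ℝ, Cart q) ∞ M] {F : Foliation p q X} {π : Y → X} {d : Y → M}
  (hd : F.IsDevelopable π d)

include hd

lemma IsDevelopable.isOpenMap_proj : IsOpenMap π := hd.isLocalHomeomorph.isOpenMap

lemma IsDevelopable.continuous_proj : Continuous π := hd.isLocalHomeomorph.continuous

lemma IsDevelopable.continuous : Continuous d := hd.contMDiff.continuous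

/-- The transverse coordinates of a foliated chart determine, and are determined by, the developing
map near any two points joined by a leafwise path in the chart. -/
lemma eventually_snd_eq_iff_of_path {φ : OpenPartialHomeomorph X (Cart p × Cart q)}
    (hφ : φ ∈ F.charts) {τ : unitInterval → Y} (hτ : Continuous τ)
    (hτd : ∀ s t, d (τ s) = d (τ t)) {s t : unitInterval} (hst : s ≤ t)
    (h : ∀ r ∈ Icc s t, π (τ r) ∈ φ.source) :
    ∀ᶠ r in 𝓝 (τ s, τ t), (φ (π r.1)).2 = (φ (π r.2)).2 ↔ d r.1 = d r.2 := by
  have hconn : IsPreconnected (Icc s t) := isPreconnected_Icc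
  -- The relation holds between nearby times and is symmetric and transitive, so it holds across the
  -- connected interval. For transitivity, openness of `d` inserts a point near `τ b` with the same
  -- value of `d`.
  refine hconn.induction₂
    (fun a b => ∀ᶠ r in 𝓝 (τ a, τ b), (φ (π r.1)).2 = (φ (π r.2)).2 ↔ d r.1 = d r.2)
    ?_ ?_ ?_ (left_mem_Icc.2 hst) (right_mem_Icc.2 hst)
  · intro a ha
    have h1 := (eventually_snd_eq_iff hd hφ (h a ha)).eventually_nhds
    have c : ContinuousAt (fun b => (τ a, τ b)) a := by fun_prop
    exact mem_nhdsWithin_of_mem_nhds (c.eventually h1)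
  · intro a b c _ _ _ hab hbc
    have c1 : ContinuousAt (fun r : Y × (Y × Y) => (r.2.1, r.1)) (τ b, (τ a, τ c)) := by fun_prop
    have c2 : ContinuousAt (fun r : Y × (Y × Y) => (r.1, r.2.2)) (τ b, (τ a, τ c)) := by fun_prop
    filter_upwards [hd.isOpenMap.eventually_exists_lift (g := fun r : Y × Y => d r.1)
      (a₀ := τ b) (a := (τ a, τ c)) (hd.continuous.comp continuous_fst).continuousAt (hτd b a)
      ((c1.eventually hab).and (c2.eventually hbc))] with r ⟨z, hz, h1, h2⟩
    rw [h1.2 hz.symm, h2, hz]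
  · intro a b _ _ hab
    have c1 : ContinuousAt (fun r : Y × Y => (r.2, r.1)) (τ b, τ a) := by fun_prop
    filter_upwards [c1.eventually hab] with r hr
    rw [eq_comm, hr, eq_comm]

section Path

variable {x x' : X} {σ : Path x x'} {τ : unitInterval → Y} (hτ : Continuous τ)
  (hσ : ∀ t, π (τ t) = σ t) (hτd : ∀ s t, d (τ s) = d (τ t))

include hτ hσ hτd

/-- Sliding along a path preserves the developing map. -/
lemma eventually_eq_of_slides {S : Set X} (hx : x ∈ S) {t : unitInterval} {g : X → X}
    (h : F.Slides σ S t g) : ContinuousWithinAt g S x ∧ g x = σ t ∧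
      ∀ᶠ r in 𝓝 (τ 0, τ t), π r.1 ∈ S → g (π r.1) = π r.2 → d r.1 = d r.2 := by
  have h0 : π (τ 0) = x := by rw [hσ, σ.source]
  have hfst : ∀ t', Tendsto (fun r : Y × Y => π r.1) (𝓝 (τ 0, τ t') ⊓ 𝓟 {r | π r.1 ∈ S})
      (𝓝[S] x) := by
    intro t'
    have c : Tendsto (fun r : Y × Y => π r.1) (𝓝 (τ 0, τ t')) (𝓝 x) := by
      rw [← h0]
      exact (hd.continuous_proj.comp continuous_fst).continuousAt
    exact tendsto_nhdsWithin_iff.2 ⟨c.mono_left inf_le_left,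
      mem_of_superset (mem_inf_of_right (mem_principal_self _)) fun r hr => hr⟩
  induction h with
  | start g hg =>
    have hgx : g x = x := hg.self_of_nhdsWithin hx
    refine ⟨?_, by rw [hgx, σ.source], ?_⟩
    · have h1 : ContinuousWithinAt id S x := continuousWithinAt_id
      exact h1.congr_of_eventuallyEq hg hgx
    · have h1 := eventually_inf_principal.1 ((hfst 0).eventually hg)
      filter_upwards [h1, hd.isLocalHomeomorph.eventually_injective (τ 0)] with r h1 h2 h3 h4
      rw [h2 ((h1 h3).symm.trans h4)]
  | step s t g k φ hg hst hφ hsrc hk hkx hplaque ih =>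
    obtain ⟨hgc, hgx, hgd⟩ := ih
    refine ⟨hk, hkx, ?_⟩
    have h1 := eventually_snd_eq_iff_of_path hd hφ hτ hτd hst (fun r hr => by
      rw [hσ]; exact hsrc r hr)
    have hT : Tendsto (fun r : Y × Y => g (π r.1)) (𝓝 (τ 0, τ t) ⊓ 𝓟 {r | π r.1 ∈ S})
        (𝓝 (π (τ s))) := by
      rw [hσ, ← hgx]
      exact hgc.tendsto.comp (hfst t)
    have c1 : Tendsto (fun r : Y × (Y × Y) => (r.2.1, r.1))
        (𝓝 (τ s) ×ˢ (𝓝 (τ 0, τ t) ⊓ 𝓟 {r | π r.1 ∈ S})) (𝓝 (τ 0, τ s)) := by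
      have : ContinuousAt (fun r : Y × (Y × Y) => (r.2.1, r.1)) (τ s, (τ 0, τ t)) := by fun_prop
      rw [ContinuousAt, nhds_prod_eq] at this
      exact this.mono_left (prod_mono_right _ inf_le_left)
    have c2 : Tendsto (fun r : Y × (Y × Y) => (r.1, r.2.2))
        (𝓝 (τ s) ×ˢ (𝓝 (τ 0, τ t) ⊓ 𝓟 {r | π r.1 ∈ S})) (𝓝 (τ s, τ t)) := by
      have : ContinuousAt (fun r : Y × (Y × Y) => (r.1, r.2.2)) (τ s, (τ 0, τ t)) := by fun_prop
      rw [ContinuousAt, nhds_prod_eq] at this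
      exact this.mono_left (prod_mono_right _ inf_le_left)
    -- The intermediate point `g (π r.1)` is lifted to `z` near `τ s`: the induction hypothesis
    -- gives `d r.1 = d z`, and the common plaque of `φ` gives `d z = d r.2`.
    have h2 := hd.isOpenMap_proj.eventually_exists_lift_of_tendsto hT
      ((c1.eventually hgd).and (c2.eventually h1))
    filter_upwards [eventually_inf_principal.1 h2,
      eventually_inf_principal.1 ((hfst t).eventually hplaque)] with r r1 r2 hr hkr
    obtain ⟨z, hz, hz1, hz2⟩ := r1 hr
    have h3 : k (π r.1) ∈ {w | w ∈ φ.source ∧ (φ w).2 = (φ (g (π r.1))).2} :=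
      connectedComponentIn_subset _ _ (r2 hr)
    refine (hz1 hr hz.symm).trans (hz2.1 ?_)
    show (φ (π z)).2 = (φ (π r.2)).2
    rw [hz, ← hkr]
    exact h3.2.symm

/-- There is a sliding along every leafwise path. -/
lemma exists_slides {S : Set X} (hx : x ∈ S) : ∃ g, F.Slides σ S 1 g := by
  choose φ hφ hxφ hconv using fun x : X => exists_convex_chart (F.covers x).choose_spec.1
    (F.covers x).choose_spec.2
  -- The path is subdivided so that each piece lies in a convex chart. On each piece a point keeps
  -- its transverse coordinate and takes the leafwise coordinate of the end of the piece.
  obtain ⟨t, ht0, hmono, ⟨n, hn⟩, hsub⟩ := exists_monotone_Icc_subset_open_cover_unitInterval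
    (c := fun x => σ ⁻¹' (φ x).source) (fun x => (φ x).open_source.preimage σ.continuous)
    (fun r _ => mem_iUnion.2 ⟨σ r, hxφ (σ r)⟩)
  suffices ∀ m, ∃ g, F.Slides σ S (t m) g by
    have h := this n
    rwa [hn n le_rfl] at h
  intro m
  induction m with
  | zero => exact ⟨id, ht0 ▸ Slides.start id (Eventually.of_forall fun _ => rfl)⟩
  | succ m ih =>
    obtain ⟨g, hg⟩ := ih
    obtain ⟨i, hi⟩ := hsub m
    obtain ⟨hgc, hgx, -⟩ := eventually_eq_of_slides hd hτ hσ hτd hx hg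
    have hm : t m ≤ t (m + 1) := hmono (Nat.le_succ m)
    have hs : σ (t m) ∈ (φ i).source := hi (left_mem_Icc.2 hm)
    have hs' : σ (t (m + 1)) ∈ (φ i).source := hi (right_mem_Icc.2 hm)
    have heq : (φ i (σ (t m))).2 = (φ i (σ (t (m + 1)))).2 := by
      have h1 := (eventually_snd_eq_iff_of_path hd (hφ i) hτ hτd hm
        (fun r hr => by rw [hσ]; exact hi hr)).self_of_nhds.2 (hτd _ _)
      simpa only [hσ] using h1
    have hgs : ∀ᶠ z in 𝓝[S] x, g z ∈ (φ i).source :=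
      hgc.eventually (by rw [hgx]; exact (φ i).open_source.mem_nhds hs)
    have c1 : ContinuousWithinAt (fun z => ((φ i (σ (t (m + 1)))).1, (φ i (g z)).2)) S x :=
      continuousWithinAt_const.prodMk (ContinuousAt.comp_continuousWithinAt (g := φ i)
        ((φ i).continuousAt (by rw [hgx]; exact hs)) hgc).snd
    have hx1 : ((φ i (σ (t (m + 1)))).1, (φ i (g x)).2) = φ i (σ (t (m + 1))) := by
      rw [hgx, heq]
    have ht : ∀ᶠ z in 𝓝[S] x, ((φ i (σ (t (m + 1)))).1, (φ i (g z)).2) ∈ (φ i).target :=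
      c1.eventually (by beta_reduce; rw [hx1]; exact (φ i).open_target.mem_nhds ((φ i).map_source hs'))
    refine ⟨fun z => (φ i).symm ((φ i (σ (t (m + 1)))).1, (φ i (g z)).2),
      Slides.step (t m) _ g _ (φ i) hg hm (hφ i) hi ?_ ?_ ?_⟩
    · refine ContinuousAt.comp_continuousWithinAt (g := (φ i).symm) ?_ c1
      rw [hx1]
      exact (φ i).continuousAt_symm ((φ i).map_source hs')
    · rw [hx1, (φ i).left_inv hs']
    · filter_upwards [hgs, ht] with z h1 h2
      refine mem_plaque (hconv i) h1 ((φ i).map_target h2) ?_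
      rw [(φ i).right_inv h2]

/-- Maps which preserve the developing map are given by sliding. -/
lemma slides_of_eventually_eq {S : Set X} (hx : x ∈ S) {k : X → X}
    (hk : ContinuousWithinAt k S x) (hkx : k x = x')
    (hkd : ∀ᶠ r in 𝓝 (τ 0, τ 1), π r.1 ∈ S → k (π r.1) = π r.2 → d r.1 = d r.2) :
    F.Slides σ S 1 k := by
  obtain ⟨g, hg⟩ := exists_slides hd hτ hσ hτd hx
  obtain ⟨hgc, hgx, hgd⟩ := eventually_eq_of_slides hd hτ hσ hτd hx hg
  obtain ⟨φ₀, hφ₀, hxφ₀⟩ := F.covers x'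
  obtain ⟨φ, hφ, hxφ, hconv⟩ := exists_convex_chart hφ₀ hxφ₀
  rw [σ.target] at hgx
  have h0 : π (τ 0) = x := by rw [hσ, σ.source]
  have h1 : π (τ 1) = x' := by rw [hσ, σ.target]
  -- A final step of zero duration replaces an arbitrary sliding `g` by `k`: both preserve `d`, so
  -- near the end of `σ` their values lie in a common plaque of a convex chart.
  refine Slides.step 1 1 g k φ hg le_rfl hφ ?_ hk (by rw [hkx, σ.target]) ?_
  · intro r hr
    rw [Icc_self, mem_singleton_iff] at hr
    rw [hr, σ.target]
    exact hxφ
  have hgs : ∀ᶠ z in 𝓝[S] x, g z ∈ φ.source :=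
    hgc.eventually (by rw [hgx]; exact φ.open_source.mem_nhds hxφ)
  have hks : ∀ᶠ z in 𝓝[S] x, k z ∈ φ.source :=
    hk.eventually (by rw [hkx]; exact φ.open_source.mem_nhds hxφ)
  have hT : Tendsto (fun z => (z, (k z, g z))) (𝓝[S] x)
      (𝓝 (Prod.map π (Prod.map π π) (τ 0, (τ 1, τ 1)))) := by
    have h2 : Tendsto (fun z => z) (𝓝[S] x) (𝓝 x) := tendsto_id.mono_left nhdsWithin_le_nhds
    have h3 := h2.prodMk_nhds (hk.tendsto.prodMk_nhds hgc.tendsto)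
    rw [hkx, hgx] at h3
    simpa only [Prod.map, h0, h1] using h3
  have hev := eventually_snd_eq_iff hd hφ (y := τ 1) (by rwa [h1])
  have c1 : ContinuousAt (fun r : Y × (Y × Y) => (r.1, r.2.1)) (τ 0, (τ 1, τ 1)) := by fun_prop
  have c2 : ContinuousAt (fun r : Y × (Y × Y) => (r.1, r.2.2)) (τ 0, (τ 1, τ 1)) := by fun_prop
  have c3 : ContinuousAt (fun r : Y × (Y × Y) => r.2) (τ 0, (τ 1, τ 1)) := by fun_prop
  have hopen : IsOpenMap (Prod.map π (Prod.map π π)) :=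
    hd.isOpenMap_proj.prodMap (hd.isOpenMap_proj.prodMap hd.isOpenMap_proj)
  filter_upwards [hgs, hks, self_mem_nhdsWithin,
    hopen.eventually_exists_lift_of_tendsto hT
      (Q := fun r => (π r.1.1 ∈ S → k (π r.1.1) = π r.1.2.1 → d r.1.1 = d r.1.2.1) ∧
        (π r.1.1 ∈ S → g (π r.1.1) = π r.1.2.2 → d r.1.1 = d r.1.2.2) ∧
        ((φ (π r.1.2.1)).2 = (φ (π r.1.2.2)).2 ↔ d r.1.2.1 = d r.1.2.2))
      (tendsto_fst.eventually
        ((c1.eventually hkd).and ((c2.eventually hgd).and (c3.eventually hev))))]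
    with z z1 z2 hz ⟨r, hr, r1, r2, r3⟩
  have e1 : π r.1 = z := congrArg Prod.fst hr
  have e2 : π r.2.1 = k z := congrArg (fun a => a.2.1) hr
  have e3 : π r.2.2 = g z := congrArg (fun a => a.2.2) hr
  simp only [e1, e2, e3] at r1 r2 r3
  exact mem_plaque hconv z1 z2 (r3.2 ((r1 hz trivial).symm.trans (r2 hz trivial)))

end Path

/-- The image of a transversal under the developing map is open. -/
lemma eventually_exists_mem_transversal {S : Set X} (hS : F.IsTransversal S) {y : Y}
    (hy : π y ∈ S) {Q : Y → Prop} (hQ : ∀ᶠ z in 𝓝 y, π z ∈ S → Q z) :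
    ∀ᶠ m in 𝓝 (d y), ∃ z, d z = m ∧ π z ∈ S ∧ Q z := by
  obtain ⟨φ, hφ, hyφ, hSφ⟩ := hS _ hy
  have c : ContinuousAt (fun z => ((φ (π y)).1, (φ (π z)).2)) y :=
    continuousAt_const.prodMk (ContinuousAt.comp (g := φ) (f := π) (φ.continuousAt hyφ)
      hd.continuous_proj.continuousAt).snd
  have hy0 : φ.symm ((φ (π y)).1, (φ (π y)).2) = π y := φ.left_inv hyφ
  have hT : ContinuousAt (fun z => φ.symm ((φ (π y)).1, (φ (π z)).2)) y :=
    ContinuousAt.comp (g := φ.symm) (f := fun z => ((φ (π y)).1, (φ (π z)).2))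
      (φ.continuousAt_symm (φ.map_source hyφ)) c
  -- A point `w` is exchanged for one with the same transverse coordinate and the leafwise
  -- coordinate of `π y`; this point lies over `S`, and `d` is unchanged.
  have h1 : ∀ᶠ w in 𝓝 y, ∃ z, π z = φ.symm ((φ (π y)).1, (φ (π w)).2) ∧
      (((φ (π z)).2 = (φ (π w)).2 ↔ d z = d w) ∧ (π z ∈ S → Q z)) :=
    hd.isOpenMap_proj.eventually_exists_lift hT hy0.symm
      ((eventually_snd_eq_iff hd hφ hyφ).and (continuousAt_fst.eventually hQ))
  have h2 : ∀ᶠ w in 𝓝 y, ((φ (π y)).1, (φ (π w)).2) ∈ φ.target :=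
    c.eventually (φ.open_target.mem_nhds (φ.map_source hyφ))
  filter_upwards [hd.isOpenMap.eventually_exists_lift (g := id) (a₀ := y) (a := d y)
    continuousAt_id rfl (continuousAt_fst.eventually (h1.and h2))] with m ⟨w, hw, ⟨z, hz, h3, h4⟩, h5⟩
  have h6 : φ (π z) = ((φ (π y)).1, (φ (π w)).2) := by rw [hz, φ.right_inv h5]
  have h7 : π z ∈ S := (hSφ _ (by rw [hz]; exact φ.map_target h5)).2 (by rw [h6])
  exact ⟨z, (h3.1 (by rw [h6])).trans hw, h7, h4 h7⟩

end Foliation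

namespace Foliation

/-! ### Holonomy classes in terms of the action of the deck transformations -/

variable {p q : ℕ} {X Y M : Type u} [TopologicalSpace X] [ChartedSpace (Cart (p + q)) X]
  [TopologicalSpace Y] [ChartedSpace (Cart (p + q)) Y]
  [IsManifold 𝓘(ℝ, Cart (p + q)) ∞ Y] [TopologicalSpace M] [ChartedSpace (Cart q) M]
  [IsManifold 𝓘(ℝ, Cart q) ∞ M] {F : Foliation p q X} {π : Y → X} {d : Y → M}

/-- `τ` is a lift of the leafwise path `σ` along `π`. -/
structure LeafPath.IsLift {x x' : X} (σ : F.LeafPath x x') (π : Y → X) (τ : unitInterval → Y) :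
    Prop where
  continuous : Continuous τ
  proj : ∀ t, π (τ t) = σ.toPath t

lemma LeafPath.IsLift.deck {x x' : X} {σ : F.LeafPath x x'} {τ : unitInterval → Y}
    (h : σ.IsLift π τ) (γ : deckGroup π) : σ.IsLift π (fun t => γ.1 (τ t)) :=
  ⟨γ.1.continuous.comp h.continuous, fun t => (γ.2 _).trans (h.proj t)⟩

lemma LeafPath.IsLift.proj_zero {x x' : X} {σ : F.LeafPath x x'} {τ : unitInterval → Y}
    (h : σ.IsLift π τ) : π (τ 0) = x := by rw [h.proj, σ.toPath.source]

lemma LeafPath.IsLift.proj_one {x x' : X} {σ : F.LeafPath x x'} {τ : unitInterval → Y}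
    (h : σ.IsLift π τ) : π (τ 1) = x' := by rw [h.proj, σ.toPath.target]

variable (hd : F.IsDevelopable π d)

include hd

lemma LeafPath.exists_isLift {x x' : X} (σ : F.LeafPath x x') {y : Y} (hy : π y = x) :
    ∃ τ, σ.IsLift π τ ∧ τ 0 = y := by
  have h0 : σ.toPath.toContinuousMap 0 = π y := σ.toPath.source.trans hy.symm
  refine ⟨hd.cover.covering.liftPath σ.toPath.toContinuousMap y h0,
    ⟨map_continuous _, fun t => ?_⟩, hd.cover.covering.liftPath_zero _ _ h0⟩
  exact congrFun (hd.cover.covering.liftPath_lifts σ.toPath.toContinuousMap y h0) t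

lemma LeafPath.IsLift.eq {x x' : X} {σ : F.LeafPath x x'} {τ : unitInterval → Y}
    (h : σ.IsLift π τ) (s t : unitInterval) : d (τ s) = d (τ t) := by
  have h1 : π ∘ τ = σ.toPath := funext h.proj
  let τ' : (F.pullback π hd.cover.localDiffeo).LeafPath (τ 0) (τ 1) :=
    ⟨⟨⟨τ, h.continuous⟩, rfl, rfl⟩, (isLeafwise_pullback_iff h.continuous).2 (by
      rw [h1]; exact σ.leafwise)⟩
  exact eq_of_sameLeaf hd (τ'.sameLeaf s t)

omit hd in
-- Near `(y, γ y)` the pairs with equal projections are the pairs `(z, γ z)`. So the left side says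
-- that `h(γ)` fixes `d z` for `z` over `S`, and such `d z` fill a neighbourhood of `d y`.
lemma leafAction_eventuallyEq_id_iff (hd : F.IsDevelopable π d) {S : Set X} (hS : F.IsTransversal S)
    {y : Y} (hy : π y ∈ S) (γ : deckGroup π) :
    (∀ᶠ r in 𝓝 (y, γ.1 y), π r.1 ∈ S → π r.1 = π r.2 → d r.1 = d r.2) ↔
      leafAction hd γ =ᶠ[𝓝 (d y)] id := by
  constructor
  · intro h
    have c : ContinuousAt (fun z => (z, γ.1 z)) y := by fun_prop
    have h1 : ∀ᶠ z in 𝓝 y, π z ∈ S → d z = d (γ.1 z) := by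
      filter_upwards [c.eventually h] with z hz hzS
      exact hz hzS (γ.2 z).symm
    filter_upwards [eventually_exists_mem_transversal hd hS hy h1] with m ⟨z, hz, _, hz'⟩
    rw [← hz, leafAction_apply hd]
    exact hz'.symm
  · intro h
    have c : ContinuousAt (fun r : Y × Y => (γ.1 r.1, r.2)) (y, γ.1 y) := by fun_prop
    have c' : ContinuousAt (fun r : Y × Y => d r.1) (y, γ.1 y) :=
      (hd.continuous.comp continuous_fst).continuousAt
    filter_upwards [c.eventually (hd.isLocalHomeomorph.eventually_injective (γ.1 y)),
      c'.eventually h] with r r1 r2 _ r3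
    have h2 : γ.1 r.1 = r.2 := r1 ((γ.2 _).trans r3)
    rw [← h2, ← leafAction_apply hd]
    exact r2.symm

/-- Leafwise paths are in the same holonomy class if and only if the deck transformations which
compare the endpoints of their lifts have the same germ on the leaf space. -/
lemma holRel_iff {x x' : X} {σ₁ σ₂ : F.LeafPath x x'} {τ₁ τ₂ : unitInterval → Y}
    (h₁ : σ₁.IsLift π τ₁) (h₂ : σ₂.IsLift π τ₂) (h0 : τ₁ 0 = τ₂ 0) {γ₁ γ₂ : deckGroup π}
    (h : γ₁.1 (τ₁ 1) = γ₂.1 (τ₂ 1)) :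
    F.HolRel x x' σ₁ σ₂ ↔ leafAction hd γ₁ =ᶠ[𝓝 (d (τ₁ 0))] leafAction hd γ₂ := by
  have hend : (γ₁⁻¹ * γ₂).1 (τ₂ 1) = τ₁ 1 := by
    show γ₁.1.symm (γ₂.1 (τ₂ 1)) = τ₁ 1
    rw [← h, γ₁.1.symm_apply_apply]
  -- The loop `σ₁ * σ₂⁻¹` lifts to `τ₁` followed by the reverse of the translate of `τ₂` by `γ₁⁻¹
  -- γ₂`. This lift runs from `y = τ₁ 0` to `γ₁⁻¹ γ₂ y`, so trivial holonomy means that `h(γ₁⁻¹ γ₂)`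
  -- is the identity near `d y`.
  let P₁ : Path (τ₁ 0) (τ₁ 1) := ⟨⟨τ₁, h₁.continuous⟩, rfl, rfl⟩
  let P₂ : Path ((γ₁⁻¹ * γ₂).1 (τ₁ 0)) (τ₁ 1) :=
    ⟨⟨fun t => (γ₁⁻¹ * γ₂).1 (τ₂ t), (h₂.deck _).continuous⟩, by rw [h0], hend⟩
  let τ := P₁.trans P₂.symm
  have hdP : ∀ t, d (P₂ t) = d (τ₁ 0) := fun t =>
    ((h₂.deck (γ₁⁻¹ * γ₂)).eq hd t 1).trans ((congrArg d hend).trans (h₁.eq hd 1 0))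
  have hτd : ∀ t, d (τ t) = d (τ₁ 0) := by
    intro t
    simp only [τ, Path.trans_apply, Path.symm_apply]
    split_ifs
    · exact h₁.eq hd _ 0
    · exact hdP _
  have hτπ : ∀ t, π (τ t) = σ₁.toPath.trans σ₂.toPath.symm t := by
    intro t
    simp only [τ, Path.trans_apply, Path.symm_apply]
    split_ifs
    · exact h₁.proj _
    · exact (h₂.deck (γ₁⁻¹ * γ₂)).proj _
  have hτdd : ∀ s t, d (τ s) = d (τ t) := fun s t => (hτd s).trans (hτd t).symm
  have hx : π (τ₁ 0) = x := h₁.proj_zero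
  have hτ0 : τ 0 = τ₁ 0 := τ.source
  have hτ1 : τ 1 = (γ₁⁻¹ * γ₂).1 (τ₁ 0) := τ.target
  have key : ∀ S, F.IsTransversal S → x ∈ S →
      (F.IsHolonomy (σ₁.toPath.trans σ₂.toPath.symm) S S id ↔
        leafAction hd (γ₁⁻¹ * γ₂) =ᶠ[𝓝 (d (τ₁ 0))] id) := by
    intro S hS hxS
    rw [← leafAction_eventuallyEq_id_iff hd hS (by rwa [hx]) (γ₁⁻¹ * γ₂)]
    constructor
    · intro hslides
      have hs := (eventually_eq_of_slides hd τ.continuous hτπ hτdd hxS hslides.1).2.2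
      rwa [hτ0, hτ1] at hs
    · intro hev
      exact ⟨slides_of_eventually_eq hd τ.continuous hτπ hτdd hxS continuousWithinAt_id rfl
        (by rwa [hτ0, hτ1]),
        self_mem_nhdsWithin⟩
  have h3 : leafAction hd (γ₁⁻¹ * γ₂) =ᶠ[𝓝 (d (τ₁ 0))] id ↔
      leafAction hd γ₁ =ᶠ[𝓝 (d (τ₁ 0))] leafAction hd γ₂ := by
    refine eventually_congr (Eventually.of_forall fun m => ?_)
    rw [map_mul, map_inv, Equiv.Perm.mul_apply, Equiv.Perm.inv_eq_iff_eq, eq_comm]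
    rfl
  rw [← h3]
  constructor
  · intro hrel
    obtain ⟨φ, hφ, hxφ⟩ := F.covers x
    exact (key _ (isTransversal_slice hφ x) ⟨hxφ, rfl⟩).1
      (hrel _ (isTransversal_slice hφ x) ⟨hxφ, rfl⟩)
  · intro hev S hS hxS
    exact (key S hS hxS).2 hev

/-- With lifts of the endpoints fixed, `HolRel` is equality of germs. This is needed because arrows
are defined with `Quot`, whose equality is a priori only the generated equivalence relation. -/
lemma equivalence_holRel (hπ : IsGaloisCover (p + q) π) (x x' : X) :
    Equivalence (F.HolRel x x') := by
  by_cases hne : Nonempty (F.LeafPath x x')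
  swap
  · exact ⟨fun σ => (hne ⟨σ⟩).elim, fun {σ} => (hne ⟨σ⟩).elim, fun {σ} => (hne ⟨σ⟩).elim⟩
  obtain ⟨σ₀⟩ := hne
  obtain ⟨y, rfl⟩ := hd.cover.surjective x
  obtain ⟨z, rfl⟩ := hd.cover.surjective x'
  choose τ hτ hτ0 using fun σ : F.LeafPath (π y) (π z) => σ.exists_isLift hd rfl
  have h1 : ∀ σ, ∃ γ : deckGroup π, γ.1 (τ σ 1) = z := fun σ => by
    obtain ⟨γ, hγ, h⟩ := hπ.transitive (τ σ 1) z (hτ σ).proj_one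
    exact ⟨⟨γ, hγ⟩, h⟩
  choose γ hγ using h1
  have key : ∀ σ₁ σ₂, F.HolRel (π y) (π z) σ₁ σ₂ ↔
      leafAction hd (γ σ₁) =ᶠ[𝓝 (d y)] leafAction hd (γ σ₂) := by
    intro σ₁ σ₂
    rw [holRel_iff hd (hτ σ₁) (hτ σ₂) ((hτ0 _).trans (hτ0 _).symm) ((hγ σ₁).trans (hγ σ₂).symm),
      hτ0]
  refine ⟨fun σ => ?_, fun {σ₁ σ₂} => ?_, fun {σ₁ σ₂ σ₃} => ?_⟩
  · rw [key]
  · rw [key, key]; exact fun h => h.symm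
  · rw [key, key, key]; exact fun h h' => h.trans h'

lemma quot_mk_eq_iff (hπ : IsGaloisCover (p + q) π) {x x' : X} {σ₁ σ₂ : F.LeafPath x x'} :
    (Quot.mk (F.HolRel x x') σ₁ = Quot.mk _ σ₂) ↔ F.HolRel x x' σ₁ σ₂ := by
  rw [Quot.eq, (equivalence_holRel hd hπ x x').eqvGen_iff]

omit hd in
/-- The holonomy groupoid, presented by germs of elements of the developing pseudogroup. -/
def holPresentation (hd : F.IsDevelopable π d) (hπ : IsGaloisCover (p + q) π) :
    GermPresentation (developingPseudogroup hd) π d F.HolArrow where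
  src := HolArrow.src
  tgt := HolArrow.tgt
  Rep g y z θ := θ ∈ developingPseudogroup hd ∧ d y ∈ θ.source ∧
    ∃ σ : F.LeafPath g.src g.tgt, g.cls = Quot.mk _ σ ∧ ∃ τ, σ.IsLift π τ ∧ τ 0 = y ∧
      ∃ γ : deckGroup π, γ.1 (τ 1) = z ∧ θ =ᶠ[𝓝 (d y)] leafAction hd γ
  isLocalHomeomorph := hd.isLocalHomeomorph
  surjective := hd.cover.surjective
  continuous_d := hd.continuous
  isOpenMap_d := hd.isOpenMap
  mem h := h.1
  base_mem h := h.2.1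
  map_base := by
    rintro g y z θ ⟨-, -, σ, -, τ, hτ, rfl, γ, rfl, h⟩
    rw [h.self_of_nhds, hτ.eq hd 0 1, leafAction_apply hd]
  src_eq := by
    rintro g y z θ ⟨-, -, σ, -, τ, hτ, rfl, γ, rfl, h⟩
    exact hτ.proj_zero
  tgt_eq := by
    rintro g y z θ ⟨-, -, σ, -, τ, hτ, rfl, γ, rfl, h⟩
    exact (γ.2 _).trans hτ.proj_one
  exists_rep := by
    intro g y z hy hz
    obtain ⟨σ, hσ⟩ := Quot.exists_rep g.cls
    obtain ⟨τ, hτ, hτ0⟩ := σ.exists_isLift hd hy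
    obtain ⟨γ, hγ, hγz⟩ := hπ.transitive (τ 1) z (hτ.proj_one.trans hz.symm)
    exact ⟨(leafHomeo hd ⟨γ, hγ⟩).toOpenPartialHomeomorph, leafHomeo_mem hd _, mem_univ _, σ,
      hσ.symm, τ, hτ, hτ0, ⟨γ, hγ⟩, hγz, EventuallyEq.refl _ _⟩
  exists_arrow := by
    intro y z θ hθ hy hz
    obtain ⟨γ, hγ⟩ := eventuallyEq_leafAction hd hθ hy
    -- Since `γ y` and `z` lie in one fiber of `d`, they are joined by a leafwise path. Its
    -- projection to `X` is the required path, and translating by `γ⁻¹` gives the lift that starts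
    -- at `y`.
    have h1 : d (γ.1 y) = d z := by rw [← hz, hγ.self_of_nhds, leafAction_apply hd]
    obtain ⟨τ⟩ := (hd.simple.fibers _ _).1 h1
    let σ : F.LeafPath (π y) (π z) :=
      ⟨(τ.toPath.map hd.continuous_proj).cast (γ.2 y).symm rfl,
        (isLeafwise_pullback_iff τ.toPath.continuous).1 τ.leafwise⟩
    have hlift : σ.IsLift π (fun t => γ⁻¹.1 (τ.toPath t)) :=
      LeafPath.IsLift.deck ⟨τ.toPath.continuous, fun t => rfl⟩ γ⁻¹
    refine ⟨σ.hol, hθ, hy, σ, rfl, _, hlift, ?_, γ, ?_, hγ⟩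
    · show γ.1.symm (τ.toPath 0) = y
      rw [τ.toPath.source, γ.1.symm_apply_apply]
    · show γ.1 (γ.1.symm (τ.toPath 1)) = z
      rw [τ.toPath.target, γ.1.apply_symm_apply]
  eq_iff := by
    rintro ⟨x₁, x₁', c₁⟩ ⟨x₂, x₂', c₂⟩ y z θ θ' ⟨-, -, σ, hσ, τ, hτ, h0, γ, h1, h⟩
      ⟨-, -, σ', hσ', τ', hτ', h0', γ', h1', h'⟩
    dsimp only at σ hσ hτ σ' hσ' hτ'
    have e1 : x₁ = x₂ := by rw [← hτ.proj_zero, ← hτ'.proj_zero, h0, h0']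
    have e2 : x₁' = x₂' := by
      rw [← hτ.proj_one, ← hτ'.proj_one, ← γ.2 (τ 1), ← γ'.2 (τ' 1), h1, h1']
    subst e1 e2 hσ hσ' h0
    have h2 := holRel_iff hd hτ hτ' h0'.symm (h1.trans h1'.symm)
    rw [HolArrow.mk.injEq, heq_eq_eq, quot_mk_eq_iff hd hπ]
    simp only [true_and]
    rw [h2]
    exact ⟨fun e => h.trans (e.trans h'.symm), fun e => h.symm.trans (e.trans h')⟩
  change := by
    intro y y' hy
    obtain ⟨γ, hγ, rfl⟩ := hπ.transitive y y' hy
    lift γ to deckGroup π using hγ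
    refine ⟨(leafHomeo hd γ).toOpenPartialHomeomorph, leafHomeo_mem hd γ, mem_univ _, ?_⟩
    have c : ContinuousAt (fun r : Y × Y => (γ.1 r.1, r.2)) (y, γ.1 y) := by fun_prop
    filter_upwards [c.eventually (hd.isLocalHomeomorph.eventually_injective (γ.1 y))]
      with ⟨a, b⟩ hab hab'
    obtain rfl : γ.1 a = b := hab ((γ.2 a).trans hab')
    refine ⟨leafHomeo_apply hd γ a, ?_, ?_⟩
    · rintro g z θ ⟨hθ, ha, σ, hσ, τ, hτ, hτ0, δ, hδ, hev⟩
      refine ⟨(developingPseudogroup hd).trans (leafHomeo_mem hd γ) hθ, ⟨mem_univ _, ?_⟩, σ, hσ,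
        _, hτ.deck γ⁻¹, ?_, δ * γ, ?_, ?_⟩
      · show (leafHomeo hd γ).toOpenPartialHomeomorph (d a) ∈ θ.source
        rwa [leafHomeo_apply]
      · show γ.1.symm (τ 0) = a
        rw [hτ0, γ.1.symm_apply_apply]
      · show δ.1 (γ.1 (γ.1.symm (τ 1))) = z
        rw [γ.1.apply_symm_apply, hδ]
      · have c1 : Tendsto (leafAction hd γ) (𝓝 (d a)) (𝓝 (d (γ.1 a))) := by
          rw [← leafAction_apply hd]
          exact (contMDiff_leafAction hd γ).continuous.continuousAt
        filter_upwards [c1.eventually hev] with m hm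
        rw [map_mul]
        exact hm
    · rintro g z θ ⟨hθ, ha, σ, hσ, τ, hτ, hτ0, δ, hδ, hev⟩
      refine ⟨(developingPseudogroup hd).trans hθ (leafHomeo_mem hd γ), ?_, σ, hσ, τ, hτ, hτ0,
        γ * δ, congrArg γ.1 hδ, ?_⟩
      · simpa using ha
      · filter_upwards [hev] with m hm
        rw [map_mul]
        exact congrArg (leafAction hd γ) hm

end Foliation

/-- Near `a`, the map `g` factors through `f`; outside the image of the neighbourhood the value of
`k` is immaterial. -/
lemma exists_eventually_eq_comp {E A B : Type*} [TopologicalSpace E] [Nonempty B] {f : E → A}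
    {g : E → B} {a : E} (h : ∀ᶠ r in 𝓝 (a, a), f r.1 = f r.2 → g r.1 = g r.2) :
    ∃ k : A → B, ∀ᶠ b in 𝓝 a, g b = k (f b) := by
  obtain ⟨U, hU, hUh⟩ := mem_prod_same_iff.1 (by rwa [nhds_prod_eq] at h)
  have hfac : Function.FactorsThrough (fun b : U => g b) (fun b : U => f b) :=
    fun b c hbc => hUh (mk_mem_prod b.2 c.2) hbc
  refine ⟨Function.extend (fun b : U => f b) (fun b : U => g b) (fun _ => Classical.arbitrary B),
    ?_⟩
  filter_upwards [hU] with b hb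
  exact (hfac.extend_apply _ ⟨b, hb⟩).symm

namespace Foliation

/-! ### The standard charts of the holonomy groupoid -/

variable {p q : ℕ} {X Y M : Type u} [TopologicalSpace X] [ChartedSpace (Cart (p + q)) X]
  [TopologicalSpace Y] [ChartedSpace (Cart (p + q)) Y]
  [IsManifold 𝓘(ℝ, Cart (p + q)) ∞ Y] [TopologicalSpace M] [ChartedSpace (Cart q) M]
  [IsManifold 𝓘(ℝ, Cart q) ∞ M] {F : Foliation p q X} {π : Y → X} {d : Y → M}
  (hd : F.IsDevelopable π d) (hπ : IsGaloisCover (p + q) π)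

include hd hπ

/-- The transverse coordinates of `φ` and of any foliated chart are both locally equivalent to `d`,
hence to each other, and the foliated atlas is maximal. -/
lemma mem_charts_of_isAdaptedChart {φ : OpenPartialHomeomorph X (Cart p × Cart q)}
    (hφ : IsAdaptedChart (EB := Cart (p + q)) π d φ) : φ ∈ F.charts := by
  have key : ∀ χ ∈ F.charts, ∀ y, π y ∈ φ.source → π y ∈ χ.source →
      ∀ᶠ r in 𝓝 (y, y), (φ (π r.1)).2 = (φ (π r.2)).2 ↔ (χ (π r.1)).2 = (χ (π r.2)).2 := by
    intro χ hχ y h1 h2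
    filter_upwards [(holPresentation hd hπ).eventually_basic hφ h1,
      eventually_snd_eq_iff hd hχ h2] with r r1 r2
    rw [r1, r2]
  have hdesc : ∀ (f g : X → Cart q) (y : Y),
      (∀ᶠ r in 𝓝 (y, y), f (π r.1) = f (π r.2) → g (π r.1) = g (π r.2)) →
      ∃ k : Cart q → Cart q, ∀ᶠ x in 𝓝 (π y), g x = k (f x) := by
    intro f g y h
    obtain ⟨k, hk⟩ := exists_eventually_eq_comp (f := f ∘ π) (g := g ∘ π) h
    refine ⟨k, ?_⟩
    filter_upwards [hd.isOpenMap_proj.image_mem_nhds hk] with x ⟨z, hz, hzx⟩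
    rw [← hzx]
    exact hz
  refine F.maximal φ ⟨hφ.smooth, hφ.smooth_symm⟩ fun χ hχ => ⟨?_, ?_⟩
  · rintro x ⟨h1, h2⟩
    obtain ⟨y, rfl⟩ := hd.cover.surjective x
    exact hdesc (fun x => (φ x).2) (fun x => (χ x).2) y ((key χ hχ y h1 h2).mono fun r hr => hr.1)
  · rintro x ⟨h2, h1⟩
    obtain ⟨y, rfl⟩ := hd.cover.surjective x
    exact hdesc (fun x => (χ x).2) (fun x => (φ x).2) y ((key χ hχ y h1 h2).mono fun r hr => hr.2)

lemma rep_hol {x x' : X} {σ : F.LeafPath x x'} {τ : unitInterval → Y} (h : σ.IsLift π τ) :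
    (holPresentation hd hπ).Rep σ.hol (τ 0) (τ 1) (OpenPartialHomeomorph.refl M) :=
  ⟨(developingPseudogroup hd).id_mem, mem_univ _, σ, rfl, τ, h, rfl, 1, rfl, by
    rw [map_one]; exact EventuallyEq.refl _ _⟩

/-- If the lift of `τ` starts where the lift of `σ` ends, the two paths and their concatenation are
all presented by the identity of `M`. -/
lemma mul_hol {x y z : X} (σ : F.LeafPath x y) (τ : F.LeafPath y z) (c) :
    (holPresentation hd hπ).mul τ.hol σ.hol c = (σ.trans τ).hol := by
  obtain ⟨x₀, hx₀⟩ := hd.cover.surjective x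
  obtain ⟨a, ha, ha0⟩ := σ.exists_isLift hd hx₀
  obtain ⟨b, hb, hb0⟩ := τ.exists_isLift hd ha.proj_one
  let A : Path x₀ (a 1) := ⟨⟨a, ha.continuous⟩, ha0, rfl⟩
  let B : Path (a 1) (b 1) := ⟨⟨b, hb.continuous⟩, hb0, rfl⟩
  have hAB : (σ.trans τ).IsLift π (A.trans B) := by
    refine ⟨(A.trans B).continuous, fun t => ?_⟩
    show _ = σ.toPath.trans τ.toPath t
    simp only [Path.trans_apply]
    split_ifs
    · exact ha.proj _
    · exact hb.proj _
  have h1 := rep_hol hd hπ hAB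
  rw [(A.trans B).source, (A.trans B).target] at h1
  have h2 := rep_hol hd hπ ha
  have h3 := rep_hol hd hπ hb
  rw [ha0] at h2
  rw [hb0] at h3
  have h4 := GermPresentation.Rep.mul c h2 h3
  rw [OpenPartialHomeomorph.refl_trans] at h4
  exact (holPresentation hd hπ).rep_ext h4 h1

/-- Holonomy between transversals and germs on `M` describe the same thing, since sliding preserves
`d` and `d` is locally equivalent to the transverse coordinates of both charts. -/
lemma chartSource_holPresentation {φ ψ : OpenPartialHomeomorph X (Cart p × Cart q)}
    (hφ : φ ∈ F.charts) (hψ : ψ ∈ F.charts) :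
    (holPresentation hd hπ).chartSource φ ψ = F.holChartSource φ ψ := by
  ext g
  obtain ⟨x, x', c⟩ := g
  obtain ⟨σ, rfl⟩ := Quot.exists_rep c
  obtain ⟨y, hy⟩ := hd.cover.surjective x
  constructor
  · intro hg
    obtain ⟨hx, hx', -⟩ := id hg
    replace hx : x ∈ φ.source := hx
    replace hx' : x' ∈ ψ.source := hx'
    obtain ⟨τ, hτ, hτ0⟩ := σ.exists_isLift hd hy
    have hiff : ∀ᶠ r in 𝓝 (τ 0, τ 1), d r.1 = d r.2 ↔ (φ (π r.1)).2 = (ψ (π r.2)).2 :=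
      (holPresentation hd hπ).chartSource_eventually_iff
        (isAdaptedChart_of_mem_charts hd hψ) hg (rep_hol hd hπ hτ)
    have hxx' : ((ψ x').1, (φ x).2) = ψ x' := by
      have h1 := hiff.self_of_nhds.1 (hτ.eq hd 0 1)
      rw [hτ.proj_zero, hτ.proj_one] at h1
      rw [h1]
    -- The holonomy between the slices is written down explicitly: `h` keeps the transverse
    -- coordinate and takes the leafwise coordinate of `x'`. It preserves `d`, so it is a sliding.
    let h : X → X := fun z => ψ.symm ((ψ x').1, (φ z).2)
    have hhx : h x = x' := by
      show ψ.symm ((ψ x').1, (φ x).2) = x'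
      rw [hxx', ψ.left_inv hx']
    have c1 : ContinuousAt (fun z => ((ψ x').1, (φ z).2)) x :=
      continuousAt_const.prodMk (φ.continuousAt hx).snd
    have htgt : ∀ᶠ z in 𝓝 x, ((ψ x').1, (φ z).2) ∈ ψ.target :=
      c1.eventually (by beta_reduce; rw [hxx']; exact ψ.open_target.mem_nhds (ψ.map_source hx'))
    have hh : ContinuousAt h x := by
      refine ContinuousAt.comp (g := ψ.symm) ?_ c1
      rw [hxx']
      exact ψ.continuousAt_symm (ψ.map_source hx')
    have c2 : Tendsto (fun r : Y × Y => π r.1) (𝓝 (τ 0, τ 1)) (𝓝 x) := by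
      rw [← hτ.proj_zero]
      exact (hd.continuous_proj.comp continuous_fst).continuousAt
    refine ⟨hx, hx', σ, rfl, slice φ x, slice ψ x', h, isTransversal_slice hφ x, ⟨hx, rfl⟩,
      isTransversal_slice hψ x', ⟨hx', rfl⟩, ⟨?_, ?_⟩, ?_⟩
    · refine slides_of_eventually_eq (S := slice φ x) hd hτ.continuous hτ.proj (hτ.eq hd)
        ⟨hx, rfl⟩ hh.continuousWithinAt hhx ?_
      filter_upwards [hiff, c2.eventually htgt] with r r1 r2 _ r4
      refine r1.2 ?_
      rw [← r4]
      show _ = (ψ (ψ.symm _)).2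
      rw [ψ.right_inv r2]
    · filter_upwards [mem_nhdsWithin_of_mem_nhds htgt] with z hz
      refine ⟨ψ.map_target hz, ?_⟩
      show (ψ (ψ.symm _)).1 = _
      rw [ψ.right_inv hz]
    · filter_upwards [mem_nhdsWithin_of_mem_nhds htgt] with z hz
      show (ψ (ψ.symm _)).2 = _
      rw [ψ.right_inv hz]
  · rintro ⟨hx, hx', σ, hσ, S, T, h, hS, hxS, hT, hxT, ⟨hslides, -⟩, hcoord⟩
    dsimp only at hx hx' σ hσ hxS hxT hslides hcoord
    rw [hσ]
    obtain ⟨τ, hτ, hτ0⟩ := σ.exists_isLift hd hy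
    refine ⟨hx, hx', _, _, _, rep_hol hd hπ hτ, ?_⟩
    show ∀ᶠ r in 𝓝 (τ 0, τ 1), d r.1 = d r.2 → (φ (π r.1)).2 = (ψ (π r.2)).2
    obtain ⟨hhc, hhx, hhd⟩ :=
      eventually_eq_of_slides hd hτ.continuous hτ.proj (hτ.eq hd) hxS hslides
    rw [σ.toPath.target] at hhx
    obtain ⟨U, hU, hφU⟩ := mem_prod_same_iff.1 (show _ ∈ 𝓝 (τ 0) ×ˢ 𝓝 (τ 0) by
      rw [← nhds_prod_eq]
      exact eventually_snd_eq_iff hd hφ (y := τ 0) (by rwa [hτ.proj_zero]))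
    obtain ⟨V, hV, hψV⟩ := mem_prod_same_iff.1 (show _ ∈ 𝓝 (τ 1) ×ˢ 𝓝 (τ 1) by
      rw [← nhds_prod_eq]
      exact eventually_snd_eq_iff hd hψ (y := τ 1) (by rwa [hτ.proj_one]))
    have c1 : Tendsto π (𝓝 (τ 0) ⊓ 𝓟 {z | π z ∈ S}) (𝓝[S] x) := by
      refine tendsto_nhdsWithin_iff.2 ⟨?_,
        mem_of_superset (mem_inf_of_right (mem_principal_self _)) fun r hr => hr⟩
      rw [← hτ.proj_zero]
      exact hd.continuous_proj.continuousAt.mono_left inf_le_left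
    have c2 : Tendsto (fun z => h (π z)) (𝓝 (τ 0) ⊓ 𝓟 {z | π z ∈ S}) (𝓝 (π (τ 1))) := by
      rw [hτ.proj_one, ← hhx]
      exact hhc.tendsto.comp c1
    have c3 : Tendsto (fun r : Y × Y => (r.2, r.1)) (𝓝 (τ 1) ×ˢ (𝓝 (τ 0) ⊓ 𝓟 {z | π z ∈ S}))
        (𝓝 (τ 0, τ 1)) := by
      rw [nhds_prod_eq]
      exact (tendsto_snd.mono_right inf_le_left).prodMk tendsto_fst
    have h1 := hd.isOpenMap_proj.eventually_exists_lift_of_tendsto c2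
      ((c3.eventually hhd).and (tendsto_fst.eventually hV))
    -- A point near `τ 0` may be off `S`, so it is replaced by `z` over `S` with the same value of
    -- `d`. The holonomy takes `π z` to `π w` with `w` near `τ 1` and `d w = d z`, and there the
    -- coordinate condition applies.
    have h2 := eventually_exists_mem_transversal hd hS (y := τ 0) (by rwa [hτ.proj_zero])
      (((eventually_inf_principal.1 h1).and ((eventually_inf_principal.1
        (c1.eventually hcoord)).and (mem_of_superset hU fun _ => id))).mono
        fun z hz hzS => And.intro (hz.1 hzS) (And.intro (hz.2.1 hzS) hz.2.2))
    have c4 : ContinuousAt (fun r : Y × Y => d r.1) (τ 0, τ 1) :=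
      (hd.continuous.comp continuous_fst).continuousAt
    filter_upwards [c4.eventually h2, prod_mem_nhds hU hV] with r ⟨z, hz, hzS, h3, h4, h5⟩ h6 h7
    obtain ⟨w, hw, hw1, hw2⟩ := h3
    have e1 : (φ (π r.1)).2 = (φ (π z)).2 := (hφU (mk_mem_prod h6.1 h5)).2 hz.symm
    have e2 : (ψ (π r.2)).2 = (ψ (π w)).2 :=
      (hψV (mk_mem_prod h6.2 hw2)).2 (h7.symm.trans (hz.symm.trans (hw1 hzS hw.symm)))
    rw [e1, e2, hw, h4]

end Foliation

/-! ### The standard charts of the germ groupoid -/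

section GermCharts

variable {E : Type} [NormedAddCommGroup E] [NormedSpace ℝ E] {M : Type u} [TopologicalSpace M]
  [ChartedSpace E M] {Ψ : StructureGroupoid M}

/-- From the coordinates `c` to the coordinates `c ∘ ψ.symm`, the germs that are the identity are
precisely those of `ψ`. -/
lemma chartSource_germPresentation {ψ : OpenPartialHomeomorph M M} (hψ : ψ ∈ Ψ)
    (c : OpenPartialHomeomorph M E) :
    (germPresentation Ψ).chartSource
      ((c.restr ψ.source).transHomeomorph
        (ContinuousLinearEquiv.uniqueProd ℝ E (Cart 0)).symm.toHomeomorph)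
      ((ψ.symm.trans c).transHomeomorph
        (ContinuousLinearEquiv.uniqueProd ℝ E (Cart 0)).symm.toHomeomorph) =
      {g | ∃ x, ∃ hx : x ∈ ψ.source, x ∈ c.source ∧ g = GermArrow.of ψ hψ x hx} := by
  have hs : ∀ x, x ∈ (c.restr ψ.source).source ↔ x ∈ c.source ∧ x ∈ ψ.source := fun x => by
    rw [OpenPartialHomeomorph.restr_source, ψ.open_source.interior_eq]; rfl
  have ht : ∀ x, x ∈ (ψ.symm.trans c).source ↔ x ∈ ψ.target ∧ ψ.symm x ∈ c.source := fun x => by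
    rw [OpenPartialHomeomorph.trans_source]; rfl
  ext g
  constructor
  · rintro ⟨h1, h2, y, z, θ, ⟨hyz, hθ, hy, rfl⟩, h3⟩
    obtain ⟨h1, h1'⟩ := (hs y).1 h1
    obtain ⟨h2, h2'⟩ := (ht (θ y)).1 h2
    subst hyz
    replace h3 : ∀ᶠ r in 𝓝 (y, θ y), θ r.1 = r.2 → c r.1 = c (ψ.symm r.2) := h3
    refine ⟨y, h1', h1, GermArrow.of_eq_of_iff.2 ?_⟩
    have c1 : ContinuousAt (fun a => (a, θ a)) y := continuousAt_id.prodMk (θ.continuousAt hy)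
    have c2 : ContinuousAt (fun a => ψ.symm (θ a)) y :=
      ContinuousAt.comp (g := ψ.symm) (ψ.continuousAt_symm h2) (θ.continuousAt hy)
    filter_upwards [c1.eventually h3, c2.eventually (c.open_source.mem_nhds h2'),
      (θ.continuousAt hy).eventually (ψ.open_target.mem_nhds h2), c.open_source.mem_nhds h1]
      with a a1 a2 a3 a4
    have := c.injOn a4 a2 (a1 rfl)
    rw [← ψ.right_inv a3, ← this]
  · rintro ⟨x, hx, hxc, rfl⟩
    refine ⟨(hs x).2 ⟨hxc, hx⟩, (ht (ψ x)).2 ⟨ψ.map_source hx, by rwa [ψ.left_inv hx]⟩, _, _, _,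
      germPresentation_rep hψ hx, ?_⟩
    show ∀ᶠ r in 𝓝 (x, ψ x), ψ r.1 = r.2 → c r.1 = c (ψ.symm r.2)
    filter_upwards [continuousAt_fst.eventually (ψ.open_source.mem_nhds hx)] with r r1 r2
    rw [← r2, ψ.left_inv r1]

end GermCharts

/-! ### The holonomy groupoid and the germ groupoid as Lie groupoids -/

section LieGroupoids

/-- `ℝ^(p + q)` as a product. -/
def cartProd (p q : ℕ) : Cart (p + q) ≃L[ℝ] Cart p × Cart q :=
  ContinuousLinearEquiv.ofFinrankEq (by simp)

variable {p q : ℕ} {X Y M : Type u}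
  [TopologicalSpace X] [T2Space X] [SecondCountableTopology X]
  [ChartedSpace (Cart (p + q)) X] [IsManifold 𝓘(ℝ, Cart (p + q)) ∞ X]
  [TopologicalSpace Y] [ChartedSpace (Cart (p + q)) Y] [IsManifold 𝓘(ℝ, Cart (p + q)) ∞ Y]
  [TopologicalSpace M] [ChartedSpace (Cart q) M] [IsManifold 𝓘(ℝ, Cart q) ∞ M]

lemma Foliation.isHolonomyGroupoid {F : Foliation p q X} {π : Y → X} {d : Y → M}
    (hd : F.IsDevelopable π d) (hπ : IsGaloisCover (p + q) π) [TopologicalSpace F.HolArrow]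
    [ChartedSpace (Cart p × Cart q × Cart p) F.HolArrow]
    (hS : (holPresentation hd hπ).IsSmoothStructure (EB := Cart (p + q))
      (ContinuousLinearEquiv.refl ℝ (Cart p × Cart q × Cart p)))
    (κ : Cart (p + q) ≃L[ℝ] Cart p × Cart q) : IsHolonomyGroupoid F (hS.lieGroupoid κ) where
  src_eq _ := rfl
  tgt_eq _ := rfl
  mul_eq := mul_hol hd hπ
  charts_covers g := by
    obtain ⟨φ, ψ, hφ, hψ, hg⟩ := hS.exists_chartSource g
    have h1 := mem_charts_of_isAdaptedChart hd hπ hφ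
    have h2 := mem_charts_of_isAdaptedChart hd hπ hψ
    exact ⟨φ, h1, ψ, h2, chartSource_holPresentation hd hπ h1 h2 ▸ hg⟩
  charts_mem φ hφ ψ hψ := by
    obtain ⟨e, he, hsrc, hκ⟩ := hS.chart_mem φ ψ (isAdaptedChart_of_mem_charts hd hφ)
      (isAdaptedChart_of_mem_charts hd hψ)
    exact ⟨e, he, hsrc.trans (chartSource_holPresentation hd hπ hφ hψ), fun g _ => hκ g⟩

variable [T2Space M] [SecondCountableTopology M]

/-- The condition `hκ` makes the identification of model spaces the bare middle coordinate, so that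
the chart is `c` itself and not `c` followed by a linear automorphism. -/
lemma isGermGroupoid {Ψ : StructureGroupoid M} (hΨ : IsSmoothPseudogroup (FQ := Cart q) Ψ)
    [TopologicalSpace (GermArrow Ψ)] [ChartedSpace (Cart q) (GermArrow Ψ)]
    {κ : Cart q ≃L[ℝ] Cart 0 × Cart q × Cart 0} (hκ : ∀ v, (κ v).2.1 = v)
    (hS : (germPresentation Ψ).IsSmoothStructure (EB := Cart q) κ)
    (κ' : Cart q ≃L[ℝ] Cart 0 × Cart q) : IsGermGroupoid Ψ (hS.lieGroupoid κ') where
  src_of _ _ _ _ := rfl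
  tgt_of _ _ _ _ := rfl
  mul_of ψ χ hψ hχ x hx hy c := by
    refine (germPresentation Ψ).rep_ext
      (GermPresentation.Rep.mul c (germPresentation_rep hψ hx) (germPresentation_rep hχ hy)) ?_
    exact germPresentation_rep (Ψ.trans hψ hχ) (by simp [hx, hy])
  charts_mem ψ hψ c hc := by
    have h1 := (IsManifold.mem_maximalAtlas_iff_contMDiffOn (I := 𝓘(ℝ, Cart q)) (n := ∞) c).1 hc
    have h2 := (IsManifold.mem_maximalAtlas_iff_contMDiffOn (I := 𝓘(ℝ, Cart q)) (n := ∞) _).1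
      (hΨ.trans_mem_maximalAtlas (Ψ.symm hψ) hc)
    obtain ⟨e, he, hsrc, hκe⟩ := hS.chart_mem _ _
      (isAdaptedChart_uniqueProd (c := c.restr ψ.source)
        (h1.1.mono (c.restr_source ψ.source ▸ inter_subset_left))
        (h1.2.mono inter_subset_left))
      (isAdaptedChart_uniqueProd h2.1 h2.2)
    refine ⟨e, he, hsrc.trans (chartSource_germPresentation hψ c), fun g _ => ?_⟩
    rw [← hκ (e g), hκe]
    rfl

end LieGroupoids

end

/-! ### The Morita equivalence -/

theorem proposition4p3 {p q : ℕ} {X Y M : Type u}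
    [TopologicalSpace X] [T2Space X] [SecondCountableTopology X]
    [ChartedSpace (Cart (p + q)) X] [IsManifold 𝓘(ℝ, Cart (p + q)) ∞ X]
    [TopologicalSpace Y] [T2Space Y] [SecondCountableTopology Y]
    [ChartedSpace (Cart (p + q)) Y] [IsManifold 𝓘(ℝ, Cart (p + q)) ∞ Y]
    [TopologicalSpace M] [T2Space M] [SecondCountableTopology M]
    [ChartedSpace (Cart q) M] [IsManifold 𝓘(ℝ, Cart q) ∞ M]
    (F : Foliation p q X) (π : Y → X) (d : Y → M)
    (hd : F.IsDevelopable π d) (hπ : IsGaloisCover (p + q) π) :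
    ∃ (_ : TopologicalSpace F.HolArrow)
      (_ : ChartedSpace (Cart p × Cart q × Cart p) F.HolArrow)
      (_ : TopologicalSpace (GermArrow (Foliation.developingPseudogroup hd)))
      (_ : ChartedSpace (Cart q) (GermArrow (Foliation.developingPseudogroup hd)))
      (H : LieGroupoid (Cart (p + q)) (Cart p × Cart q × Cart p) X F.HolArrow)
      (G : LieGroupoid (Cart q) (Cart q) M (GermArrow (Foliation.developingPseudogroup hd))),
      IsHolonomyGroupoid F H ∧ IsGermGroupoid (Foliation.developingPseudogroup hd) G ∧
        LieGroupoid.MoritaEquivalent H G := by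
  have hΨ := Foliation.isSmoothPseudogroup_developingPseudogroup hd
  let PH := Foliation.holPresentation hd hπ
  let PG := germPresentation (Foliation.developingPseudogroup hd)
  -- The intermediate groupoid `K` over `Y`: an arrow from `y` to `z` is a germ in `Ψ` from `d y` to
  -- `d z`.
  let PK := PG.pullback hd.continuous hd.isOpenMap
  have hCH : HasAdaptedCharts (Cart (p + q)) (Cart p) (FQ := Cart q) π d :=
    hd.simple.submersion.hasAdaptedCharts_of_isLocalDiffeomorph hd.cover.localDiffeo
  have hCG : HasAdaptedCharts (Cart q) (Cart 0) (FQ := Cart q) (id : M → M) id :=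
    hasAdaptedCharts_id
  have hCK : HasAdaptedCharts (Cart (p + q)) (Cart p) (FQ := Cart q) (id : Y → Y) d :=
    hd.simple.submersion.hasAdaptedCharts
  let κ := ContinuousLinearEquiv.refl ℝ (Cart p × Cart q × Cart p)
  -- The germ groupoid is treated as the case of a foliation by points, with leafwise factors `Cart
  -- 0`.
  let κG : Cart q ≃L[ℝ] Cart 0 × Cart q × Cart 0 :=
    (ContinuousLinearEquiv.prodUnique ℝ (Cart q) (Cart 0)).symm.trans
      (ContinuousLinearEquiv.uniqueProd ℝ (Cart q × Cart 0) (Cart 0)).symm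
  let κG' : Cart q ≃L[ℝ] Cart 0 × Cart q :=
    (ContinuousLinearEquiv.uniqueProd ℝ (Cart q) (Cart 0)).symm
  obtain ⟨tH, cH, hH⟩ := PH.exists_isSmoothStructure κ (PH.exists_mem_chartSource hΨ hCH)
  obtain ⟨tG, cG, hG⟩ := PG.exists_isSmoothStructure κG (PG.exists_mem_chartSource hΨ hCG)
  obtain ⟨tK, cK, hK⟩ := PK.exists_isSmoothStructure κ (PK.exists_mem_chartSource hΨ hCK)
  refine ⟨tH, cH, tG, cG, hH.lieGroupoid (cartProd p q), hG.lieGroupoid κG',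
    Foliation.isHolonomyGroupoid hd hπ hH _, isGermGroupoid hΨ (fun v => rfl) hG _, ?_⟩
  refine ⟨Cart (p + q), Cart p × Cart q × Cart p, inferInstance, inferInstance, inferInstance,
    inferInstance, inferInstance, inferInstance, Y, _, inferInstance, inferInstance, tK, cK,
    hK.lieGroupoid (cartProd p q),
    GermPresentation.functor (f := id) (fun _ => rfl) hK (cartProd p q) hH (cartProd p q)
      continuous_id hd.cover.localDiffeo.contMDiff,
    GermPresentation.functor (f := d) (fun _ => rfl) hK (cartProd p q) hG κG' hd.continuous
      hd.contMDiff, ?_, ?_⟩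
  · exact GermPresentation.functor_isMorita _ _ _ _ _ _ _ hd.simple.surjective hCK hCH
  · exact GermPresentation.functor_isMorita _ _ _ _ _ _ _ hd.simple.surjective hCK hCG
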